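/- Let $G_{\mathbb C}\subset \mathrm{GL}(k,\mathbb C)$ be a connected linear algebraic group defined over $\mathbb R$, let $V_{\mathbb C}=\mathbb C^n$ with real structure $V_{\mathbb R}=\mathbb R^n$ (and $V_{\mathbb R}^*\simeq\mathbb R^n$), and let $\rho:G_{\mathbb C}\to \mathrm{GL}(V_{\mathbb C})$ be an $\mathbb R$-rational representation with a Zariski-dense orbit, so that $(G_{\mathbb C},\rho,V_{\mathbb C})$ is a prehomogeneous vector space over $\mathbb R$. Let $S_{\mathbb C}$ be the complement of the dense orbit, $S_{\mathbb R}=S_{\mathbb C}\cap V_{\mathbb R}$, let $G_{\mathbb R}=G_{\mathbb C}\cap \mathrm{GL}(k,\mathbb R)$ act on $V_{\mathbb R}$ by $gm=\rho(g)m$, let $F_{\mathbb R}$ be the set of fixed points of $G_{\mathbb R}$ in $V_{\mathbb R}$, and let $G$ be the connected component of the unit element $e$ of $G_{\mathbb R}$, with a left invariant Haar measure $d_G$ and with $|g|=d(g,e)$ the distance of a left invariant Riemannian metric on $G$. Let $f\in\mathcal S(G)$, that is, $f:G\to\mathbb C$ is smooth and for every $\kappa\ge 0$ and every element $X$ of the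 universal enveloping algebra of the complexified Lie algebra of $G$ one has $|dL(X)f(g)|\le C e^{-\kappa|g|}$ for some constant $C$, and $dL(X)f\in L^1(G,e^{\kappa|g|}d_G)$, where $L$ is the left regular representation. Let $\pi(f)=\int_G f(g)\pi(g)\,d_G(g)$ on the space $C_0(V_{\mathbb R})$ of continuous functions vanishing at infinity, where $(\pi(g)\phi)(m)=\phi(g^{-1}m)$, and put $$\hat f(m,\xi)=\int_G f(g)\,e^{i(g^{-1}m)\cdot\xi}\,d_G(g),\qquad a_f(m,\xi)=e^{-im\cdot\xi}\hat f(m,\xi),\qquad m\in V_{\mathbb R},\ \xi\in V_{\mathbb R}^*.$$ For open $U$, $S^l_{1,0}(U\times\mathbb R^n)$ is the space of smooth functions $a$ on $U\times\mathbb R^n$ with $|\partial_\xi^\alpha\partial_x^\beta a(x,\xi)|\le C_{\alpha,\beta,K}(1+|\xi|^2)^{(l-|\alpha|)/2}$ for $x$ in compact sets $K\subset U$, and $S^{-\infty}=\bigcap_l S^l_{1,0}$. For open $U\subset\mathbb R^n$, $L^{l}(U)$ is the class of operators on $C_c^\infty(U)$ of the form $Au(x)=(2\pi)^{-n}\int e^{ix\cdot\xi}a(x,\xi)\hat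 u(\xi)\,d\xi$, $x\in U$, with $\hat u(\xi)=\int e^{-iy\cdot\xi}u(y)\,dy$ and $a\in S^l_{1,0}(U\times\mathbb R^n)$, and $L^{-\infty}(U)=\bigcap_l L^l(U)$. Assume that $S_{\mathbb R}=F_{\mathbb R}$. Then $\pi(f):C_c^\infty(V_{\mathbb R})\to\mathcal D'(V_{\mathbb R})$ is given by the family of oscillatory integrals $$(\pi(f)\phi)(m)=(2\pi)^{-n}\int\!\!\int e^{i(m-m')\cdot\xi}a_f(m,\xi)\phi(m')\,dm'\,d\xi ,\qquad m\in V_{\mathbb R},\ \phi\in C_c^\infty(V_{\mathbb R}),$$ where, for each fixed $m\in V_{\mathbb R}$, the function $(m',\xi)\mapsto a_f(m,\xi)$ lies in $S^0_{1,0}(V_{\mathbb R}\times V_{\mathbb R}^*)$, and in $S^{-\infty}(V_{\mathbb R}\times V_{\mathbb R}^*)$ if $m\notin F_{\mathbb R}$. The oscillatory integrals $\mathcal K_{f,m}=(2\pi)^{-n}\int e^{i(m-\cdot)\cdot\xi}a_f(m,\xi)\,d\xi$ are distributions on $V_{\mathbb R}$, the map $V_{\mathbb R}\ni m\mapsto\mathcal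 K_{f,m}\in\mathcal D'(V_{\mathbb R})$ is continuous, and the Schwartz kernel $\mathcal K_f\in\mathcal D'(V_{\mathbb R}\times V_{\mathbb R})$ of $\pi(f)$, for which $\langle\pi(f)u,v\rangle=\mathcal K_f(v\otimes u)$, is given by $\mathcal K_f(\Psi)=\int_{V_{\mathbb R}}\mathcal K_{f,m}(\Psi(m,\cdot))\,dm$ for $\Psi\in C_c^\infty(V_{\mathbb R}\times V_{\mathbb R})$. Furthermore, the function $(m,m',\xi)\mapsto a_f(m,\xi)$ lies in $S^{-\infty}((V_{\mathbb R}-F_{\mathbb R})\times V_{\mathbb R}\times V_{\mathbb R}^*)$, so that $\pi(f)$, as a map from $C_c^\infty(V_{\mathbb R})$ to $\mathcal D'(V_{\mathbb R}-F_{\mathbb R})$, is a Fourier integral operator, with phase function $(m-m')\cdot\xi$ and amplitude $a_f(m,\xi)$. In particular, $\pi(f)\in L^{-\infty}(V_{\mathbb R}-F_{\mathbb R})$. -/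

import Mathlib

open MeasureTheory TopologicalSpace Filter Topology
open scoped Distributions ContDiff ZeroAtInfty CompactConvergenceCLM MatrixGroups ENNReal

noncomputable section

namespace PrehomogeneousSpace

/-! ### Test functions and distributions -/

/-- Euclidean space `ℝⁿ`. -/
abbrev Euc (n : ℕ) : Type := EuclideanSpace ℝ (Fin n)

section Distributions

variable {E : Type*} [NormedAddCommGroup E] [NormedSpace ℝ E]

/-- `𝒟'(X)`: continuous `ℂ`-linear forms on the space `C_c^∞(X)` of complex valued test functions,
with the topology of uniform convergence on compact (equivalently, bounded) sets of test
functions. -/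
abbrev CDist (X : Opens E) : Type _ := 𝓓(X, ℂ) →L_c[ℂ] ℂ

/-- A test function, viewed as a continuous function vanishing at infinity. -/
def testToC0 {X : Opens E} (φ : 𝓓(X, ℂ)) : C₀(E, ℂ) where
  toFun := φ
  continuous_toFun := φ.continuous
  zero_at_infty' := φ.hasCompactSupport.is_zero_at_infty

/-- The distribution `v ↦ ∫ v(x) h(x) dμ(x)` on `X` defined by a function `h` that is locally
integrable on `X`. -/
def distOf [MeasurableSpace E] [BorelSpace E] (μ : Measure E) (X : Opens E) (h : E → ℂ) : CDist X :=
  ContinuousLinearMap.toUniformConvergenceCLM _ _ _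
    (TestFunction.integralAgainstBilinCLM (Ω := X) (n := ⊤) (𝕜 := ℂ)
      (ContinuousLinearMap.mul ℂ ℂ) μ h)

/-- The tensor product `(v ⊗ u)(x, y) = v(x) u(y)` of two test functions. -/
def tensor (v u : 𝓓((⊤ : Opens E), ℂ)) : 𝓓((⊤ : Opens (E × E)), ℂ) where
  toFun p := v p.1 * u p.2
  contDiff' := (v.contDiff.comp contDiff_fst).mul (u.contDiff.comp contDiff_snd)
  hasCompactSupport' := by
    refine HasCompactSupport.intro (v.hasCompactSupport.isCompact.prod
      u.hasCompactSupport.isCompact) fun p hp => ?_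
    by_cases h : p.1 ∈ tsupport v
    · rw [image_eq_zero_of_notMem_tsupport (f := u) fun h' => hp ⟨h, h'⟩, mul_zero]
    · rw [image_eq_zero_of_notMem_tsupport (f := v) h, zero_mul]
  tsupport_subset' := fun _ _ => trivial

/-- The slice `y ↦ Ψ(x, y)` of a test function on a product. -/
def slice (Ψ : 𝓓((⊤ : Opens (E × E)), ℂ)) (x : E) : 𝓓((⊤ : Opens E), ℂ) where
  toFun y := Ψ (x, y)
  contDiff' := Ψ.contDiff.comp (contDiff_const.prodMk contDiff_id)
  hasCompactSupport' := by
    refine HasCompactSupport.intro (Ψ.hasCompactSupport.isCompact.image continuous_snd)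
      fun y hy => image_eq_zero_of_notMem_tsupport fun h => hy ⟨(x, y), h, rfl⟩
  tsupport_subset' := fun _ _ => trivial

/-- `K ∈ 𝒟'(E × E)` is a Schwartz kernel of `A : C_c^∞(E) → 𝒟'(E)`:
`⟨A u, v⟩ = K(v ⊗ u)` for all test functions `u`, `v`. -/
def IsSchwartzKernel (A : 𝓓((⊤ : Opens E), ℂ) → CDist (⊤ : Opens E))
    (K : CDist (⊤ : Opens (E × E))) : Prop :=
  ∀ u v : 𝓓((⊤ : Opens E), ℂ), A u v = K (tensor v u)

end Distributions

/-! ### Symbols, oscillatory integrals, pseudodifferential and Fourier integral operators -/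

section Symbols

variable {E : Type*} [NormedAddCommGroup E] [NormedSpace ℝ E] {N : ℕ}

/-- The iterated directional derivative `∂_{v₁} ⋯ ∂_{v_r} h`. -/
def iterLineDeriv {F : Type*} [NormedAddCommGroup F] [NormedSpace ℝ F] (vs : List F) (h : F → ℂ) :
    F → ℂ :=
  vs.foldr (fun v h' x => lineDeriv ℝ h' x v) h

/-- The symbol class `S^l(X × ℝᴺ) = S^l_{1,0}(X × ℝᴺ)`, for `X` open: smooth functions on
`X × ℝᴺ` such that `|∂_ξ^α ∂_x^β a(x, ξ)| ≤ C ⟨ξ⟩^(l - |α|)` for `x` in a compact subset of `X`.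
The mixed derivatives are taken along arbitrary lists of directions; taking the vectors of a basis
one gets the usual multi-indices, to which the general case reduces by multilinearity. -/
def SymbolClass (l : ℝ) (X : Set E) : Set (E → Euc N → ℂ) :=
  {a | ContDiffOn ℝ ∞ (Function.uncurry a) (X ×ˢ Set.univ) ∧
    ∀ (α : List (Euc N)) (β : List E) (K : Set E), IsCompact K → K ⊆ X →
      ∃ C : ℝ, ∀ x ∈ K, ∀ ξ : Euc N,
        ‖iterLineDeriv (α.map (fun w => ((0, w) : E × Euc N)) ++ β.map (fun v => (v, 0)))
            (Function.uncurry a) (x, ξ)‖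
          ≤ C * (1 + ‖ξ‖ ^ 2) ^ ((l - α.length) / 2)}

/-- `S^{-∞}(X × ℝᴺ) = ⋂_l S^l(X × ℝᴺ)`. -/
def SymbolClassNegInfty (X : Set E) : Set (E → Euc N → ℂ) :=
  {a | ∀ l : ℝ, a ∈ SymbolClass l X}

/-- `I` is the value of the oscillatory integral
`∫∫ e^{i Φ(x, ξ)} a(x, ξ) w(x) dx đξ`, where `đξ = (2π)^{-N} dξ`: for every cutoff function
`χ ∈ C_c^∞(ℝᴺ)` equal to `1` near the origin, the absolutely convergent integrals
with `χ(εξ)` inserted converge to `I` as `ε → 0+`. -/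
def HasOscillatoryIntegral [MeasureSpace E] (Φ : E → Euc N → ℝ) (a : E → Euc N → ℂ) (w : E → ℂ)
    (I : ℂ) : Prop :=
  ∀ χ : 𝓓((⊤ : Opens (Euc N)), ℂ), (∀ᶠ ξ in 𝓝 0, χ ξ = 1) →
    Tendsto (fun ε : ℝ => ((2 * Real.pi : ℝ) : ℂ)⁻¹ ^ N *
        ∫ ξ : Euc N, ∫ x : E, Complex.exp (Complex.I * (Φ x ξ : ℝ)) * χ (ε • ξ) * a x ξ * w x)
      (𝓝[>] 0) (𝓝 I)

/-- A (nondegenerate) phase function on `X × (ℝᴺ - 0)`: real valued, smooth, positively homogeneous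
of degree one in `ξ`, and without critical points. -/
structure IsPhaseFunction (X : Set E) (Φ : E → Euc N → ℝ) : Prop where
  smooth : ContDiffOn ℝ ∞ (Function.uncurry Φ) (X ×ˢ {0}ᶜ)
  homogeneous : ∀ x ∈ X, ∀ ξ : Euc N, ∀ t : ℝ, 0 < t → Φ x (t • ξ) = t * Φ x ξ
  no_critical : ∀ x ∈ X, ∀ ξ : Euc N, ξ ≠ 0 → fderiv ℝ (Function.uncurry Φ) (x, ξ) ≠ 0

/-- `A : C_c^∞(Y) → 𝒟'(X)` is the Fourier integral operator with phase function `Φ` and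
amplitude `a`:
`⟨A u, v⟩ = ∫∫∫ e^{i Φ(x, y, ξ)} a(x, y, ξ) u(y) v(x) dx dy đξ` as an oscillatory integral. -/
structure IsFourierIntegralOperator [MeasureSpace E] {X Y : Opens E} (Φ : E × E → Euc N → ℝ)
    (a : E × E → Euc N → ℂ) (A : 𝓓(Y, ℂ) → CDist X) : Prop where
  phase : IsPhaseFunction ((X : Set E) ×ˢ (Y : Set E)) Φ
  amplitude : ∃ l : ℝ, a ∈ SymbolClass l ((X : Set E) ×ˢ (Y : Set E))
  apply_eq : ∀ (u : 𝓓(Y, ℂ)) (v : 𝓓(X, ℂ)),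
    HasOscillatoryIntegral Φ a (fun p => v p.1 * u p.2) (A u v)

end Symbols

section Pseudodifferential

variable {n : ℕ}

/-- The Fourier transform `û(ξ) = ∫ e^{-i y·ξ} u(y) dy`. -/
def fourierInt (u : Euc n → ℂ) (ξ : Euc n) : ℂ :=
  ∫ y : Euc n, Complex.exp (-Complex.I * (inner ℝ y ξ : ℝ)) * u y

/-- `A ∈ L^l(U)`: the operator `A` on `C_c^∞(U)` has the form
`A u(x) = ∫ e^{i x·ξ} a(x, ξ) û(ξ) đξ`, `x ∈ U`, with `a ∈ S^l(U × ℝⁿ)`. -/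
def IsPseudodifferential (l : ℝ) (U : Opens (Euc n)) (A : 𝓓(U, ℂ) → Euc n → ℂ) : Prop :=
  ∃ a : Euc n → Euc n → ℂ, a ∈ SymbolClass l (U : Set (Euc n)) ∧
    ∀ u : 𝓓(U, ℂ), ∀ x ∈ U,
      A u x = ((2 * Real.pi : ℝ) : ℂ)⁻¹ ^ n *
        ∫ ξ : Euc n, Complex.exp (Complex.I * (inner ℝ x ξ : ℝ)) * a x ξ * fourierInt u ξ

/-- `A ∈ L^{-∞}(U) = ⋂_l L^l(U)`. -/
def IsSmoothingOperator (U : Opens (Euc n)) (A : 𝓓(U, ℂ) → Euc n → ℂ) : Prop :=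
  ∀ l : ℝ, IsPseudodifferential l U A

end Pseudodifferential

/-! ### Prehomogeneous vector spaces over `ℝ` -/

/-- The set of zeros in `GL(k, ℂ)` of a set of polynomials in the matrix entries, with coefficients
in `R` (`R = ℝ` or `ℂ`). -/
def zeroLocus {k : ℕ} (R : Type) [CommRing R] [Algebra R ℂ]
    (I : Set (MvPolynomial (Fin k × Fin k) R)) : Set (GL (Fin k) ℂ) :=
  {g | ∀ p ∈ I, MvPolynomial.aeval (fun ij : Fin k × Fin k => (g : Matrix _ _ ℂ) ij.1 ij.2) p = 0}

/-- Connectedness in the Zariski topology of `GL(k, ℂ)`: the set is nonempty, and it is not the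
union of two disjoint proper relatively closed subsets. -/
def IsZariskiConnected {k : ℕ} (S : Set (GL (Fin k) ℂ)) : Prop :=
  S.Nonempty ∧ ∀ I J : Set (MvPolynomial (Fin k × Fin k) ℂ),
    S ⊆ zeroLocus ℂ I ∪ zeroLocus ℂ J → S ∩ zeroLocus ℂ I ∩ zeroLocus ℂ J = ∅ →
      S ⊆ zeroLocus ℂ I ∨ S ⊆ zeroLocus ℂ J

/-- A subset of `ℂⁿ` is Zariski dense if only the zero polynomial vanishes on it. -/
def IsZariskiDense {n : ℕ} (S : Set (Fin n → ℂ)) : Prop :=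
  ∀ p : MvPolynomial (Fin n) ℂ, (∀ x ∈ S, MvPolynomial.eval x p = 0) → p = 0

/-- The inclusion `GL(k, ℝ) → GL(k, ℂ)`. -/
def complexify (k : ℕ) : GL (Fin k) ℝ →* GL (Fin k) ℂ :=
  Matrix.GeneralLinearGroup.map Complex.ofRealHom

/-- A prehomogeneous vector space `(G_ℂ, ρ, V_ℂ)` over `ℝ`, where `V_ℂ = ℂⁿ` has the real structure
`V_ℝ = ℝⁿ`, and `G_ℂ` is a closed subgroup of `GL(k, ℂ)`. -/
structure RealPrehomogeneousSpace (k n : ℕ) where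
  /-- the linear algebraic group `G_ℂ` -/
  GC : Subgroup (GL (Fin k) ℂ)
  /-- `G_ℂ` is algebraic and defined over `ℝ` -/
  defined_over_real : ∃ I : Set (MvPolynomial (Fin k × Fin k) ℝ),
    (GC : Set (GL (Fin k) ℂ)) = zeroLocus ℝ I
  /-- `G_ℂ` is connected -/
  connected : IsZariskiConnected (GC : Set (GL (Fin k) ℂ))
  /-- the representation `ρ` -/
  ρ : GC →* GL (Fin n) ℂ
  /-- `ρ` is `ℝ`-rational: its matrix entries are restrictions to `G_ℂ` of elements of
  `ℝ[g_{ab}, det(g)⁻¹]` -/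
  rational : ∀ i j : Fin n, ∃ (p : MvPolynomial (Fin k × Fin k) ℝ) (r : ℕ), ∀ g : GC,
    (ρ g : Matrix (Fin n) (Fin n) ℂ) i j =
      MvPolynomial.aeval
        (fun ab : Fin k × Fin k => ((g : GL (Fin k) ℂ) : Matrix _ _ ℂ) ab.1 ab.2) p *
        ((Matrix.det ((g : GL (Fin k) ℂ) : Matrix (Fin k) (Fin k) ℂ))⁻¹) ^ r
  /-- there is a Zariski dense orbit -/
  exists_dense_orbit : ∃ m : Fin n → ℂ,
    IsZariskiDense (Set.range fun g : GC => (ρ g : Matrix (Fin n) (Fin n) ℂ).mulVec m)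

namespace RealPrehomogeneousSpace

variable {k n : ℕ} (P : RealPrehomogeneousSpace k n)

/-- The orbit `G_ℂ m` of a point `m ∈ V_ℂ`. -/
def orbitC (m : Fin n → ℂ) : Set (Fin n → ℂ) :=
  Set.range fun g : P.GC => (P.ρ g : Matrix (Fin n) (Fin n) ℂ).mulVec m

/-- The singular set `S_ℂ`, the complement of the (unique) Zariski dense orbit: the set of the points
whose orbits are not Zariski dense. -/
def singularC : Set (Fin n → ℂ) := {m | ¬ IsZariskiDense (P.orbitC m)}

/-- `S_ℝ = S_ℂ ∩ V_ℝ`. -/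
def singularR : Set (Euc n) := {m | (fun i => (m i : ℂ)) ∈ P.singularC}

/-- The group `G_ℝ = G_ℂ ∩ GL(k, ℝ)` of real points. -/
def GR : Subgroup (GL (Fin k) ℝ) := P.GC.comap (complexify k)

/-- The matrix `ρ(g)`, which is real for `g ∈ G_ℝ` (see `rhoReal_spec`). -/
def rhoRealMatrix (g : P.GR) : Matrix (Fin n) (Fin n) ℝ :=
  (P.ρ ⟨complexify k g, g.2⟩ : Matrix (Fin n) (Fin n) ℂ).map Complex.re

theorem rhoReal_spec (g : P.GR) :
    (P.rhoRealMatrix g).map Complex.ofReal =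
      (P.ρ ⟨complexify k g, g.2⟩ : Matrix (Fin n) (Fin n) ℂ) := by
  ext i j
  obtain ⟨p, r, h⟩ := P.rational i j
  have h1 := h ⟨complexify k g, g.2⟩
  have key : ∃ x : ℝ, (P.ρ ⟨complexify k g, g.2⟩ : Matrix (Fin n) (Fin n) ℂ) i j = (x : ℂ) := by
    refine ⟨MvPolynomial.aeval (fun ab : Fin k × Fin k =>
      ((g : GL (Fin k) ℝ) : Matrix _ _ ℝ) ab.1 ab.2) p *
      ((Matrix.det ((g : GL (Fin k) ℝ) : Matrix (Fin k) (Fin k) ℝ))⁻¹) ^ r, ?_⟩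
    rw [h1]
    have h2 : MvPolynomial.aeval (fun ab : Fin k × Fin k =>
        (((complexify k g : GL (Fin k) ℂ)) : Matrix _ _ ℂ) ab.1 ab.2) p =
        algebraMap ℝ ℂ (MvPolynomial.aeval (fun ab : Fin k × Fin k =>
          ((g : GL (Fin k) ℝ) : Matrix _ _ ℝ) ab.1 ab.2) p) := by
      rw [← MvPolynomial.aeval_algebraMap_apply]
      rfl
    have h3 : Matrix.det ((complexify k g : GL (Fin k) ℂ) : Matrix (Fin k) (Fin k) ℂ) =
        ((Matrix.det ((g : GL (Fin k) ℝ) : Matrix (Fin k) (Fin k) ℝ) : ℝ) : ℂ) :=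
      (RingHom.map_det Complex.ofRealHom _).symm
    simp only [h2, h3]
    simp
  obtain ⟨x, hx⟩ := key
  simp [rhoRealMatrix, hx]

/-- The action of `G_ℝ` on `V_ℝ`, by real matrices. -/
def rhoReal : P.GR →* Matrix (Fin n) (Fin n) ℝ where
  toFun := P.rhoRealMatrix
  map_one' := by
    apply Matrix.map_injective Complex.ofReal_injective
    simp only [rhoReal_spec]
    have : (⟨complexify k ((1 : P.GR) : GL (Fin k) ℝ), (1 : P.GR).2⟩ : P.GC) = 1 :=
      Subtype.ext (map_one (complexify k))
    rw [this]
    simp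
  map_mul' g h := by
    apply Matrix.map_injective Complex.ofReal_injective
    have e : (P.rhoRealMatrix g * P.rhoRealMatrix h).map Complex.ofReal =
        (P.rhoRealMatrix g).map Complex.ofReal * (P.rhoRealMatrix h).map Complex.ofReal :=
      Matrix.map_mul (f := Complex.ofRealHom)
    simp only [e, rhoReal_spec]
    have : (⟨complexify k ((g * h : P.GR) : GL (Fin k) ℝ), (g * h).2⟩ : P.GC) =
        ⟨complexify k g, g.2⟩ * ⟨complexify k h, h.2⟩ :=
      Subtype.ext (map_mul (complexify k) _ _)
    rw [this]
    simp

/-- The point `g m`, for `g ∈ G_ℝ` and `m ∈ V_ℝ`. -/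
def act (g : P.GR) (m : Euc n) : Euc n := Matrix.toEuclideanCLM (𝕜 := ℝ) (P.rhoReal g) m

theorem act_act (g h : P.GR) (m : Euc n) : P.act g (P.act h m) = P.act (g * h) m := by
  simp [act, map_mul]

theorem act_one (m : Euc n) : P.act 1 m = m := by
  simp [act]

theorem continuous_act (g : P.GR) : Continuous (P.act g) :=
  (Matrix.toEuclideanCLM (𝕜 := ℝ) (P.rhoReal g)).continuous

/-- The linear homeomorphism `m ↦ g m` of `V_ℝ`. -/
def actHomeo (g : P.GR) : Euc n ≃ₜ Euc n where
  toFun := P.act g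
  invFun := P.act g⁻¹
  left_inv m := by rw [act_act, inv_mul_cancel, act_one]
  right_inv m := by rw [act_act, mul_inv_cancel, act_one]
  continuous_toFun := P.continuous_act g
  continuous_invFun := P.continuous_act g⁻¹

/-- The set `F_ℝ` of the fixed points of the action of `G_ℝ` on `V_ℝ`. -/
def fixedR : Set (Euc n) := {m | ∀ g : P.GR, P.act g m = m}

theorem isClosed_fixedR : IsClosed P.fixedR := by
  have : P.fixedR = ⋂ g : P.GR, {m | P.act g m = m} := by
    ext m; simp [fixedR]
  rw [this]
  exact isClosed_iInter fun g => isClosed_eq (P.continuous_act g) continuous_id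

/-- The open set `V_ℝ - F_ℝ`. -/
def complFixed : Opens (Euc n) := ⟨P.fixedRᶜ, P.isClosed_fixedR.isOpen_compl⟩

/-! ### The identity component `G` of `G_ℝ` and its rapidly decreasing functions -/

/-- The connected component `G` of the unit element in `G_ℝ`, as a subgroup of `GL(k, ℝ)`. -/
def G : Subgroup (GL (Fin k) ℝ) :=
  (Subgroup.connectedComponentOfOne P.GR).map P.GR.subtype

theorem G_le_GR : P.G ≤ P.GR := by
  rintro _ ⟨g, -, rfl⟩
  exact g.2

/-- The inclusion `G → G_ℝ`. -/
def incl : P.G →* P.GR := Subgroup.inclusion P.G_le_GR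

/-- The entries of an element of `G`, as a point of the vector space of all real `k × k`-matrices. -/
def entries (g : P.G) : Fin k → Fin k → ℝ := fun i j => ((g : GL (Fin k) ℝ) : Matrix _ _ ℝ) i j

/-- `γ` restricts to a `C¹`-path in `G`, defined on `[0, 1]`, from the unit element to `g`. -/
structure IsPath (γ : ℝ → Matrix (Fin k) (Fin k) ℝ) (g : P.G) : Prop where
  contDiff : ∀ i j, ContDiff ℝ 1 fun t => γ t i j
  mem : ∀ t ∈ Set.Icc (0 : ℝ) 1, ∃ h : P.G, γ t = ((h : GL (Fin k) ℝ) : Matrix _ _ ℝ)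
  source : γ 0 = 1
  target : γ 1 = ((g : GL (Fin k) ℝ) : Matrix _ _ ℝ)

/-- The length of a path `γ` with respect to the left invariant Riemannian metric
`⟨X, Y⟩_g = tr((g⁻¹ X)ᵀ (g⁻¹ Y))`, that is, `∫₀¹ |γ⁻¹ γ'| dt`. -/
def pathLength (γ : ℝ → Matrix (Fin k) (Fin k) ℝ) : ℝ :=
  ∫ t in (0 : ℝ)..1,
    Real.sqrt (∑ i, ∑ j, ((γ t)⁻¹ * Matrix.of fun a b => deriv (fun s => γ s a b) t) i j ^ 2)

/-- The Riemannian distance `|g| = d(g, e)` of `g` from the unit element of `G`. (It is finite, as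
`G` is a connected Lie group; distances of different left invariant Riemannian metrics are bounded
by multiples of each other.) -/
def dist1 (g : P.G) : ℝ≥0∞ :=
  ⨅ (γ : ℝ → Matrix (Fin k) (Fin k) ℝ) (_ : P.IsPath γ g), ENNReal.ofReal (pathLength γ)

/-- The number `e^{κ |g|}`. -/
def expDist (κ : ℝ) (g : P.G) : ℝ≥0∞ := EReal.exp ((κ : EReal) * ((P.dist1 g : ℝ≥0∞) : EReal))

/-- The exponential of a matrix, as an element of `GL(k, ℝ)`. -/
def expGL (X : Matrix (Fin k) (Fin k) ℝ) : GL (Fin k) ℝ where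
  val := NormedSpace.exp X
  inv := NormedSpace.exp (-X)
  val_inv := by
    rw [← Matrix.exp_add_of_commute _ _ ((Commute.refl X).neg_right), add_neg_cancel,
      NormedSpace.exp_zero]
  inv_val := by
    rw [← Matrix.exp_add_of_commute _ _ ((Commute.refl X).neg_left), neg_add_cancel,
      NormedSpace.exp_zero]

/-- The Lie algebra of `G`: the matrices `X` such that `e^{tX} ∈ G` for all real `t`. -/
def lieAlg : Set (Matrix (Fin k) (Fin k) ℝ) := {X | ∀ t : ℝ, expGL (t • X) ∈ P.G}

/-- Smooth functions on `G`, a locally closed submanifold of the space of `k × k`-matrices: near each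
point of `G`, the function is the restriction of a smooth function on an open set of matrices. -/
def IsSmooth (f : P.G → ℂ) : Prop :=
  ∀ g : P.G, ∃ (U : Set (Fin k → Fin k → ℝ)) (F : (Fin k → Fin k → ℝ) → ℂ),
    IsOpen U ∧ P.entries g ∈ U ∧ ContDiffOn ℝ ∞ F U ∧
      ∀ h : P.G, P.entries h ∈ U → f h = F (P.entries h)

/-- `dL(X) f(g) = d/dh f(e^{-hX} g)` at `h = 0`, for `X` in the Lie algebra of `G`. -/
def dL (X : P.lieAlg) (f : P.G → ℂ) (g : P.G) : ℂ :=
  deriv (fun h : ℝ => f (⟨expGL ((-h) • (X : Matrix (Fin k) (Fin k) ℝ)), X.2 (-h)⟩ * g)) 0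

/-- `dL(X₁ ⋯ X_r) f = dL(X₁) ⋯ dL(X_r) f`. The monomials `X₁ ⋯ X_r` span the universal enveloping
algebra of the complexified Lie algebra. -/
def dLWord (w : List P.lieAlg) (f : P.G → ℂ) : P.G → ℂ := w.foldr P.dL f

/-- The space `𝒮(G)` of rapidly decreasing smooth functions: for all `κ ≥ 0` and all elements `w`
of the enveloping algebra, `|dL(w) f(g)| ≤ C e^{-κ|g|}`, and `dL(w) f ∈ L¹(G, e^{κ|g|} d_G)`, where
`d_G = μ` is Haar measure. -/
structure IsRapidlyDecreasing [MeasurableSpace P.G] (μ : Measure P.G) (f : P.G → ℂ) : Prop where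
  smooth : P.IsSmooth f
  decay : ∀ κ : ℝ, 0 ≤ κ → ∀ w : List P.lieAlg, ∃ C : NNReal, ∀ g : P.G,
    ‖P.dLWord w f g‖ₑ ≤ C * P.expDist (-κ) g
  integrable : ∀ κ : ℝ, 0 ≤ κ → ∀ w : List P.lieAlg,
    ∫⁻ g, ‖P.dLWord w f g‖ₑ * P.expDist κ g ∂μ < ⊤

/-! ### The operators `π(f)` and their symbols -/

/-- The left regular representation on `C₀(V_ℝ)`: `(π(g)φ)(m) = φ(g⁻¹ m)`. -/
def leftRegular (g : P.GR) (φ : C₀(Euc n, ℂ)) : C₀(Euc n, ℂ) :=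
  φ.comp (P.actHomeo g⁻¹).toCocompactMap

/-- `π(f)φ = ∫_G f(g) π(g)φ d_G(g)`, as an integral in the Banach space `C₀(V_ℝ)`. -/
def piOp [MeasurableSpace P.G] (μ : Measure P.G) (f : P.G → ℂ) (φ : C₀(Euc n, ℂ)) : C₀(Euc n, ℂ) :=
  ∫ g, f g • P.leftRegular (P.incl g) φ ∂μ

/-- `π(f)` as an operator `C_c^∞(Y) → C₀(V_ℝ) → 𝒟'(X)`, for open sets `X, Y ⊆ V_ℝ`. -/
def piDist [MeasurableSpace P.G] (μ : Measure P.G) (f : P.G → ℂ) (X Y : Opens (Euc n))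
    (φ : 𝓓(Y, ℂ)) : CDist X :=
  distOf volume X (P.piOp μ f (testToC0 φ))

/-- The function `f̂(m, ξ) = ∫_G f(g) e^{i (g⁻¹ m)·ξ} d_G(g)`. -/
def fHat [MeasurableSpace P.G] (μ : Measure P.G) (f : P.G → ℂ) (m ξ : Euc n) : ℂ :=
  ∫ g, f g * Complex.exp (Complex.I * (inner ℝ (P.act (P.incl g)⁻¹ m) ξ : ℝ)) ∂μ

/-- The symbol `a_f(m, ξ) = e^{-i m·ξ} f̂(m, ξ)`. -/
def symbol [MeasurableSpace P.G] (μ : Measure P.G) (f : P.G → ℂ) (m ξ : Euc n) : ℂ :=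
  Complex.exp (-Complex.I * (inner ℝ m ξ : ℝ)) * P.fHat μ f m ξ

end RealPrehomogeneousSpace

end PrehomogeneousSpace

end

open PrehomogeneousSpace

/-! Since $(g^{-1}m-m)\cdot\xi$ is the pairing of $\rho(g^{-1})-1$ with the matrix $b=(\xi_i m_j)$,
the symbol $a_f(m,\xi)$ is an integral $\int f(g)e^{i\langle\rho(g^{-1})-1,\,b\rangle}d_G(g)$,
called `oscInt`, evaluated at $b$ = `outer m ξ`. Everything about the symbol is read off from this
integral.

Regularity. Differentiating in $b$ multiplies $f$ by matrix entries of $\rho(g^{-1})$. These grow at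
most like $e^{\kappa|g|}$ (a Gronwall estimate along paths from $e$ to $g$), so the rapid decay of
$f$ absorbs them and `oscInt` is smooth.

Decay. For $X$ in the Lie algebra, the derivative of the phase along $g\mapsto e^{-hX}g$ is
$\xi\cdot\rho(g^{-1})d\rho(X)m$. If the vectors $d\rho(X)m$ span $V_{\mathbb R}$, integration by
parts on $G$ trades each power of $\xi$ for a derivative $dL(X)$ of the amplitude, locally uniformly
in $m$ (`mul_oscInt_eq`, `exists_nhds_rapidDecayOn`). Derivatives in $m,\xi$ only produce polynomial
factors, so rapid decay of all derivatives, hence $S^{-\infty}$, follows.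

Spanning. It holds for $m\notin S_{\mathbb R}$: the complex orbit map of such an $m$ is dominant,
and in characteristic zero a dominant rational map is submersive at some point
(`exists_submersive_point`). Homogeneity moves that point to the identity, exponentials of Zariski
tangent vectors stay in $G_{\mathbb C}$ (`IsTangentVector.eval_exp_eq_zero`), and real parts descend
to the Lie algebra of $G$ (`exists_lieAlg_deriv_act`). At the remaining points $m\in S_{\mathbb
R}=F_{\mathbb R}$ the phase is trivial and $a_f(m,\cdot)$ is constant, thus of order $0$.

Operator. The integral formulas need neither decay nor the hypothesis on $S_{\mathbb R}$: $\hat f$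
is bounded and continuous and the Fourier transform of a test function is integrable, so Fubini and
Fourier inversion at $g^{-1}m$ give $\int f(g)\phi(g^{-1}m)\,d_G(g)$
(`integral_fHat_mul_fourierInt`). The kernel $\mathcal K_{f,m}$ is the functional $\phi\mapsto\int
f(g)\phi(g^{-1}m)\,d_G(g)$. -/

/-! ### Derivations of function fields in characteristic zero. -/

/-- Elements that are algebraically independent over a field of characteristic zero have
derivations with arbitrarily prescribed values. -/
theorem exists_derivation_of_algebraicIndependent {F K : Type} [Field F] [CharZero F] [Field K]
    [Algebra F K] [Algebra.EssFiniteType F K] {n : ℕ} {x : Fin n → K}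
    (hx : AlgebraicIndependent F x) (c : Fin n → K) :
    ∃ D : Derivation F K K, ∀ j, D (x j) = c j := by
  -- `K` is formally smooth over `L = F(x)` (characteristic zero, essentially of finite type), and
  -- `L` is a localization of `S = F[X]`; hence `K` is formally smooth over `S`.
  let S := MvPolynomial (Fin n) F
  let : Algebra S K := (MvPolynomial.aeval x).toRingHom.toAlgebra
  have hSK (s : S) : algebraMap S K s = MvPolynomial.aeval x s := rfl
  have : IsScalarTower F S K := IsScalarTower.of_algebraMap_eq fun r => by
    rw [hSK, MvPolynomial.algebraMap_eq, MvPolynomial.aeval_C]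
  have : FaithfulSMul S K := (faithfulSMul_iff_algebraMap_injective S K).2 hx
  let L := FractionRing S
  let : Algebra L K := FractionRing.liftAlgebra S K
  have : IsScalarTower S L K := inferInstance
  have : IsScalarTower F L K := IsScalarTower.of_algebraMap_eq fun r => by
    rw [IsScalarTower.algebraMap_apply F S L, ← IsScalarTower.algebraMap_apply S L K,
      ← IsScalarTower.algebraMap_apply F S K]
  have : Algebra.EssFiniteType L K := Algebra.EssFiniteType.of_comp F L K
  have : CharZero L := charZero_of_injective_algebraMap (FaithfulSMul.algebraMap_injective F L)
  have : Algebra.FormallySmooth L K := inferInstance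
  have : Algebra.FormallyEtale S L := Algebra.FormallyEtale.of_isLocalization (nonZeroDivisors S)
  have : Algebra.FormallySmooth S K := Algebra.FormallySmooth.comp S L K
  let d : Derivation F S K := MvPolynomial.mkDerivation F c
  -- The dual numbers `K[ε]` become an `S`-algebra through $s\mapsto s+d(s)\varepsilon$. An
  -- `S`-linear lift of the identity of `K` to `K[ε]` then has a derivation extending `d` as its
  -- `ε`-part.
  let i : S →+* TrivSqZeroExt K K :=
    { toFun s := TrivSqZeroExt.inl (algebraMap S K s) + TrivSqZeroExt.inr (d s)
      map_one' := by ext <;> simp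
      map_zero' := by ext <;> simp
      map_mul' s t := by
        ext
        · simp
        · simp only [TrivSqZeroExt.snd_mul, TrivSqZeroExt.snd_add, TrivSqZeroExt.snd_inl,
            TrivSqZeroExt.snd_inr, TrivSqZeroExt.fst_add, TrivSqZeroExt.fst_inl,
            TrivSqZeroExt.fst_inr, Derivation.leibniz, Algebra.smul_def, zero_add, add_zero,
            map_mul, MulOpposite.smul_eq_mul_unop, MulOpposite.unop_op,
            Algebra.algebraMap_self, RingHom.id_apply]
          ring
      map_add' s t := by ext <;> simp }
  let : Algebra S (TrivSqZeroExt K K) := i.toAlgebra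
  have hi (s : S) : algebraMap S (TrivSqZeroExt K K) s = TrivSqZeroExt.inl (algebraMap S K s) + TrivSqZeroExt.inr (d s) := rfl
  let g : TrivSqZeroExt K K →ₐ[S] K :=
    { (TrivSqZeroExt.fstHom K K K).toRingHom with
      commutes' := fun s => by simp [hi] }
  have hg (b : TrivSqZeroExt K K) : g b = b.fst := rfl
  have hker : IsNilpotent (RingHom.ker (g : TrivSqZeroExt K K →+* K)) := by
    refine ⟨2, ?_⟩
    rw [Submodule.pow_succ, Submodule.pow_one, Ideal.zero_eq_bot, eq_bot_iff, Ideal.mul_le]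
    intro a ha b hb
    have ha : a.fst = 0 := ha
    have hb : b.fst = 0 := hb
    rw [Ideal.mem_bot]
    ext <;> simp [ha, hb]
  let l : K →ₐ[S] TrivSqZeroExt K K := Algebra.FormallySmooth.liftOfSurjective (AlgHom.id S K) g
    (fun y => ⟨TrivSqZeroExt.inl y, rfl⟩) hker
  have hl (y : K) : (l y).fst = y :=
    Algebra.FormallySmooth.liftOfSurjective_apply (AlgHom.id S K) g _ hker y
  have hlS (s : S) : l (algebraMap S K s) = TrivSqZeroExt.inl (algebraMap S K s) + TrivSqZeroExt.inr (d s) := by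
    rw [AlgHom.commutes, hi]
  refine ⟨Derivation.mk' { toFun := fun y => (l y).snd, map_add' := ?_, map_smul' := ?_ } ?_, ?_⟩
  · intro y z; simp
  · intro r y
    have h1 : r • y = algebraMap S K (MvPolynomial.C r) * y := by
      rw [Algebra.smul_def, hSK, MvPolynomial.aeval_C]
    have h2 : d (MvPolynomial.C r) = 0 := d.map_algebraMap r
    rw [h1, map_mul, hlS, TrivSqZeroExt.snd_mul, h2]
    simp [hSK, Algebra.smul_def]
  · intro y z
    simp [hl, mul_comm]
  · intro j
    have h1 : x j = algebraMap S K (MvPolynomial.X j) := by rw [hSK, MvPolynomial.aeval_X]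
    have h2 : d (MvPolynomial.X j) = c j := MvPolynomial.mkDerivation_X _ _ _
    change (l (x j)).snd = c j
    rw [h1, hlS, h2]
    simp

/-! ### Dominant rational maps are submersive somewhere. -/

section RationalMaps

variable {σ : Type} [Fintype σ] {n : ℕ}

/-- The differential of a polynomial `p` at the point `z`, applied to the vector `Y`. -/
noncomputable def polyDifferential {A : Type*} [CommRing A] (p : MvPolynomial σ A) (z Y : σ → A) : A :=
  ∑ s, MvPolynomial.eval z (MvPolynomial.pderiv s p) * Y s

/-- Clears the denominators of $q(N/d)$. The same `r` and `s` must serve for every `A`, because the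
identity is used both in a function field and at the points of a set. -/
theorem exists_common_denominator (N : Fin n → MvPolynomial σ ℂ) (d : MvPolynomial σ ℂ)
    (q : MvPolynomial (Fin n) ℂ) :
    ∃ (r : ℕ) (s : MvPolynomial σ ℂ), ∀ (A : Type) [Field A] [Algebra ℂ A]
      (φ : MvPolynomial σ ℂ →ₐ[ℂ] A), φ d ≠ 0 →
        φ s = MvPolynomial.aeval (fun j => φ (N j) / φ d) q * φ d ^ r := by
  induction q using MvPolynomial.induction_on with
  | C a =>
    refine ⟨0, MvPolynomial.C a, fun A _ _ φ _ => ?_⟩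
    simp [← MvPolynomial.algebraMap_eq]
  | add p q hp hq =>
    obtain ⟨r₁, s₁, h₁⟩ := hp
    obtain ⟨r₂, s₂, h₂⟩ := hq
    refine ⟨r₁ + r₂, s₁ * d ^ r₂ + s₂ * d ^ r₁, fun A _ _ φ hd => ?_⟩
    simp only [map_add, map_mul, map_pow, h₁ A φ hd, h₂ A φ hd]
    ring
  | mul_X p j hp =>
    obtain ⟨r, s, h⟩ := hp
    refine ⟨r + 1, s * N j, fun A _ _ φ hd => ?_⟩
    simp only [map_mul, h A φ hd, MvPolynomial.aeval_X, pow_succ]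
    field_simp

theorem derivation_apply_algHom {K : Type} [Field K] [Algebra ℂ K] (D : Derivation ℂ K K)
    (φ : MvPolynomial σ ℂ →ₐ[ℂ] K) (p : MvPolynomial σ ℂ) :
    D (φ p) = ∑ s, φ (MvPolynomial.pderiv s p) * D (φ (MvPolynomial.X s)) := by
  classical
  induction p using MvPolynomial.induction_on with
  | C a => simp [← MvPolynomial.algebraMap_eq]
  | add p q hp hq => simp [hp, hq, add_mul, Finset.sum_add_distrib]
  | mul_X p j hp =>
    have h (s : σ) : φ (MvPolynomial.pderiv s (p * MvPolynomial.X j)) * D (φ (MvPolynomial.X s)) =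
        φ (MvPolynomial.X j) * (φ (MvPolynomial.pderiv s p) * D (φ (MvPolynomial.X s))) +
        if s = j then φ p * D (φ (MvPolynomial.X j)) else 0 := by
      rw [Derivation.leibniz, MvPolynomial.pderiv_X]
      by_cases hs : s = j
      · subst hs; simp; ring
      · simp [hs, Ne.symm hs]; ring
    simp only [h, Finset.sum_add_distrib, ← Finset.mul_sum, ← hp]
    simp [map_mul]
    ring

/-- A rational map `N / d` on a set `Z` whose image is Zariski dense is submersive at some point of
the Zariski closure of `Z` at which `d` does not vanish. -/
theorem exists_submersive_point (Z : Set (σ → ℂ)) (N : Fin n → MvPolynomial σ ℂ)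
    (d : MvPolynomial σ ℂ) (hd : ∀ z ∈ Z, MvPolynomial.eval z d ≠ 0)
    (hdense : ∀ q : MvPolynomial (Fin n) ℂ, (∀ z ∈ Z, MvPolynomial.eval
      (fun j => MvPolynomial.eval z (N j) / MvPolynomial.eval z d) q = 0) → q = 0) :
    ∃ (z : σ → ℂ) (h : ℂ) (Y : Fin n → σ → ℂ),
      (∀ p : MvPolynomial σ ℂ, (∀ w ∈ Z, MvPolynomial.eval w p = 0) → MvPolynomial.eval z p = 0) ∧
      MvPolynomial.eval z d ≠ 0 ∧ h ≠ 0 ∧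
      (∀ l, ∀ p : MvPolynomial σ ℂ, (∀ w ∈ Z, MvPolynomial.eval w p = 0) →
        polyDifferential p z (Y l) = 0) ∧
      ∀ l j, MvPolynomial.eval z d * polyDifferential (N j) z (Y l) -
        MvPolynomial.eval z (N j) * polyDifferential d z (Y l) = if j = l then h else 0 := by
  classical
  let I : Ideal (MvPolynomial σ ℂ) := MvPolynomial.vanishingIdeal ℂ Z
  have hI (p : MvPolynomial σ ℂ) : p ∈ I ↔ ∀ w ∈ Z, MvPolynomial.eval w p = 0 := by
    simp [I, MvPolynomial.mem_vanishingIdeal_iff, MvPolynomial.aeval_eq_eval]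
  -- `S` collects the numerators of the nonzero polynomial expressions in the $N_j/d$. By density
  -- none of them vanishes on `Z`; a prime containing `I` and avoiding `S` singles out an
  -- irreducible closed subset of the closure of `Z` on which the $N_j/d$ remain algebraically
  -- independent.
  let S : Submonoid (MvPolynomial σ ℂ) :=
    { carrier := {s | ∃ q : MvPolynomial (Fin n) ℂ, q ≠ 0 ∧ ∃ r : ℕ, ∀ z ∈ Z,
        MvPolynomial.eval z s = MvPolynomial.eval
          (fun j => MvPolynomial.eval z (N j) / MvPolynomial.eval z d) q *
            MvPolynomial.eval z d ^ r}
      one_mem' := ⟨1, one_ne_zero, 0, fun z _ => by simp⟩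
      mul_mem' := by
        rintro a b ⟨q, hq, r, h⟩ ⟨q', hq', r', h'⟩
        refine ⟨q * q', mul_ne_zero hq hq', r + r', fun z hz => ?_⟩
        rw [map_mul, map_mul, h z hz, h' z hz]
        ring }
  have hdisj : Disjoint (I : Set (MvPolynomial σ ℂ)) S := by
    rw [Set.disjoint_left]
    rintro s hs ⟨q, hq, r, h⟩
    refine hq (hdense q fun z hz => ?_)
    have h1 := (hI s).1 hs z hz
    rw [h z hz] at h1
    exact (mul_eq_zero.1 h1).resolve_right (pow_ne_zero _ (hd z hz))
  obtain ⟨p, hp, hIp, hpS⟩ := Ideal.exists_le_prime_disjoint I S hdisj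
  rw [Set.disjoint_left] at hpS
  let B := MvPolynomial σ ℂ ⧸ p
  let K := FractionRing B
  let φ : MvPolynomial σ ℂ →ₐ[ℂ] K :=
    (IsScalarTower.toAlgHom ℂ B K).comp (Ideal.Quotient.mkₐ ℂ p)
  have hφ' (s : MvPolynomial σ ℂ) : φ s = algebraMap B K (Ideal.Quotient.mk p s) := rfl
  have hφ (s : MvPolynomial σ ℂ) : φ s = 0 ↔ s ∈ p := by
    rw [hφ', IsFractionRing.to_map_eq_zero_iff, Ideal.Quotient.eq_zero_iff_mem]
  have hdp : d ∉ p := fun h => hpS h ⟨1, one_ne_zero, 1, fun z _ => by simp⟩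
  have hφd : φ d ≠ 0 := fun h => hdp ((hφ d).1 h)
  have : Algebra.EssFiniteType B K := Algebra.EssFiniteType.of_isLocalization K (nonZeroDivisors B)
  have : Algebra.EssFiniteType ℂ K := Algebra.EssFiniteType.comp ℂ B K
  have hind : AlgebraicIndependent ℂ (fun j => φ (N j) / φ d) := by
    rw [algebraicIndependent_iff]
    intro q hq
    by_contra hq0
    obtain ⟨r, s, hs⟩ := exists_common_denominator N d q
    refine hpS (a := s) ((hφ s).1 ?_) ⟨q, hq0, r, fun z hz => ?_⟩
    · rw [hs K φ hφd, hq, zero_mul]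
    · simpa [MvPolynomial.aeval_eq_eval] using hs ℂ (MvPolynomial.aeval z)
        (by simpa [MvPolynomial.aeval_eq_eval] using hd z hz)
  -- Vector fields on the irreducible subset that are dual to the functions $N_j/d$. Their
  -- coefficients are rational; `b` is a common denominator.
  choose D hD using fun l : Fin n => exists_derivation_of_algebraicIndependent hind
    (fun j => if j = l then (1 : K) else 0)
  obtain ⟨b, hb⟩ := IsLocalization.exist_integer_multiples_of_finite (nonZeroDivisors B)
    (fun ls : Fin n × σ => D ls.1 (φ (MvPolynomial.X ls.2)))
  choose y' hy' using hb
  obtain ⟨b₀, hb₀⟩ := Ideal.Quotient.mk_surjective (b : B)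
  choose y hy using fun ls => Ideal.Quotient.mk_surjective (y' ls)
  have hyφ (l : Fin n) (s : σ) : φ (y (l, s)) = φ b₀ * D l (φ (MvPolynomial.X s)) := by
    rw [hφ', hφ', hy, hy', hb₀, Algebra.smul_def]
  have hb₀p : b₀ ∉ p := fun h => by
    refine nonZeroDivisors.coe_ne_zero b ?_
    rw [← hb₀, Ideal.Quotient.eq_zero_iff_mem]
    exact h
  have hDφ (l : Fin n) (P : MvPolynomial σ ℂ) :
      φ (∑ s, MvPolynomial.pderiv s P * y (l, s)) = φ b₀ * D l (φ P) := by
    rw [derivation_apply_algHom, map_sum, Finset.mul_sum]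
    refine Finset.sum_congr rfl fun s _ => ?_
    rw [map_mul, hyφ]
    ring
  have hbd : b₀ * d ∉ p := fun h => (hp.mem_or_mem h).elim hb₀p hdp
  -- Nullstellensatz: $b_0d\notin p$ is nonzero at some zero of `p`, where the vector fields `b₀ D
  -- l` can be evaluated.
  obtain ⟨z, hz, hz0⟩ : ∃ z ∈ MvPolynomial.zeroLocus ℂ p, MvPolynomial.eval z (b₀ * d) ≠ 0 := by
    by_contra! hcon
    refine hbd ?_
    rw [← MvPolynomial.IsPrime.vanishingIdeal_zeroLocus (K := ℂ) p,
      MvPolynomial.mem_vanishingIdeal_iff]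
    intro z hz
    simpa [MvPolynomial.aeval_eq_eval] using hcon z hz
  have hzp (s : MvPolynomial σ ℂ) (hs : φ s = 0) : MvPolynomial.eval z s = 0 := by
    simpa [MvPolynomial.aeval_eq_eval] using
      MvPolynomial.mem_zeroLocus_iff.1 hz s ((hφ s).1 hs)
  rw [map_mul] at hz0
  have hpd (l : Fin n) (P : MvPolynomial σ ℂ) :
      polyDifferential P z (fun s => MvPolynomial.eval z (y (l, s))) =
        MvPolynomial.eval z (∑ s, MvPolynomial.pderiv s P * y (l, s)) := by
    simp [polyDifferential]
  -- The constant $h=b_0d^2$ comes from $d\,D(N)-N\,D(d)=d^2D(N/d)$ applied to `b₀ D l`.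
  refine ⟨z, MvPolynomial.eval z (b₀ * d ^ 2), fun l s => MvPolynomial.eval z (y (l, s)),
    fun P hP => hzp P ((hφ P).2 (hIp ((hI P).2 hP))), right_ne_zero_of_mul hz0, ?_, ?_, ?_⟩
  · rw [map_mul, map_pow]
    exact mul_ne_zero (left_ne_zero_of_mul hz0) (pow_ne_zero _ (right_ne_zero_of_mul hz0))
  · intro l P hP
    rw [hpd]
    refine hzp _ ?_
    rw [hDφ, (hφ P).2 (hIp ((hI P).2 hP)), map_zero, mul_zero]
  · intro l j
    obtain ⟨F, hF⟩ : ∃ F, F = φ (N j) / φ d := ⟨_, rfl⟩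
    have h2 : φ (N j) = F * φ d := by rw [hF, div_mul_cancel₀ _ hφd]
    have h1 : D l (φ (N j)) = (if j = l then φ d else 0) + F * D l (φ d) := by
      rw [h2, Derivation.leibniz, hF, hD l j]
      simp only [smul_eq_mul, mul_ite, mul_one, mul_zero]
      ring
    rw [hpd, hpd, ← sub_eq_zero]
    have h3 := hzp (d * (∑ s, MvPolynomial.pderiv s (N j) * y (l, s)) -
      N j * (∑ s, MvPolynomial.pderiv s d * y (l, s)) - if j = l then b₀ * d ^ 2 else 0) (by
        rw [map_sub, map_sub, map_mul, map_mul, hDφ, hDφ, h1, h2]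
        by_cases hjl : j = l
        · simp only [hjl, if_true, map_mul, map_pow]
          ring
        · simp only [hjl, if_false, map_zero]
          ring)
    by_cases hjl : j = l
    · simpa [hjl] using h3
    · simpa [hjl] using h3

end RationalMaps

/-! ### Derivatives of polynomials and of matrix exponentials along curves. -/

section PolynomialCurves

theorem hasDerivAt_eval_mvPolynomial {𝕜 A σ : Type*} [Fintype σ] [NontriviallyNormedField 𝕜]
    [NormedCommRing A] [NormedAlgebra 𝕜 A] (p : MvPolynomial σ A) {γ : 𝕜 → σ → A} {γ' : σ → A} {t : 𝕜}
    (h : ∀ s, HasDerivAt (fun u => γ u s) (γ' s) t) :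
    HasDerivAt (fun u => MvPolynomial.eval (γ u) p)
      (∑ s, MvPolynomial.eval (γ t) (MvPolynomial.pderiv s p) * γ' s) t := by
  classical
  induction p using MvPolynomial.induction_on with
  | C a => simpa using hasDerivAt_const t a
  | add p q hp hq => simpa [add_mul, Finset.sum_add_distrib] using hp.fun_add hq
  | mul_X p j hp =>
    have h1 := hp.fun_mul (h j)
    have h2 (s : σ) : MvPolynomial.eval (γ t) (MvPolynomial.pderiv s (p * MvPolynomial.X j)) * γ' s =
        MvPolynomial.eval (γ t) (MvPolynomial.pderiv s p) * γ' s * γ t j +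
        if s = j then MvPolynomial.eval (γ t) p * γ' j else 0 := by
      rw [Derivation.leibniz, MvPolynomial.pderiv_X]
      by_cases hs : s = j
      · subst hs; simp; ring
      · simp [hs, Ne.symm hs]; ring
    simp only [h2, Finset.sum_add_distrib, ← Finset.sum_mul]
    simpa using h1

-- The parameter field `𝕂` is kept separate from the entries `A`: complex matrices are exponentiated
-- along complex parameters (for Taylor series) and along real ones (for one parameter groups).
attribute [local instance] Matrix.linftyOpNormedAddCommGroup Matrix.linftyOpNormedRing
  Matrix.linftyOpNormedAlgebra in
theorem hasDerivAt_matrix_exp_entry {𝕂 A : Type*} [RCLike 𝕂] [RCLike A] [NormedAlgebra 𝕂 A] {k : ℕ}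
    (X : Matrix (Fin k) (Fin k) A) (t : 𝕂) (i j : Fin k) :
    HasDerivAt (fun u : 𝕂 => NormedSpace.exp (u • X) i j)
      ((NormedSpace.exp (t • X) * X : Matrix (Fin k) (Fin k) A) i j) t := by
  have h : HasDerivAt (fun u : 𝕂 => NormedSpace.exp (u • X)) (NormedSpace.exp (t • X) * X) t :=
    hasDerivAt_exp_smul_const X t
  let e : Matrix (Fin k) (Fin k) A →ₗ[𝕂] A :=
    { toFun M := M i j
      map_add' _ _ := rfl
      map_smul' _ _ := rfl }
  have he : Continuous e := continuous_apply_apply i j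
  exact (ContinuousLinearMap.hasFDerivAt ⟨e, he⟩).comp_hasDerivAt t h

end PolynomialCurves

/-! ### The Zariski tangent space at the identity and its exponentials. -/

section Tangent

variable {k : ℕ}

/-- A matrix, as a point at which polynomials in the matrix entries can be evaluated. -/
def matPoint {A : Type*} (g : Matrix (Fin k) (Fin k) A) : Fin k × Fin k → A := fun ab => g ab.1 ab.2

/-- The polynomial `p` vanishes on `H`. -/
def VanishesOn (H : Subgroup (GL (Fin k) ℂ)) (p : MvPolynomial (Fin k × Fin k) ℂ) : Prop :=
  ∀ g ∈ H, MvPolynomial.eval (matPoint (g : Matrix (Fin k) (Fin k) ℂ)) p = 0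

/-- The Zariski tangent space of `H` at the unit element. -/
def IsTangentVector (H : Subgroup (GL (Fin k) ℂ)) (X : Matrix (Fin k) (Fin k) ℂ) : Prop :=
  ∀ p, VanishesOn H p → polyDifferential p (matPoint 1) (matPoint X) = 0

theorem polyDifferential_add_smul {σ : Type} [Fintype σ] (p : MvPolynomial σ ℂ) (z Y Y' : σ → ℂ)
    (a : ℂ) : polyDifferential p z (Y + a • Y') =
      polyDifferential p z Y + a * polyDifferential p z Y' := by
  simp only [polyDifferential, Pi.add_apply, Pi.smul_apply, smul_eq_mul, mul_add,
    Finset.sum_add_distrib, Finset.mul_sum]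
  congr 1
  exact Finset.sum_congr rfl fun s _ => by ring

theorem polyDifferential_sum_smul {σ ι : Type} [Fintype σ] [Fintype ι] (p : MvPolynomial σ ℂ)
    (z : σ → ℂ) (Y : ι → σ → ℂ) (a : ι → ℂ) : polyDifferential p z (∑ l, a l • Y l) =
      ∑ l, a l * polyDifferential p z (Y l) := by
  simp only [polyDifferential, Finset.sum_apply, Pi.smul_apply, smul_eq_mul, Finset.mul_sum]
  rw [Finset.sum_comm]
  exact Finset.sum_congr rfl fun s _ => Finset.sum_congr rfl fun l _ => by ring

/-- The polynomial `p(g ·)`. -/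
noncomputable def leftTranslatePoly (g : Matrix (Fin k) (Fin k) ℂ)
    (p : MvPolynomial (Fin k × Fin k) ℂ) : MvPolynomial (Fin k × Fin k) ℂ :=
  MvPolynomial.bind₁ (fun ab => ∑ c, MvPolynomial.C (g ab.1 c) * MvPolynomial.X (c, ab.2)) p

theorem eval_leftTranslatePoly (g h : Matrix (Fin k) (Fin k) ℂ)
    (p : MvPolynomial (Fin k × Fin k) ℂ) :
    MvPolynomial.eval (matPoint h) (leftTranslatePoly g p) =
      MvPolynomial.eval (matPoint (g * h)) p := by
  rw [leftTranslatePoly, MvPolynomial.eval, MvPolynomial.eval₂Hom_bind₁]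
  have : (fun i => MvPolynomial.eval₂Hom (RingHom.id ℂ) (matPoint h)
      (∑ c, MvPolynomial.C (g i.1 c) * MvPolynomial.X (c, i.2))) = matPoint (g * h) := by
    ext i
    simp [matPoint, Matrix.mul_apply]
  rw [this]
  rfl

theorem hasDerivAt_eval_line {σ : Type} [Fintype σ] (p : MvPolynomial σ ℂ) (z Y : σ → ℂ) :
    HasDerivAt (fun t : ℂ => MvPolynomial.eval (z + t • Y) p) (polyDifferential p z Y) 0 := by
  have h := hasDerivAt_eval_mvPolynomial p (γ := fun t : ℂ => z + t • Y) (γ' := Y) (t := 0)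
    (fun s => by
      simpa using (((hasDerivAt_id (0 : ℂ)).mul_const (Y s)).const_add (z s)))
  simpa [polyDifferential] using h

/-- Left translation is linear in the matrix entries, so it carries the line $w+tY$ to the line
$gw+tgY$. -/
theorem polyDifferential_leftTranslatePoly (g w Y : Matrix (Fin k) (Fin k) ℂ)
    (p : MvPolynomial (Fin k × Fin k) ℂ) :
    polyDifferential (leftTranslatePoly g p) (matPoint w) (matPoint Y) =
      polyDifferential p (matPoint (g * w)) (matPoint (g * Y)) := by
  refine (hasDerivAt_eval_line (leftTranslatePoly g p) (matPoint w) (matPoint Y)).unique ?_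
  have h := hasDerivAt_eval_line p (matPoint (g * w)) (matPoint (g * Y))
  have e (t : ℂ) : MvPolynomial.eval (matPoint w + t • matPoint Y) (leftTranslatePoly g p) =
      MvPolynomial.eval (matPoint (g * w) + t • matPoint (g * Y)) p := by
    have h1 : matPoint w + t • matPoint Y = matPoint (w + t • Y) := rfl
    have h2 : matPoint (g * w) + t • matPoint (g * Y) = matPoint (g * (w + t • Y)) := by
      rw [mul_add, Matrix.mul_smul]; rfl
    rw [h1, h2, eval_leftTranslatePoly]
  simpa only [e] using h

variable {H : Subgroup (GL (Fin k) ℂ)}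

theorem VanishesOn.leftTranslatePoly {p : MvPolynomial (Fin k × Fin k) ℂ} (hp : VanishesOn H p)
    {g : GL (Fin k) ℂ} (hg : g ∈ H) : VanishesOn H (leftTranslatePoly (g : Matrix _ _ ℂ) p) := by
  intro h hh
  rw [eval_leftTranslatePoly]
  exact hp (g * h) (H.mul_mem hg hh)

theorem IsTangentVector.translate {X : Matrix (Fin k) (Fin k) ℂ} (hX : IsTangentVector H X)
    {p : MvPolynomial (Fin k × Fin k) ℂ} (hp : VanishesOn H p) {g : GL (Fin k) ℂ} (hg : g ∈ H) :
    polyDifferential p (matPoint (g : Matrix _ _ ℂ)) (matPoint ((g : Matrix _ _ ℂ) * X)) = 0 := by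
  have h := hX _ (hp.leftTranslatePoly hg)
  rwa [polyDifferential_leftTranslatePoly, mul_one] at h

/-- The left invariant vector field of `X` maps the vanishing ideal of `H` to itself:
$q(g)=dp_g(gX)$ is a polynomial, zero on `H` by translation to the identity. -/
theorem IsTangentVector.exists_deriv_poly {X : Matrix (Fin k) (Fin k) ℂ} (hX : IsTangentVector H X)
    {p : MvPolynomial (Fin k × Fin k) ℂ} (hp : VanishesOn H p) :
    ∃ q, VanishesOn H q ∧ ∀ z : ℂ, HasDerivAt
      (fun u : ℂ => MvPolynomial.eval (matPoint (NormedSpace.exp (u • X))) p)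
      (MvPolynomial.eval (matPoint (NormedSpace.exp (z • X))) q) z := by
  refine ⟨∑ ab, MvPolynomial.pderiv ab p *
    ∑ c, MvPolynomial.X (ab.1, c) * MvPolynomial.C (X c ab.2), fun g hg => ?_, fun z => ?_⟩
  · have h := hX.translate hp hg
    simpa [polyDifferential, matPoint, Matrix.mul_apply] using h
  · have h := hasDerivAt_eval_mvPolynomial p
      (γ := fun u : ℂ => matPoint (NormedSpace.exp (u • X))) (t := z)
      (γ' := matPoint (NormedSpace.exp (z • X) * X))
      (fun s => hasDerivAt_matrix_exp_entry X z s.1 s.2)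
    have e : MvPolynomial.eval (matPoint (NormedSpace.exp (z • X)))
        (∑ ab, MvPolynomial.pderiv ab p *
          ∑ c, MvPolynomial.X (ab.1, c) * MvPolynomial.C (X c ab.2)) =
        ∑ s, MvPolynomial.eval (matPoint (NormedSpace.exp (z • X))) (MvPolynomial.pderiv s p) *
          matPoint (NormedSpace.exp (z • X) * X) s := by
      simp [matPoint, Matrix.mul_apply]
    rw [e]
    exact h

/-- Every derivative at $0$ of the entire function $z\mapsto p(e^{zX})$ is the value at the identity
of a polynomial vanishing on `H`, hence $0$; so the Taylor series vanishes. No smoothness or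
dimension count for `H` is needed. -/
theorem IsTangentVector.eval_exp_eq_zero {X : Matrix (Fin k) (Fin k) ℂ} (hX : IsTangentVector H X)
    {p : MvPolynomial (Fin k × Fin k) ℂ} (hp : VanishesOn H p) (z : ℂ) :
    MvPolynomial.eval (matPoint (NormedSpace.exp (z • X))) p = 0 := by
  choose D hD hD' using fun q : {q // VanishesOn H q} => hX.exists_deriv_poly q.2
  let F (q : {q // VanishesOn H q}) (u : ℂ) : ℂ :=
    MvPolynomial.eval (matPoint (NormedSpace.exp (u • X))) q.1
  have hF (q : {q // VanishesOn H q}) : deriv (F q) = F ⟨D q, hD q⟩ :=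
    funext fun u => (hD' q u).deriv
  have h0 (r : ℕ) : ∀ q, iteratedDeriv r (F q) 0 = 0 := by
    induction r with
    | zero =>
      intro q
      simpa [F] using q.2 1 H.one_mem
    | succ r ih =>
      intro q
      rw [iteratedDeriv_succ', hF]
      exact ih _
  have hd : Differentiable ℂ (F ⟨p, hp⟩) := fun u => (hD' ⟨p, hp⟩ u).differentiableAt
  have h := Complex.taylorSeries_eq_of_entire' 0 z hd
  simp only [h0, mul_zero, zero_mul, tsum_zero] at h
  exact h.symm

end Tangent

/-! ### Complex conjugation of polynomials; the determinant polynomial. -/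

section Tangent
variable {k : ℕ}

theorem eval_conj_map_conj {σ : Type*} (z : σ → ℂ) (p : MvPolynomial σ ℂ) :
    MvPolynomial.eval (fun s => starRingEnd ℂ (z s)) (MvPolynomial.map (starRingEnd ℂ) p) =
      starRingEnd ℂ (MvPolynomial.eval z p) := by
  rw [MvPolynomial.eval_map, MvPolynomial.eval, MvPolynomial.coe_eval₂Hom,
    MvPolynomial.eval₂_comp_left]
  rfl

theorem polyDifferential_conj {σ : Type} [Fintype σ] (z Y : σ → ℂ) (p : MvPolynomial σ ℂ) :
    polyDifferential (MvPolynomial.map (starRingEnd ℂ) p) (fun s => starRingEnd ℂ (z s))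
      (fun s => starRingEnd ℂ (Y s)) = starRingEnd ℂ (polyDifferential p z Y) := by
  simp only [polyDifferential, map_sum, map_mul, MvPolynomial.pderiv_map, eval_conj_map_conj]

/-- The complex polynomial with the same coefficients as a real polynomial. -/
noncomputable def complexPoly {σ : Type*} (p : MvPolynomial σ ℝ) : MvPolynomial σ ℂ :=
  MvPolynomial.map (algebraMap ℝ ℂ) p

theorem eval_complexPoly {σ : Type*} (z : σ → ℂ) (p : MvPolynomial σ ℝ) :
    MvPolynomial.eval z (complexPoly p) = MvPolynomial.aeval z p := by
  rw [complexPoly, MvPolynomial.eval_map, MvPolynomial.aeval_def]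

theorem conj_map_complexPoly {σ : Type*} (p : MvPolynomial σ ℝ) :
    MvPolynomial.map (starRingEnd ℂ) (complexPoly p) = complexPoly p := by
  rw [complexPoly, MvPolynomial.map_map]
  have : (starRingEnd ℂ).comp (algebraMap ℝ ℂ) = algebraMap ℝ ℂ :=
    RingHom.ext fun x => Complex.conj_ofReal x
  rw [this]

/-- The determinant, as a polynomial in the entries of a matrix. -/
noncomputable def detPoly (k : ℕ) : MvPolynomial (Fin k × Fin k) ℂ :=
  (Matrix.mvPolynomialX (Fin k) (Fin k) ℂ).det

theorem eval_detPoly (g : Matrix (Fin k) (Fin k) ℂ) :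
    MvPolynomial.eval (matPoint g) (detPoly k) = g.det := by
  rw [detPoly, RingHom.map_det]
  congr 1
  ext i j
  simp [matPoint, Matrix.mvPolynomialX]

end Tangent

/-! ### From the Zariski tangent space of `GC` to the Lie algebra of `G`. -/

namespace PrehomogeneousSpace.RealPrehomogeneousSpace

variable {k n : ℕ} (P : RealPrehomogeneousSpace k n)

/-- The real equations of `GC`, read as complex polynomials, belong to its vanishing ideal. -/
theorem mem_GC_of_vanishing {g : GL (Fin k) ℂ}
    (h : ∀ p, VanishesOn P.GC p → MvPolynomial.eval (matPoint (g : Matrix _ _ ℂ)) p = 0) :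
    g ∈ P.GC := by
  obtain ⟨I, hI⟩ := P.defined_over_real
  rw [← SetLike.mem_coe, hI]
  intro p hp
  rw [← eval_complexPoly]
  refine h _ fun w hw => ?_
  rw [eval_complexPoly]
  rw [← SetLike.mem_coe, hI] at hw
  exact hw p hp

theorem matPoint_map_conj (g : GL (Fin k) ℂ) :
    matPoint (Matrix.GeneralLinearGroup.map (starRingEnd ℂ) g : Matrix (Fin k) (Fin k) ℂ) =
      fun s => starRingEnd ℂ (matPoint (g : Matrix _ _ ℂ) s) := rfl

theorem conj_mem_GC {g : GL (Fin k) ℂ} (hg : g ∈ P.GC) :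
    Matrix.GeneralLinearGroup.map (starRingEnd ℂ) g ∈ P.GC := by
  obtain ⟨I, hI⟩ := P.defined_over_real
  rw [← SetLike.mem_coe, hI] at hg ⊢
  intro p hp
  have h := hg p hp
  rw [← eval_complexPoly] at h ⊢
  have h' : MvPolynomial.eval (matPoint (g : Matrix _ _ ℂ)) (complexPoly p) = 0 := h
  have e := eval_conj_map_conj (matPoint (g : Matrix _ _ ℂ)) (complexPoly p)
  rw [conj_map_complexPoly, h', map_zero, ← matPoint_map_conj] at e
  exact e

/-- `GC` has real equations, so its vanishing ideal is stable under conjugation, and the base point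
$1$ is real. This is what makes real and imaginary parts of tangent vectors tangent. -/
theorem isTangentVector_conj {X : Matrix (Fin k) (Fin k) ℂ} (hX : IsTangentVector P.GC X) :
    IsTangentVector P.GC (X.map (starRingEnd ℂ)) := by
  intro p hp
  have h1 : VanishesOn P.GC (MvPolynomial.map (starRingEnd ℂ) p) := by
    intro g hg
    have h2 := hp _ (P.conj_mem_GC hg)
    have h3 := eval_conj_map_conj (matPoint
      ((Matrix.GeneralLinearGroup.map (starRingEnd ℂ) g : GL (Fin k) ℂ) : Matrix _ _ ℂ)) p
    rw [h2, map_zero] at h3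
    rw [← h3]
    congr 2
    ext s
    simp [matPoint]
  have h4 := hX _ h1
  have h5 := polyDifferential_conj (matPoint (1 : Matrix (Fin k) (Fin k) ℂ))
    (matPoint (X.map (starRingEnd ℂ))) p
  have h6 : (fun s => starRingEnd ℂ (matPoint (1 : Matrix (Fin k) (Fin k) ℂ) s)) = matPoint 1 := by
    ext s
    simp [matPoint, Matrix.one_apply, apply_ite]
  have h7 : (fun s => starRingEnd ℂ (matPoint (X.map (starRingEnd ℂ)) s)) = matPoint X := by
    ext s
    simp [matPoint]
  rw [h6, h7, h4] at h5
  exact ((map_eq_zero (starRingEnd ℂ)).1 h5.symm)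

/-- The exponential of a complex matrix, as an element of `GL(k, ℂ)`. -/
noncomputable def expGLC (X : Matrix (Fin k) (Fin k) ℂ) : GL (Fin k) ℂ where
  val := NormedSpace.exp X
  inv := NormedSpace.exp (-X)
  val_inv := by
    rw [← Matrix.exp_add_of_commute _ _ ((Commute.refl X).neg_right), add_neg_cancel,
      NormedSpace.exp_zero]
  inv_val := by
    rw [← Matrix.exp_add_of_commute _ _ ((Commute.refl X).neg_left), neg_add_cancel,
      NormedSpace.exp_zero]

theorem expGLC_mem {X : Matrix (Fin k) (Fin k) ℂ} (hX : IsTangentVector P.GC X) (t : ℝ) :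
    expGLC (t • X) ∈ P.GC := by
  refine P.mem_GC_of_vanishing fun p hp => ?_
  have h := hX.eval_exp_eq_zero hp (t : ℂ)
  rwa [Complex.coe_smul] at h

attribute [local instance] Matrix.linftyOpNormedAddCommGroup Matrix.linftyOpNormedRing
  Matrix.linftyOpNormedAlgebra in
theorem matrix_exp_map_ofReal (X : Matrix (Fin k) (Fin k) ℝ) :
    (NormedSpace.exp X).map Complex.ofReal = NormedSpace.exp (X.map Complex.ofReal) := by
  have hc : Continuous (Complex.ofRealHom.mapMatrix (m := Fin k)) :=
    continuous_matrix fun i j => Complex.continuous_ofReal.comp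
      ((continuous_id (X := Matrix (Fin k) (Fin k) ℝ)).matrix_elem i j)
  exact NormedSpace.map_exp (Complex.ofRealHom.mapMatrix (m := Fin k)) hc X

theorem complexify_expGL (X : Matrix (Fin k) (Fin k) ℝ) (t : ℝ) :
    complexify k (expGL (t • X)) = expGLC (t • X.map Complex.ofReal) := by
  ext i j
  refine (congrFun (congrFun (matrix_exp_map_ofReal (t • X)) i) j).trans ?_
  have h : (t • X).map Complex.ofReal = t • X.map Complex.ofReal := by
    ext a b
    simp
  rw [h]
  rfl

theorem continuous_expGL (X : Matrix (Fin k) (Fin k) ℝ) :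
    Continuous fun t : ℝ => expGL (t • X) := by
  have h (Y : Matrix (Fin k) (Fin k) ℝ) : Continuous fun t : ℝ => NormedSpace.exp (t • Y) :=
    continuous_matrix fun i j => continuous_iff_continuousAt.2 fun t =>
      (hasDerivAt_matrix_exp_entry Y t i j).continuousAt
  rw [Units.continuous_iff]
  refine ⟨h X, ?_⟩
  have e : (fun t : ℝ => ((expGL (t • X))⁻¹ : GL (Fin k) ℝ).val) =
      fun t : ℝ => NormedSpace.exp (t • (-X)) := by
    ext1 t
    rw [smul_neg]
    rfl
  exact e ▸ h (-X)

/-- The exponentials lie in `GR`, and the curve $s\mapsto e^{sX}$ is connected and passes through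
the identity, so it stays in the identity component. -/
theorem mem_lieAlg_of_isTangentVector {X : Matrix (Fin k) (Fin k) ℝ}
    (hX : IsTangentVector P.GC (X.map Complex.ofReal)) : X ∈ P.lieAlg := by
  have hmem (t : ℝ) : expGL (t • X) ∈ P.GR := by
    change complexify k (expGL (t • X)) ∈ P.GC
    rw [complexify_expGL]
    exact P.expGLC_mem hX t
  intro t
  refine ⟨⟨_, hmem t⟩, ?_, rfl⟩
  have hc : Continuous fun s : ℝ => (⟨expGL (s • X), hmem s⟩ : P.GR) :=
    (continuous_expGL X).subtype_mk _
  have h1 : (⟨expGL ((0 : ℝ) • X), hmem 0⟩ : P.GR) = 1 := by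
    refine Subtype.ext (Units.ext ?_)
    change NormedSpace.exp ((0 : ℝ) • X) = 1
    rw [zero_smul, NormedSpace.exp_zero]
  have hconn : IsPreconnected (Set.range fun s : ℝ => (⟨expGL (s • X), hmem s⟩ : P.GR)) :=
    isPreconnected_range hc
  exact hconn.subset_connectedComponent (x := 1) ⟨0, h1⟩ ⟨t, rfl⟩

end PrehomogeneousSpace.RealPrehomogeneousSpace

/-! ### Submersivity of the orbit maps. -/

namespace PrehomogeneousSpace.RealPrehomogeneousSpace

variable {k n : ℕ} (P : RealPrehomogeneousSpace k n)

/-- The point `g m`, for `g ∈ G_ℂ` and `m ∈ V_ℂ`. -/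
def actC (g : P.GC) (m : Fin n → ℂ) : Fin n → ℂ := (P.ρ g : Matrix (Fin n) (Fin n) ℂ).mulVec m

theorem actC_mul (g h : P.GC) (m : Fin n → ℂ) : P.actC (g * h) m = P.actC g (P.actC h m) := by
  simp [actC]

/-- All coordinates of the orbit map get one denominator, a power of the determinant. The exponent
is written `r + 1` to be positive, so that nonvanishing of the denominator implies nonvanishing of
the determinant. -/
theorem exists_orbit_numerator (m : Fin n → ℂ) :
    ∃ (N : Fin n → MvPolynomial (Fin k × Fin k) ℂ) (r : ℕ), ∀ (g : P.GC) (j : Fin n),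
      P.actC g m j = MvPolynomial.eval (matPoint ((g : GL (Fin k) ℂ) : Matrix _ _ ℂ)) (N j) /
        MvPolynomial.eval (matPoint ((g : GL (Fin k) ℂ) : Matrix _ _ ℂ)) (detPoly k ^ (r + 1)) := by
  choose p r h using P.rational
  let R := ∑ i, ∑ j, r i j
  have hR (i j : Fin n) : r i j ≤ R + 1 :=
    ((Finset.single_le_sum (f := fun j => r i j) (fun _ _ => Nat.zero_le _)
      (Finset.mem_univ j)).trans (Finset.single_le_sum (f := fun i => ∑ j, r i j)
        (fun _ _ => Nat.zero_le _) (Finset.mem_univ i))).trans (Nat.le_succ _)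
  refine ⟨fun j => ∑ b, complexPoly (p j b) * detPoly k ^ (R + 1 - r j b) * MvPolynomial.C (m b), R,
    fun g j => ?_⟩
  have hdet : Matrix.det ((g : GL (Fin k) ℂ) : Matrix (Fin k) (Fin k) ℂ) ≠ 0 :=
    (Matrix.isUnit_iff_isUnit_det _ |>.1 (g : GL (Fin k) ℂ).isUnit).ne_zero
  simp only [actC, Matrix.mulVec, dotProduct, map_sum, map_mul, map_pow, eval_detPoly,
    eval_complexPoly, MvPolynomial.eval_C, Finset.sum_div]
  refine Finset.sum_congr rfl fun b _ => ?_
  have h1 : (P.ρ g : Matrix (Fin n) (Fin n) ℂ) j b =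
      MvPolynomial.aeval (matPoint ((g : GL (Fin k) ℂ) : Matrix _ _ ℂ)) (p j b) *
        (Matrix.det ((g : GL (Fin k) ℂ) : Matrix (Fin k) (Fin k) ℂ) ^ r j b)⁻¹ :=
    (h j b g).trans (by rw [inv_pow]; rfl)
  rw [h1, pow_sub₀ _ hdet (hR j b)]
  generalize Matrix.det ((g : GL (Fin k) ℂ) : Matrix (Fin k) (Fin k) ℂ) = D at hdet
  field_simp

theorem actC_ofReal (g : P.GR) (m : Euc n) (j : Fin n) :
    P.actC ⟨complexify k g, g.2⟩ (fun i => (m i : ℂ)) j = ((P.act g m j : ℝ) : ℂ) := by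
  rw [actC, ← rhoReal_spec]
  simp only [act, Matrix.mulVec, dotProduct, Matrix.map_apply]
  change _ = (((P.rhoReal g).mulVec m j : ℝ) : ℂ)
  simp [Matrix.mulVec, dotProduct, rhoReal]

/-- The orbit map of a point with Zariski dense orbit is submersive at the unit element. -/
theorem exists_tangent_deriv_actC {m : Fin n → ℂ} (hm : IsZariskiDense (P.orbitC m)) :
    ∃ L : Matrix (Fin k) (Fin k) ℂ → Fin n → ℂ,
      (∀ X Y (a : ℂ), L (X + a • Y) = L X + a • L Y) ∧
      (∀ X (hX : IsTangentVector P.GC X) j,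
        HasDerivAt (fun t : ℝ => P.actC ⟨expGLC (t • X), P.expGLC_mem hX t⟩ m j) (L X j) 0) ∧
      ∀ v : Fin n → ℂ, ∃ X, IsTangentVector P.GC X ∧ L X = v := by
  obtain ⟨N, r, hN⟩ := P.exists_orbit_numerator m
  set d := detPoly k ^ (r + 1) with hd
  have hd0 (g : GL (Fin k) ℂ) :
      MvPolynomial.eval (matPoint (g : Matrix (Fin k) (Fin k) ℂ)) d ≠ 0 := by
    rw [hd, map_pow, eval_detPoly]
    exact pow_ne_zero _ (Matrix.isUnit_iff_isUnit_det _ |>.1 g.isUnit).ne_zero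
  -- the derivative of the orbit map at `z` in the direction `Y`
  let Q (z Y : Matrix (Fin k) (Fin k) ℂ) (j : Fin n) : ℂ :=
    (polyDifferential (N j) (matPoint z) (matPoint Y) * MvPolynomial.eval (matPoint z) d -
      MvPolynomial.eval (matPoint z) (N j) * polyDifferential d (matPoint z) (matPoint Y)) /
      MvPolynomial.eval (matPoint z) d ^ 2
  have hderiv (g : P.GC) {X} (hX : IsTangentVector P.GC X) (j : Fin n) :
      HasDerivAt (fun t : ℝ => P.actC (g * ⟨expGLC (t • X), P.expGLC_mem hX t⟩) m j)
        (Q (g : GL (Fin k) ℂ) ((g : GL (Fin k) ℂ) * X) j) 0 := by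
    let γ (t : ℝ) : Fin k × Fin k → ℂ :=
      matPoint (((g : GL (Fin k) ℂ) : Matrix (Fin k) (Fin k) ℂ) * NormedSpace.exp (t • X))
    have hγ0 : γ 0 = matPoint ((g : GL (Fin k) ℂ) : Matrix (Fin k) (Fin k) ℂ) := by
      simp only [γ, zero_smul, NormedSpace.exp_zero, mul_one]
    have hγ (s : Fin k × Fin k) : HasDerivAt (fun t => γ t s)
        (matPoint (((g : GL (Fin k) ℂ) : Matrix (Fin k) (Fin k) ℂ) * X) s) 0 := by
      simp only [γ, matPoint, Matrix.mul_apply]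
      refine HasDerivAt.fun_sum fun c _ => HasDerivAt.const_mul _ ?_
      simpa using hasDerivAt_matrix_exp_entry X (0 : ℝ) c s.2
    have h1 := hasDerivAt_eval_mvPolynomial (N j) hγ
    have h2 := hasDerivAt_eval_mvPolynomial d hγ
    have h3 := h1.fun_div h2 (by rw [hγ0]; exact hd0 g)
    rw [hγ0] at h3
    refine h3.congr_of_eventuallyEq (Eventually.of_forall fun t => ?_)
    exact hN _ j
  have hQlin (z X Y : Matrix (Fin k) (Fin k) ℂ) (a : ℂ) : Q z (X + a • Y) = Q z X + a • Q z Y := by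
    ext j
    have e : matPoint (X + a • Y) = matPoint X + a • matPoint Y := rfl
    simp only [Q, e, polyDifferential_add_smul, Pi.add_apply, Pi.smul_apply, smul_eq_mul]
    ring
  -- Density of the orbit says exactly that the orbit map, as a rational map on `GC`, has Zariski
  -- dense image.
  obtain ⟨z, h, Y, hz, hdz, hh, hY, hNY⟩ := exists_submersive_point
    (Set.range fun g : P.GC => matPoint ((g : GL (Fin k) ℂ) : Matrix (Fin k) (Fin k) ℂ)) N d
    (by rintro _ ⟨g, rfl⟩; exact hd0 g) (fun q hq => hm q (by
      rintro _ ⟨g, rfl⟩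
      have := hq _ ⟨g, rfl⟩
      simp only [← hN] at this
      exact this))
  have hvan {p : MvPolynomial (Fin k × Fin k) ℂ} (hp : VanishesOn P.GC p) :
      ∀ w ∈ Set.range fun g : P.GC => matPoint ((g : GL (Fin k) ℂ) : Matrix (Fin k) (Fin k) ℂ),
        MvPolynomial.eval w p = 0 := by
    rintro _ ⟨g, rfl⟩
    exact hp g g.2
  let zM : Matrix (Fin k) (Fin k) ℂ := Matrix.of fun i j => z (i, j)
  have hzM : matPoint zM = z := rfl
  have hzdet : zM.det ≠ 0 := by
    rw [← hzM, hd, map_pow, eval_detPoly] at hdz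
    exact fun h0 => hdz (by rw [h0, zero_pow (Nat.succ_ne_zero r)])
  let g₀ : GL (Fin k) ℂ := Matrix.GeneralLinearGroup.mkOfDetNeZero zM hzdet
  have hg₀M : (g₀ : Matrix (Fin k) (Fin k) ℂ) = zM := rfl
  -- The submersive point is only known to lie in the Zariski closure, but `GC` is closed among
  -- invertible matrices, so it is a group element.
  have hg₀ : g₀ ∈ P.GC := P.mem_GC_of_vanishing fun p hp => hz p (hvan hp)
  let YM (l : Fin n) : Matrix (Fin k) (Fin k) ℂ := Matrix.of fun i j => Y l (i, j)
  have hYM (l : Fin n) : matPoint (YM l) = Y l := rfl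
  have hinv : ((g₀⁻¹ : GL (Fin k) ℂ) : Matrix (Fin k) (Fin k) ℂ) * zM = 1 := by
    rw [← hg₀M, ← Units.val_mul, inv_mul_cancel, Units.val_one]
  have hinv' : zM * ((g₀⁻¹ : GL (Fin k) ℂ) : Matrix (Fin k) (Fin k) ℂ) = 1 := by
    rw [← hg₀M, ← Units.val_mul, mul_inv_cancel, Units.val_one]
  refine ⟨Q 1, hQlin 1, fun X hX j => ?_, fun v => ?_⟩
  · have := hderiv 1 hX j
    simpa only [one_mul, OneMemClass.coe_one, Units.val_one] using this
  -- Since $g_0e^{tX}m=g_0(e^{tX}m)$, velocity $v$ at the identity corresponds to velocity $w=g_0v$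
  -- at $g_0$. The factor $d^2/h$ in `c` normalizes the vectors `Y l` so that their images under the
  -- differential of the orbit map are the basis vectors.
  · let w := P.actC ⟨g₀, hg₀⟩ v
    let c (l : Fin n) : ℂ := MvPolynomial.eval z d ^ 2 / h * w l
    let YS : Matrix (Fin k) (Fin k) ℂ := ∑ l, c l • YM l
    have hYS : matPoint YS = ∑ l, c l • Y l := by
      ext s
      simp [matPoint, YS, Matrix.sum_apply, Finset.sum_apply, YM]
    have hX : IsTangentVector P.GC (((g₀⁻¹ : GL (Fin k) ℂ) : Matrix (Fin k) (Fin k) ℂ) * YS) := by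
      intro p hp
      rw [← hinv, ← polyDifferential_leftTranslatePoly, hzM, hYS, polyDifferential_sum_smul]
      refine Finset.sum_eq_zero fun l _ => ?_
      rw [hY l _ (hvan (hp.leftTranslatePoly (P.GC.inv_mem hg₀))), mul_zero]
    generalize hX₁ : ((g₀⁻¹ : GL (Fin k) ℂ) : Matrix (Fin k) (Fin k) ℂ) * YS = X₁ at hX
    refine ⟨X₁, hX, ?_⟩
    have hQw : Q zM YS = w := by
      ext j
      have h1 : MvPolynomial.eval z d * polyDifferential (N j) z (∑ l, c l • Y l) -
          MvPolynomial.eval z (N j) * polyDifferential d z (∑ l, c l • Y l) = c j * h := by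
        rw [polyDifferential_sum_smul, polyDifferential_sum_smul, Finset.mul_sum, Finset.mul_sum,
          ← Finset.sum_sub_distrib]
        have h2 (l : Fin n) : MvPolynomial.eval z d * (c l * polyDifferential (N j) z (Y l)) -
            MvPolynomial.eval z (N j) * (c l * polyDifferential d z (Y l)) =
            if j = l then c l * h else 0 := by
          have := hNY l j
          calc _ = c l * (MvPolynomial.eval z d * polyDifferential (N j) z (Y l) -
              MvPolynomial.eval z (N j) * polyDifferential d z (Y l)) := by ring
            _ = _ := by rw [this]; split_ifs <;> simp
        simp [h2]
      simp only [Q, hzM, hYS]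
      rw [mul_comm (polyDifferential (N j) z _), h1]
      simp only [c]
      field_simp
    ext j
    have h1 : HasDerivAt (fun t : ℝ => P.actC ⟨expGLC (t • X₁), P.expGLC_mem hX t⟩ m j)
        (Q 1 X₁ j) 0 := by
      have := hderiv 1 hX j
      simpa only [one_mul, OneMemClass.coe_one, Units.val_one] using this
    refine h1.unique ?_
    have h2 (b : Fin n) := hderiv ⟨g₀, hg₀⟩ hX b
    have e1 : (g₀ : Matrix (Fin k) (Fin k) ℂ) * X₁ = YS := by
      rw [hg₀M, ← hX₁, ← mul_assoc, hinv', one_mul]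
    have e2 : (g₀ : Matrix (Fin k) (Fin k) ℂ) = zM := rfl
    simp only [e1] at h2
    rw [e2, hQw] at h2
    -- Applying the constant matrix $\rho(g_0)^{-1}$ brings the derivative from $g_0$ back to the
    -- identity.
    have h3 : HasDerivAt (fun t : ℝ => ∑ b, (P.ρ ⟨g₀, hg₀⟩⁻¹ : Matrix (Fin n) (Fin n) ℂ) j b *
        P.actC (⟨g₀, hg₀⟩ * ⟨expGLC (t • X₁), P.expGLC_mem hX t⟩) m b)
        (∑ b, (P.ρ ⟨g₀, hg₀⟩⁻¹ : Matrix (Fin n) (Fin n) ℂ) j b * w b) 0 :=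
      HasDerivAt.fun_sum fun b _ => (h2 b).const_mul _
    have h4 (u : Fin n → ℂ) (b : Fin n) : ∑ b, (P.ρ ⟨g₀, hg₀⟩⁻¹ : Matrix (Fin n) (Fin n) ℂ) j b *
        P.actC ⟨g₀, hg₀⟩ u b = u j := by
      change P.actC ⟨g₀, hg₀⟩⁻¹ (P.actC ⟨g₀, hg₀⟩ u) j = u j
      rw [← actC_mul, inv_mul_cancel]
      simp [actC]
    simp only [actC_mul, h4 _ j, w] at h3
    exact h3

/-- The orbit map of the identity component is submersive at the points outside the singular
set. -/
theorem exists_lieAlg_deriv_act {m : Euc n} (hm : m ∉ P.singularR) (v : Euc n) :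
    ∃ X : P.lieAlg, ∀ j, HasDerivAt (fun t : ℝ =>
      P.act ⟨expGL (t • (X : Matrix (Fin k) (Fin k) ℝ)), P.G_le_GR (X.2 t)⟩ m j) (v j) 0 := by
  have hm' : IsZariskiDense (P.orbitC fun i => (m i : ℂ)) := by
    by_contra h
    exact hm h
  obtain ⟨L, hlin, hL, hsurj⟩ := P.exists_tangent_deriv_actC hm'
  obtain ⟨X, hX, hXv⟩ := hsurj fun j => (v j : ℂ)
  have hconj := P.isTangentVector_conj hX
  have hcomb (a b : ℂ) : IsTangentVector P.GC (a • X + b • X.map (starRingEnd ℂ)) := by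
    intro p hp
    have e : matPoint (a • X + b • X.map (starRingEnd ℂ)) =
      (0 + a • matPoint X) + b • matPoint (X.map (starRingEnd ℂ)) := by ext; simp [matPoint]
    have e0 : polyDifferential p (matPoint 1) 0 = 0 := by simp [polyDifferential]
    rw [e, polyDifferential_add_smul, polyDifferential_add_smul, hX p hp, hconj p hp, e0]
    simp
  let A : Matrix (Fin k) (Fin k) ℝ := X.map Complex.re
  let B : Matrix (Fin k) (Fin k) ℝ := X.map Complex.im
  have hA : IsTangentVector P.GC (A.map Complex.ofReal) := by
    convert hcomb (1 / 2) (1 / 2) using 1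
    ext i j
    simp only [A, Matrix.map_apply, Matrix.add_apply, Matrix.smul_apply, smul_eq_mul]
    rw [Complex.re_eq_add_conj]
    ring
  have hB : IsTangentVector P.GC (B.map Complex.ofReal) := by
    convert hcomb (1 / (2 * Complex.I)) (-(1 / (2 * Complex.I))) using 1
    ext i j
    simp only [B, Matrix.map_apply, Matrix.add_apply, Matrix.smul_apply, smul_eq_mul]
    rw [Complex.im_eq_sub_conj]
    ring
  have hXAB : X = A.map Complex.ofReal + Complex.I • B.map Complex.ofReal := by
    ext i j
    simp only [A, B, Matrix.map_apply, Matrix.add_apply, Matrix.smul_apply, smul_eq_mul]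
    rw [mul_comm, Complex.re_add_im]
  have hreal {C : Matrix (Fin k) (Fin k) ℝ} (hC : IsTangentVector P.GC (C.map Complex.ofReal))
      (j : Fin n) : HasDerivAt (fun t : ℝ => P.act ⟨expGL (t • C),
        P.G_le_GR (P.mem_lieAlg_of_isTangentVector hC t)⟩ m j)
          (L (C.map Complex.ofReal) j).re 0 ∧ (L (C.map Complex.ofReal) j).im = 0 := by
    have h1 := hL _ hC j
    have h2 (t : ℝ) : P.actC ⟨expGLC (t • C.map Complex.ofReal), P.expGLC_mem hC t⟩
        (fun i => (m i : ℂ)) j = ((P.act ⟨expGL (t • C),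
          P.G_le_GR (P.mem_lieAlg_of_isTangentVector hC t)⟩ m j : ℝ) : ℂ) := by
      rw [← actC_ofReal]
      congr 2
      exact (complexify_expGL C t).symm
    simp only [h2] at h1
    refine ⟨?_, ?_⟩
    · exact Complex.reCLM.hasFDerivAt.comp_hasDerivAt (0 : ℝ) h1
    · have h3 := Complex.imCLM.hasFDerivAt.comp_hasDerivAt (0 : ℝ) h1
      have h4 : HasDerivAt (fun _ : ℝ => (0 : ℝ)) (L (C.map Complex.ofReal) j).im 0 := by
        simpa [Function.comp_def] using h3
      exact h4.unique (hasDerivAt_const _ _)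
  -- Both $L(A)$ and $L(B)$ are real, being velocities of curves in $V_{\mathbb R}$. As
  -- $L(A)+iL(B)=v$ is real, $L(A)=v$, and the real part of `X` suffices.
  refine ⟨⟨A, P.mem_lieAlg_of_isTangentVector hA⟩, fun j => ?_⟩
  have h1 := (hreal hA j).1
  have h2 : (L (A.map Complex.ofReal) j).re = v j := by
    have h3 := congrFun hXv j
    rw [hXAB, hlin] at h3
    have h4 := congrArg Complex.re h3
    simpa [(hreal hB j).2] using h4
  rwa [h2] at h1

end PrehomogeneousSpace.RealPrehomogeneousSpace

/-! ### Topology of the real general linear group. -/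

section GeneralLinearGroup

attribute [local instance] Matrix.linftyOpNormedAddCommGroup Matrix.linftyOpNormedRing
  Matrix.linftyOpNormedAlgebra in
theorem isOpenEmbedding_generalLinearGroup_val (k : ℕ) :
    IsOpenEmbedding (Units.val : GL (Fin k) ℝ → Matrix (Fin k) (Fin k) ℝ) :=
  Units.isOpenEmbedding_val (R := Matrix (Fin k) (Fin k) ℝ)

instance locallyCompactSpace_generalLinearGroup (k : ℕ) : LocallyCompactSpace (GL (Fin k) ℝ) :=
  have : LocallyCompactSpace (Matrix (Fin k) (Fin k) ℝ) :=
    inferInstanceAs (LocallyCompactSpace (Fin k → Fin k → ℝ))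
  (isOpenEmbedding_generalLinearGroup_val k).locallyCompactSpace

instance secondCountableTopology_generalLinearGroup (k : ℕ) :
    SecondCountableTopology (GL (Fin k) ℝ) :=
  have : SecondCountableTopology (Matrix (Fin k) (Fin k) ℝ) :=
    inferInstanceAs (SecondCountableTopology (Fin k → Fin k → ℝ))
  (isOpenEmbedding_generalLinearGroup_val k).isEmbedding.secondCountableTopology

end GeneralLinearGroup

/-! ### Topology of `G`, and exponential bounds for matrix entries. -/

namespace PrehomogeneousSpace.RealPrehomogeneousSpace

variable {k n : ℕ} (P : RealPrehomogeneousSpace k n)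

theorem isClosed_GR : IsClosed (P.GR : Set (GL (Fin k) ℝ)) := by
  obtain ⟨I, hI⟩ := P.defined_over_real
  have e : (P.GR : Set (GL (Fin k) ℝ)) = ⋂ p ∈ I, {g | MvPolynomial.eval (matPoint
      ((g : GL (Fin k) ℝ) : Matrix (Fin k) (Fin k) ℝ)) p = 0} := by
    ext g
    have h1 : g ∈ P.GR ↔ complexify k g ∈ (P.GC : Set (GL (Fin k) ℂ)) := Iff.rfl
    rw [SetLike.mem_coe, h1, hI]
    simp only [Set.mem_iInter, Set.mem_ofPred_eq, zeroLocus]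
    refine forall₂_congr fun p _ => ?_
    have h2 : MvPolynomial.aeval (fun ij : Fin k × Fin k =>
        ((complexify k g : GL (Fin k) ℂ) : Matrix _ _ ℂ) ij.1 ij.2) p =
        ((MvPolynomial.eval (matPoint (g : Matrix (Fin k) (Fin k) ℝ)) p : ℝ) : ℂ) := by
      rw [← MvPolynomial.aeval_eq_eval]
      exact MvPolynomial.aeval_algebraMap_apply ℂ (matPoint (g : Matrix (Fin k) (Fin k) ℝ)) p
    rw [h2, Complex.ofReal_eq_zero]
  rw [e]
  refine isClosed_biInter fun p _ => isClosed_eq ?_ continuous_const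
  refine (MvPolynomial.continuous_eval p).comp (continuous_pi fun ij => ?_)
  exact (Units.continuous_val (M := Matrix (Fin k) (Fin k) ℝ)).matrix_elem ij.1 ij.2

theorem isClosed_G : IsClosed (P.G : Set (GL (Fin k) ℝ)) := by
  have h : (P.G : Set (GL (Fin k) ℝ)) = Subtype.val '' connectedComponent (1 : P.GR) := rfl
  rw [h]
  exact P.isClosed_GR.isClosedEmbedding_subtypeVal.isClosedMap _ isClosed_connectedComponent

/-- Together with second countability this makes Haar measure on `G` σ-finite, as needed for Fubini.
-/
instance : LocallyCompactSpace P.G :=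
  P.isClosed_G.isClosedEmbedding_subtypeVal.locallyCompactSpace

instance : SecondCountableTopology P.G :=
  inferInstanceAs (SecondCountableTopology (P.G : Set (GL (Fin k) ℝ)))

/-- The entries of `g`, as a point at which polynomials can be evaluated. -/
def gPoint (g : P.G) : Fin k × Fin k → ℝ :=
  matPoint ((g : GL (Fin k) ℝ) : Matrix (Fin k) (Fin k) ℝ)

theorem continuous_gPoint : Continuous P.gPoint :=
  continuous_pi fun ij => (Units.continuous_val.comp continuous_subtype_val).matrix_elem ij.1 ij.2

/-! ### The weights `e^{κ|g|}` -/

/-- `dist1` may formally be infinite, and then distributivity in `EReal` requires nonnegative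
exponents. Working with extended values makes a proof that `dist1` is finite unnecessary. -/
theorem expDist_add {κ κ' : ℝ} (h : 0 ≤ κ) (h' : 0 ≤ κ') (g : P.G) :
    P.expDist (κ + κ') g = P.expDist κ g * P.expDist κ' g := by
  rw [expDist, expDist, expDist, ← EReal.exp_add, EReal.coe_add,
    EReal.right_distrib_of_nonneg (EReal.coe_nonneg.2 h) (EReal.coe_nonneg.2 h')]

theorem one_le_expDist {κ : ℝ} (h : 0 ≤ κ) (g : P.G) : 1 ≤ P.expDist κ g := by
  rw [expDist, EReal.one_le_exp_iff]
  exact mul_nonneg (EReal.coe_nonneg.2 h) (EReal.coe_ennreal_nonneg _)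

theorem expDist_mono {κ κ' : ℝ} (h : 0 ≤ κ) (h' : κ ≤ κ') (g : P.G) :
    P.expDist κ g ≤ P.expDist κ' g := by
  have e := P.expDist_add h (sub_nonneg.2 h') g
  rw [add_sub_cancel] at e
  rw [e]
  exact le_mul_of_one_le_right' (P.one_le_expDist (sub_nonneg.2 h') g)

/-- Functions of at most exponential growth. -/
def Tempered (u : P.G → ℝ) : Prop :=
  ∃ (C : NNReal) (κ : ℝ), 0 ≤ κ ∧ ∀ g, ‖u g‖ₑ ≤ C * P.expDist κ g

variable {P}

theorem Tempered.const (c : ℝ) : P.Tempered fun _ => c :=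
  ⟨‖c‖₊, 0, le_rfl, fun g => le_mul_of_one_le_right' (P.one_le_expDist le_rfl g)⟩

theorem Tempered.add {u v : P.G → ℝ} (hu : P.Tempered u) (hv : P.Tempered v) :
    P.Tempered fun g => u g + v g := by
  obtain ⟨C, κ, hκ, h⟩ := hu
  obtain ⟨C', κ', hκ', h'⟩ := hv
  refine ⟨C + C', κ + κ', add_nonneg hκ hκ', fun g => (enorm_add_le _ _).trans ?_⟩
  rw [ENNReal.coe_add, add_mul]
  exact add_le_add ((h g).trans (by gcongr; exact P.expDist_mono hκ (by linarith) g))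
    ((h' g).trans (by gcongr; exact P.expDist_mono hκ' (by linarith) g))

theorem Tempered.mul {u v : P.G → ℝ} (hu : P.Tempered u) (hv : P.Tempered v) :
    P.Tempered fun g => u g * v g := by
  obtain ⟨C, κ, hκ, h⟩ := hu
  obtain ⟨C', κ', hκ', h'⟩ := hv
  refine ⟨C * C', κ + κ', add_nonneg hκ hκ', fun g => ?_⟩
  rw [enorm_mul, P.expDist_add hκ hκ', ENNReal.coe_mul, mul_mul_mul_comm]
  exact mul_le_mul' (h g) (h' g)

theorem Tempered.eval {σ : Type*} {u : P.G → σ → ℝ} (hu : ∀ s, P.Tempered fun g => u g s)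
    (p : MvPolynomial σ ℝ) : P.Tempered fun g => MvPolynomial.eval (u g) p := by
  induction p using MvPolynomial.induction_on with
  | C a => simpa using Tempered.const a
  | add p q hp hq => simpa using hp.add hq
  | mul_X p j hp => simpa using hp.mul (hu j)

variable (P)

/-! ### Growth of matrix entries along paths -/

theorem det_ne_zero_of_isPath {γ : ℝ → Matrix (Fin k) (Fin k) ℝ} {g : P.G} (h : P.IsPath γ g) {t : ℝ}
    (ht : t ∈ Set.Icc (0 : ℝ) 1) : (γ t).det ≠ 0 := by
  obtain ⟨x, hx⟩ := h.mem t ht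
  rw [hx]
  exact (Matrix.isUnit_iff_isUnit_det _ |>.1 (x : GL (Fin k) ℝ).isUnit).ne_zero

/-- The velocity `γ⁻¹ γ'` of a path of matrices. -/
noncomputable def velocity (γ : ℝ → Matrix (Fin k) (Fin k) ℝ) (t : ℝ) : Matrix (Fin k) (Fin k) ℝ :=
  (γ t)⁻¹ * Matrix.of fun a b => deriv (fun s => γ s a b) t

/-- Cauchy–Schwarz twice for the Frobenius norm: $\langle M,MA\rangle\le|M||MA|\le|M|^2|A|$. With
$M=\gamma$ and $A=\gamma^{-1}\gamma'$ it bounds the derivative of $|\gamma|^2/2$. -/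
theorem sum_sq_mul_le (M A : Matrix (Fin k) (Fin k) ℝ) :
    ∑ i, ∑ j, M i j * (M * A) i j ≤
      Real.sqrt (∑ i, ∑ j, A i j ^ 2) * ∑ i, ∑ j, M i j ^ 2 := by
  set s := ∑ i, ∑ j, M i j ^ 2 with hs
  set a := ∑ i, ∑ j, A i j ^ 2 with ha
  have hs0 : 0 ≤ s := Finset.sum_nonneg fun _ _ => Finset.sum_nonneg fun _ _ => sq_nonneg _
  have ha0 : 0 ≤ a := Finset.sum_nonneg fun _ _ => Finset.sum_nonneg fun _ _ => sq_nonneg _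
  have h1 : ∑ i, ∑ j, (M * A) i j ^ 2 ≤ s * a := by
    calc ∑ i, ∑ j, (M * A) i j ^ 2
        ≤ ∑ i, ∑ j, (∑ c, M i c ^ 2) * ∑ c, A c j ^ 2 :=
          Finset.sum_le_sum fun i _ => Finset.sum_le_sum fun j _ => by
            rw [Matrix.mul_apply]
            exact Finset.sum_mul_sq_le_sq_mul_sq _ _ _
      _ = s * a := by
          simp only [← Finset.mul_sum, ← Finset.sum_mul]
          rw [hs, ha, Finset.sum_comm (f := fun i j => A i j ^ 2)]
  have h2 := Real.sum_mul_le_sqrt_mul_sqrt (Finset.univ : Finset (Fin k × Fin k))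
    (fun p => M p.1 p.2) (fun p => (M * A) p.1 p.2)
  simp only [Fintype.sum_prod_type] at h2
  refine h2.trans ?_
  calc Real.sqrt s * Real.sqrt (∑ i, ∑ j, (M * A) i j ^ 2)
      ≤ Real.sqrt s * Real.sqrt (s * a) := by gcongr
    _ = Real.sqrt a * s := by
      rw [Real.sqrt_mul hs0, ← mul_assoc, Real.mul_self_sqrt hs0, mul_comm]

theorem sum_sq_le_exp_pathLength {γ : ℝ → Matrix (Fin k) (Fin k) ℝ} {g : P.G} (h : P.IsPath γ g) :
    ∑ i, ∑ j, (γ 1) i j ^ 2 ≤ k * Real.exp (2 * pathLength γ) := by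
  -- The path lies in `G` only over $[0,1]$; the open set `U` makes two-sided derivatives available
  -- at the endpoints.
  let U : Set ℝ := {t | (γ t).det ≠ 0}
  have hγc : Continuous γ := continuous_matrix fun i j => (h.contDiff i j).continuous
  have hU : IsOpen U := isOpen_ne_fun hγc.matrix_det continuous_const
  have hIU : Set.Icc (0 : ℝ) 1 ⊆ U := fun t ht => P.det_ne_zero_of_isPath h ht
  have hd (i j) (t : ℝ) : HasDerivAt (fun s => γ s i j) (deriv (fun s => γ s i j) t) t :=
    ((h.contDiff i j).differentiable one_ne_zero t).hasDerivAt
  let a (t : ℝ) : ℝ := Real.sqrt (∑ i, ∑ j, velocity γ t i j ^ 2)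
  have hvc (i j) : ContinuousOn (fun t => velocity γ t i j) U := by
    simp only [velocity, Matrix.mul_apply, Matrix.inv_def, Matrix.smul_apply, smul_eq_mul,
      Ring.inverse_eq_inv', Matrix.of_apply]
    refine continuousOn_finsetSum _ fun c _ => ContinuousOn.mul (ContinuousOn.mul ?_ ?_) ?_
    · exact hγc.matrix_det.continuousOn.inv₀ fun t ht => ht
    · exact (hγc.matrix_adjugate.matrix_elem i c).continuousOn
    · exact ((h.contDiff c j).continuous_deriv le_rfl).continuousOn
  have hac : ContinuousOn a U := by
    refine (Real.continuous_sqrt.comp_continuousOn ?_)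
    exact continuousOn_finsetSum _ fun i _ => continuousOn_finsetSum _ fun j _ => (hvc i j).pow 2
  have hacI (t : ℝ) (ht : t ∈ Set.Icc (0 : ℝ) 1) : IntervalIntegrable a volume 0 t := by
    refine (hac.mono ?_).intervalIntegrable
    rw [Set.uIcc_of_le ht.1]
    exact (Set.Icc_subset_Icc_right ht.2).trans hIU
  have hL (t : ℝ) (ht : t ∈ Set.Icc (0 : ℝ) 1) :
      HasDerivAt (fun u => ∫ x in (0 : ℝ)..u, a x) (a t) t :=
    intervalIntegral.integral_hasDerivAt_right (hacI t ht)
      (hac.stronglyMeasurableAtFilter hU t (hIU ht)) (hac.continuousAt (hU.mem_nhds (hIU ht)))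
  let s (t : ℝ) : ℝ := ∑ i, ∑ j, γ t i j ^ 2
  have hs (t : ℝ) : HasDerivAt s (∑ i, ∑ j, 2 * γ t i j * deriv (fun s => γ s i j) t) t :=
    HasDerivAt.fun_sum fun i _ => HasDerivAt.fun_sum fun j _ => by
      simpa using (hd i j t).fun_pow 2
  -- Gronwall: $s'\le 2as$ makes $s\,e^{-2\int a}$ nonincreasing, and $s(0)=|1|^2=k$.
  let φ (t : ℝ) : ℝ := s t * Real.exp (-(2 * ∫ x in (0 : ℝ)..t, a x))
  have hφ (t : ℝ) (ht : t ∈ Set.Icc (0 : ℝ) 1) := (hs t).fun_mul (((hL t ht).const_mul 2).fun_neg.exp)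
  have hanti : AntitoneOn φ (Set.Icc 0 1) := by
    refine antitoneOn_of_deriv_nonpos (convex_Icc 0 1)
      (fun t ht => (hφ t ht).continuousAt.continuousWithinAt)
      (fun t ht => (hφ t (interior_subset ht)).differentiableAt.differentiableWithinAt)
      fun t ht => ?_
    have ht' := interior_subset ht
    rw [(hφ t ht').deriv]
    have h1 : ∑ i, ∑ j, 2 * γ t i j * deriv (fun s => γ s i j) t ≤ 2 * (a t * s t) := by
      have h2 : γ t * velocity γ t = Matrix.of fun a b => deriv (fun s => γ s a b) t := by
        rw [velocity, ← mul_assoc, Matrix.mul_nonsing_inv _ (IsUnit.mk0 _ (hIU ht')), one_mul]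
      have h3 := sum_sq_mul_le (γ t) (velocity γ t)
      rw [h2] at h3
      calc _ = 2 * ∑ i, ∑ j, γ t i j * deriv (fun s => γ s i j) t := by
            simp only [Finset.mul_sum, mul_assoc]
        _ ≤ _ := by
          refine mul_le_mul_of_nonneg_left ?_ zero_le_two
          exact h3
    have h4 := Real.exp_pos (-(2 * ∫ x in (0 : ℝ)..t, a x))
    nlinarith
  have h01 := hanti (Set.left_mem_Icc.2 zero_le_one) (Set.right_mem_Icc.2 zero_le_one) zero_le_one
  have hlen : ∫ x in (0 : ℝ)..1, a x = pathLength γ := rfl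
  have hs0 : s 0 = k := by
    simp only [s, h.source, Matrix.one_apply]
    simp
  simp only [φ, hlen, intervalIntegral.integral_same, mul_zero, Real.exp_zero,
    hs0, Real.exp_neg] at h01
  rw [← div_eq_mul_inv, div_le_iff₀ (Real.exp_pos _), inv_one, mul_one] at h01
  exact h01

theorem tempered_entry (i j : Fin k) : P.Tempered fun g => P.gPoint g (i, j) := by
  refine ⟨k, 1, zero_le_one, fun g => ?_⟩
  by_cases h0 : P.gPoint g (i, j) = 0
  · simp [h0]
  have hk : (0 : ℝ) < k := Nat.cast_pos.2 (Fin.pos i)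
  have hk1 : (1 : ℝ) ≤ k := Nat.one_le_cast.2 (Fin.pos i)
  have hpos := abs_pos.2 h0
  -- Logarithms turn the bound for each path into one for its length, which passes to the infimum.
  -- The crude constant `k` in place of $\sqrt k$ is allowed because $k\ge1$.
  have h1 : ENNReal.ofReal (Real.log (|P.gPoint g (i, j)| / k)) ≤ P.dist1 g := by
    refine le_iInf₂ fun γ hγ => ENNReal.ofReal_le_ofReal ?_
    have h2 := P.sum_sq_le_exp_pathLength hγ
    have h3 : P.gPoint g (i, j) ^ 2 ≤ ∑ i, ∑ j, (γ 1) i j ^ 2 := by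
      have e : P.gPoint g (i, j) = γ 1 i j := by rw [hγ.target]; rfl
      rw [e]
      exact (Finset.single_le_sum (f := fun j => (γ 1) i j ^ 2) (fun _ _ => sq_nonneg _)
        (Finset.mem_univ j)).trans (Finset.single_le_sum (f := fun i => ∑ j, (γ 1) i j ^ 2)
          (fun _ _ => Finset.sum_nonneg fun _ _ => sq_nonneg _) (Finset.mem_univ i))
    rw [← Real.log_exp (pathLength γ)]
    refine Real.log_le_log (by positivity) ?_
    rw [div_le_iff₀ hk]
    refine abs_le_of_sq_le_sq ?_ (by positivity)
    refine (h3.trans h2).trans ?_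
    rw [mul_pow, ← Real.exp_nat_mul, mul_comm]
    push_cast
    gcongr
    nlinarith
  have h2 : ((Real.log (|P.gPoint g (i, j)| / k) : ℝ) : EReal) ≤ ((P.dist1 g : ℝ≥0∞) : EReal) := by
    refine le_trans ?_ (EReal.coe_ennreal_le_coe_ennreal_iff.2 h1)
    rw [EReal.coe_ennreal_ofReal]
    exact EReal.coe_le_coe_iff.2 (le_max_left _ _)
  have h3 := EReal.exp_le_exp_iff.2 h2
  rw [EReal.exp_coe, Real.exp_log (by positivity)] at h3
  have h4 : P.expDist 1 g = EReal.exp ((P.dist1 g : ℝ≥0∞) : EReal) := by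
    rw [expDist, EReal.coe_one, one_mul]
  rw [h4]
  calc ‖P.gPoint g (i, j)‖ₑ = ENNReal.ofReal (k * (|P.gPoint g (i, j)| / k)) := by
        rw [mul_div_cancel₀ _ hk.ne', Real.enorm_eq_ofReal_abs]
    _ = ((k : NNReal) : ℝ≥0∞) * ENNReal.ofReal (|P.gPoint g (i, j)| / k) := by
        rw [ENNReal.ofReal_mul hk.le]
        simp
    _ ≤ _ := by gcongr

theorem dist1_inv_le (g : P.G) : P.dist1 g⁻¹ ≤ P.dist1 g := by
  refine le_iInf₂ fun γ hγ => ?_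
  let M : Matrix (Fin k) (Fin k) ℝ := ((g⁻¹ : P.G) : GL (Fin k) ℝ)
  have hM : M * ((g : GL (Fin k) ℝ) : Matrix (Fin k) (Fin k) ℝ) = 1 := by
    simp only [M]
    rw [← Units.val_mul, ← Subgroup.coe_mul, inv_mul_cancel]; rfl
  -- The reversed path translated by $g^{-1}$ runs from $1$ to $g^{-1}$, and by left invariance it
  -- has the same length.
  let γ' (t : ℝ) : Matrix (Fin k) (Fin k) ℝ := M * γ (1 - t)
  have hd (i j) (t : ℝ) : HasDerivAt (fun s => γ s i j) (deriv (fun s => γ s i j) t) t :=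
    ((hγ.contDiff i j).differentiable one_ne_zero t).hasDerivAt
  have hγ' : P.IsPath γ' g⁻¹ := by
    refine ⟨fun i j => ?_, fun t ht => ?_, ?_, ?_⟩
    · simp only [γ', Matrix.mul_apply]
      exact ContDiff.sum fun c _ => contDiff_const.mul
        ((hγ.contDiff c j).comp (contDiff_const.sub contDiff_id))
    · obtain ⟨x, hx⟩ := hγ.mem (1 - t) ⟨by linarith [ht.2], by linarith [ht.1]⟩
      exact ⟨g⁻¹ * x, by simp only [γ', hx]; rfl⟩
    · simp only [γ', sub_zero, hγ.target, hM]
    · simp only [γ', sub_self, hγ.source, mul_one, M]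
  refine (iInf₂_le γ' hγ').trans (le_of_eq ?_)
  congr 1
  have hv (t : ℝ) : velocity γ' t = -velocity γ (1 - t) := by
    have h1 : (Matrix.of fun a b => deriv (fun s => γ' s a b) t) =
        -(M * Matrix.of fun a b => deriv (fun s => γ s a b) (1 - t)) := by
      ext a b
      simp only [Matrix.of_apply, Matrix.neg_apply, Matrix.mul_apply, γ', ← Finset.sum_neg_distrib]
      refine HasDerivAt.deriv (HasDerivAt.fun_sum fun c _ => ?_)
      have h2 := ((hd c b (1 - t)).comp t ((hasDerivAt_id t).const_sub 1)).const_mul (M a c)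
      simpa using h2
    have hM' : IsUnit M.det := (Matrix.isUnit_iff_isUnit_det _).1
      ((g⁻¹ : P.G) : GL (Fin k) ℝ).isUnit
    rw [velocity, h1, velocity]
    simp only [γ']
    rw [Matrix.mul_inv_rev, mul_neg, mul_assoc, ← mul_assoc M⁻¹, Matrix.nonsing_inv_mul _ hM',
      one_mul]
  have h1 : pathLength γ' = ∫ t in (0 : ℝ)..1,
      (fun u => Real.sqrt (∑ i, ∑ j, velocity γ u i j ^ 2)) (1 - t) := by
    refine intervalIntegral.integral_congr fun t _ => ?_
    change Real.sqrt (∑ i, ∑ j, velocity γ' t i j ^ 2) = _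
    simp only [hv, Matrix.neg_apply, neg_sq]
  rw [h1, intervalIntegral.integral_comp_sub_left (fun u =>
    Real.sqrt (∑ i, ∑ j, velocity γ u i j ^ 2)) 1]
  simp only [sub_self, sub_zero]
  rfl

variable {P} in
theorem Tempered.comp_inv {u : P.G → ℝ} (hu : P.Tempered u) : P.Tempered fun g => u g⁻¹ := by
  obtain ⟨C, κ, hκ, h⟩ := hu
  refine ⟨C, κ, hκ, fun g => (h g⁻¹).trans ?_⟩
  gcongr
  rw [expDist, expDist, EReal.exp_le_exp_iff]
  exact mul_le_mul_of_nonneg_left (EReal.coe_ennreal_le_coe_ennreal_iff.2 (P.dist1_inv_le g))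
    (EReal.coe_nonneg.2 hκ)

end PrehomogeneousSpace.RealPrehomogeneousSpace

/-! ### Matrix entries of the representation, invariant derivatives and amplitudes. -/

namespace PrehomogeneousSpace.RealPrehomogeneousSpace

variable {k n : ℕ} (P : RealPrehomogeneousSpace k n)

/-- The determinant, as a polynomial with real coefficients. -/
noncomputable def detPolyReal (k : ℕ) : MvPolynomial (Fin k × Fin k) ℝ :=
  (Matrix.mvPolynomialX (Fin k) (Fin k) ℝ).det

theorem eval_detPolyReal (g : Matrix (Fin k) (Fin k) ℝ) :
    MvPolynomial.eval (matPoint g) (detPolyReal k) = g.det := by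
  rw [detPolyReal, RingHom.map_det]
  congr 1
  ext i j
  simp [matPoint, Matrix.mvPolynomialX]

/-- The representation of `G` on `V_ℝ`, by real matrices. -/
noncomputable def rep : P.G →* Matrix (Fin n) (Fin n) ℝ := P.rhoReal.comp P.incl

theorem act_inv_apply (g : P.G) (m : Euc n) (i : Fin n) :
    P.act (P.incl g)⁻¹ m i = ∑ j, P.rep g⁻¹ i j * m j := by
  rw [← map_inv]
  change ((P.rep g⁻¹).mulVec m) i = _
  simp [Matrix.mulVec, dotProduct]

theorem gPoint_inv (g : P.G) (i j : Fin k) : P.gPoint g⁻¹ (i, j) =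
    (((g : GL (Fin k) ℝ) : Matrix (Fin k) (Fin k) ℝ)⁻¹) i j := by
  change ((((g⁻¹ : P.G) : GL (Fin k) ℝ) : Matrix (Fin k) (Fin k) ℝ)) i j = _
  rw [Subgroup.coe_inv, Matrix.coe_units_inv]

theorem det_gPoint_inv (g : P.G) : MvPolynomial.eval (P.gPoint g⁻¹) (detPolyReal k) =
    (Matrix.det ((g : GL (Fin k) ℝ) : Matrix (Fin k) (Fin k) ℝ))⁻¹ := by
  rw [gPoint, eval_detPolyReal, Subgroup.coe_inv, Matrix.coe_units_inv, Matrix.det_nonsing_inv,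
    Ring.inverse_eq_inv']

/-- $\det(g)^{-1}$ is a polynomial in the entries of $g^{-1}$. Growth, continuity and smoothness of
$\rho$ thereby reduce to the entries of $g$ and $g^{-1}$. -/
theorem rep_rational (i j : Fin n) : ∃ p q : MvPolynomial (Fin k × Fin k) ℝ, ∀ g : P.G,
    P.rep g i j = MvPolynomial.eval (P.gPoint g) p * MvPolynomial.eval (P.gPoint g⁻¹) q := by
  obtain ⟨p, r, h⟩ := P.rational i j
  refine ⟨p, detPolyReal k ^ r, fun g => ?_⟩
  have h1 := h ⟨complexify k (P.incl g : GL (Fin k) ℝ), (P.incl g).2⟩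
  rw [← P.rhoReal_spec] at h1
  apply Complex.ofReal_injective
  refine h1.trans ?_
  have h2 : MvPolynomial.aeval (fun ij : Fin k × Fin k =>
      ((complexify k (P.incl g : GL (Fin k) ℝ) : GL (Fin k) ℂ) : Matrix _ _ ℂ) ij.1 ij.2) p =
      ((MvPolynomial.eval (P.gPoint g) p : ℝ) : ℂ) := by
    rw [← MvPolynomial.aeval_eq_eval]
    exact MvPolynomial.aeval_algebraMap_apply ℂ (P.gPoint g) p
  have h3 : Matrix.det ((complexify k (P.incl g : GL (Fin k) ℝ) : GL (Fin k) ℂ) :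
      Matrix (Fin k) (Fin k) ℂ) =
      ((Matrix.det ((g : GL (Fin k) ℝ) : Matrix (Fin k) (Fin k) ℝ) : ℝ) : ℂ) :=
    (RingHom.map_det Complex.ofRealHom _).symm
  simp only [h2, h3, map_pow, det_gPoint_inv]
  push_cast
  rfl

theorem tempered_rep (i j : Fin n) : P.Tempered fun g => P.rep g i j := by
  obtain ⟨p, q, h⟩ := P.rep_rational i j
  simp only [h]
  have h1 : ∀ s, P.Tempered fun g => P.gPoint g s := fun s => P.tempered_entry s.1 s.2
  exact (Tempered.eval h1 p).mul (Tempered.eval h1 q).comp_inv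

theorem tempered_rep_inv (i j : Fin n) : P.Tempered fun g => P.rep g⁻¹ i j :=
  (P.tempered_rep i j).comp_inv

theorem continuous_rep_apply (i j : Fin n) : Continuous fun g => P.rep g i j := by
  obtain ⟨p, q, h⟩ := P.rep_rational i j
  simp only [h]
  exact ((MvPolynomial.continuous_eval p).comp P.continuous_gPoint).mul
    ((MvPolynomial.continuous_eval q).comp (P.continuous_gPoint.comp continuous_inv))

/-! ### One parameter subgroups and smooth functions -/

/-- The one parameter subgroup `t ↦ e^{tX}`. -/
noncomputable def expG (X : P.lieAlg) (t : ℝ) : P.G := ⟨expGL (t • (X : Matrix (Fin k) (Fin k) ℝ)), X.2 t⟩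

theorem expG_zero (X : P.lieAlg) : P.expG X 0 = 1 := by
  refine Subtype.ext (Units.ext ?_)
  change NormedSpace.exp ((0 : ℝ) • _) = 1
  rw [zero_smul, NormedSpace.exp_zero]

theorem expG_add (X : P.lieAlg) (s t : ℝ) : P.expG X (s + t) = P.expG X s * P.expG X t := by
  refine Subtype.ext (Units.ext ?_)
  change NormedSpace.exp ((s + t) • (X : Matrix (Fin k) (Fin k) ℝ)) =
    NormedSpace.exp (s • (X : Matrix (Fin k) (Fin k) ℝ)) * NormedSpace.exp (t • (X : Matrix (Fin k) (Fin k) ℝ))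
  rw [add_smul]
  exact Matrix.exp_add_of_commute _ _ (((Commute.refl _).smul_left s).smul_right t)

theorem expG_neg (X : P.lieAlg) (t : ℝ) : P.expG X (-t) = (P.expG X t)⁻¹ := by
  rw [eq_inv_iff_mul_eq_one, ← expG_add, neg_add_cancel, expG_zero]

theorem continuous_expG (X : P.lieAlg) : Continuous (P.expG X) :=
  (continuous_expGL (X : Matrix (Fin k) (Fin k) ℝ)).subtype_mk _

theorem continuous_entries : Continuous P.entries :=
  continuous_pi fun i => continuous_pi fun j => (continuous_apply (i, j)).comp P.continuous_gPoint

/-- The vector field `-X x` on the space of matrices. -/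
noncomputable def leftField (X : Matrix (Fin k) (Fin k) ℝ) (x : Fin k → Fin k → ℝ) : Fin k → Fin k → ℝ :=
  fun i j => -∑ c, X i c * x c j

theorem hasDerivAt_entries_expG (X : P.lieAlg) (g : P.G) :
    HasDerivAt (fun h : ℝ => P.entries (P.expG X (-h) * g)) (leftField X (P.entries g)) 0 := by
  rw [hasDerivAt_pi]
  intro i
  rw [hasDerivAt_pi]
  intro j
  have e (h : ℝ) : P.entries (P.expG X (-h) * g) i j =
      ∑ c, NormedSpace.exp ((-h) • (X : Matrix (Fin k) (Fin k) ℝ)) i c * P.entries g c j := by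
    change (NormedSpace.exp ((-h) • (X : Matrix (Fin k) (Fin k) ℝ)) *
      ((g : GL (Fin k) ℝ) : Matrix (Fin k) (Fin k) ℝ)) i j = _
    rw [Matrix.mul_apply]
    rfl
  simp only [e, leftField, ← Finset.sum_neg_distrib]
  refine HasDerivAt.fun_sum fun c _ => ?_
  have h1 := hasDerivAt_matrix_exp_entry (X : Matrix (Fin k) (Fin k) ℝ) (-(0 : ℝ)) i c
  have h2 := (h1.scomp (0 : ℝ) (hasDerivAt_neg (0 : ℝ))).mul_const (P.entries g c j)
  simpa [Function.comp_def] using h2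

theorem contDiff_leftField (X : Matrix (Fin k) (Fin k) ℝ) : ContDiff ℝ ∞ (leftField X) := by
  unfold leftField
  fun_prop

variable {P}

theorem IsSmooth.continuous {f : P.G → ℂ} (hf : P.IsSmooth f) : Continuous f := by
  refine continuous_iff_continuousAt.2 fun g => ?_
  obtain ⟨U, F, hU, hgU, hF, h⟩ := hf g
  have h1 : ContinuousAt (fun x => F (P.entries x)) g :=
    ContinuousAt.comp (hF.continuousOn.continuousAt (hU.mem_nhds hgU))
      P.continuous_entries.continuousAt
  refine h1.congr ?_
  filter_upwards [P.continuous_entries.continuousAt.preimage_mem_nhds (hU.mem_nhds hgU)] with x hx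
  exact (h x hx).symm

/-- On a local extension `F`, `dL` acts as the smooth vector field $x\mapsto -Xx$ on the space of
all matrices; hence it preserves smoothness. -/
theorem hasDerivAt_of_extension {f : P.G → ℂ} {U : Set (Fin k → Fin k → ℝ)}
    {F : (Fin k → Fin k → ℝ) → ℂ} (hU : IsOpen U) (hF : ContDiffOn ℝ ∞ F U)
    (hfF : ∀ h : P.G, P.entries h ∈ U → f h = F (P.entries h)) {g : P.G} (hg : P.entries g ∈ U)
    (X : P.lieAlg) : HasDerivAt (fun h : ℝ => f (P.expG X (-h) * g))
      (fderiv ℝ F (P.entries g) (leftField X (P.entries g))) 0 := by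
  have h0 : P.expG X (-0) * g = g := by rw [neg_zero, expG_zero, one_mul]
  have h1 : HasFDerivAt F (fderiv ℝ F (P.entries g)) (P.entries (P.expG X (-0) * g)) := by
    rw [h0]
    exact ((hF.differentiableOn (by simp)).differentiableAt (hU.mem_nhds hg)).hasFDerivAt
  have h2 := h1.comp_hasDerivAt (0 : ℝ) (P.hasDerivAt_entries_expG X g)
  refine h2.congr_of_eventuallyEq ?_
  have h3 : Continuous fun h : ℝ => P.entries (P.expG X (-h) * g) :=
    P.continuous_entries.comp (((P.continuous_expG X).comp continuous_neg).mul continuous_const)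
  filter_upwards [h3.continuousAt.preimage_mem_nhds (hU.mem_nhds (by rw [h0]; exact hg))] with t ht
  exact hfF _ ht

theorem IsSmooth.hasDerivAt {f : P.G → ℂ} (hf : P.IsSmooth f) (X : P.lieAlg) (g : P.G) :
    HasDerivAt (fun h : ℝ => f (P.expG X (-h) * g)) (P.dL X f g) 0 := by
  obtain ⟨U, F, hU, hgU, hF, h⟩ := hf g
  exact (hasDerivAt_of_extension hU hF h hgU X).differentiableAt.hasDerivAt

theorem IsSmooth.dL {f : P.G → ℂ} (hf : P.IsSmooth f) (X : P.lieAlg) : P.IsSmooth (P.dL X f) := by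
  intro g
  obtain ⟨U, F, hU, hgU, hF, h⟩ := hf g
  refine ⟨U, fun x => fderiv ℝ F x (leftField X x), hU, hgU, ?_, fun x hx => ?_⟩
  · exact (hF.fderiv_of_isOpen hU (by simp)).clm_apply (contDiff_leftField _).contDiffOn
  · exact (hasDerivAt_of_extension hU hF h hx X).deriv

theorem IsSmooth.const (c : ℂ) : P.IsSmooth fun _ => c := fun _ =>
  ⟨Set.univ, fun _ => c, isOpen_univ, trivial, contDiffOn_const, fun _ _ => rfl⟩

theorem IsSmooth.add {f f' : P.G → ℂ} (hf : P.IsSmooth f) (hf' : P.IsSmooth f') :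
    P.IsSmooth fun g => f g + f' g := by
  intro g
  obtain ⟨U, F, hU, hgU, hF, h⟩ := hf g
  obtain ⟨U', F', hU', hgU', hF', h'⟩ := hf' g
  exact ⟨U ∩ U', fun x => F x + F' x, hU.inter hU', ⟨hgU, hgU'⟩,
    (hF.mono Set.inter_subset_left).add (hF'.mono Set.inter_subset_right),
    fun x hx => by simp only [h x hx.1, h' x hx.2]⟩

theorem IsSmooth.mul {f f' : P.G → ℂ} (hf : P.IsSmooth f) (hf' : P.IsSmooth f') :
    P.IsSmooth fun g => f g * f' g := by
  intro g
  obtain ⟨U, F, hU, hgU, hF, h⟩ := hf g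
  obtain ⟨U', F', hU', hgU', hF', h'⟩ := hf' g
  exact ⟨U ∩ U', fun x => F x * F' x, hU.inter hU', ⟨hgU, hgU'⟩,
    (hF.mono Set.inter_subset_left).mul (hF'.mono Set.inter_subset_right),
    fun x hx => by simp only [h x hx.1, h' x hx.2]⟩

theorem IsSmooth.eval {σ : Type*} {u : P.G → σ → ℝ} (hu : ∀ s, P.IsSmooth fun g => (u g s : ℂ))
    (p : MvPolynomial σ ℝ) : P.IsSmooth fun g => ((MvPolynomial.eval (u g) p : ℝ) : ℂ) := by
  induction p using MvPolynomial.induction_on with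
  | C a => simpa using IsSmooth.const (a : ℂ)
  | add p q hp hq => simpa using hp.add hq
  | mul_X p j hp => simpa using hp.mul (hu j)

variable (P)

theorem isSmooth_gPoint (s : Fin k × Fin k) : P.IsSmooth fun g => (P.gPoint g s : ℂ) := fun _ =>
  ⟨Set.univ, fun x => (x s.1 s.2 : ℂ), isOpen_univ, trivial,
    (Complex.ofRealCLM.contDiff.comp (contDiff_apply_apply ℝ ℝ s.1 s.2)).contDiffOn, fun _ _ => rfl⟩

theorem contDiff_matrix_det {k : ℕ} {M : (Fin k → Fin k → ℝ) → Matrix (Fin k) (Fin k) ℝ}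
    (hM : ∀ i j, ContDiff ℝ ∞ fun x => M x i j) : ContDiff ℝ ∞ fun x => (M x).det := by
  simp only [Matrix.det_apply']
  exact ContDiff.sum fun σ _ => contDiff_const.mul (contDiff_prod fun i _ => hM _ _)

/-- Cramer's rule extends the entries of $g^{-1}$ smoothly to the open set of invertible matrices.
-/
theorem isSmooth_gPoint_inv (s : Fin k × Fin k) : P.IsSmooth fun g => (P.gPoint g⁻¹ s : ℂ) := by
  intro g
  have hd : ContDiff ℝ ∞ fun x : Fin k → Fin k → ℝ => (Matrix.of x).det :=
    contDiff_matrix_det fun i j => contDiff_apply_apply ℝ ℝ i j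
  refine ⟨{x | (Matrix.of x).det ≠ 0}, fun x => (((Matrix.of x)⁻¹ s.1 s.2 : ℝ) : ℂ),
    isOpen_ne_fun hd.continuous continuous_const, ?_, ?_, fun x _ => ?_⟩
  · exact (Matrix.isUnit_iff_isUnit_det _ |>.1 (g : GL (Fin k) ℝ).isUnit).ne_zero
  · refine Complex.ofRealCLM.contDiff.comp_contDiffOn ?_
    simp only [Ring.inverse_eq_inv', Matrix.smul_apply, smul_eq_mul,
      Matrix.adjugate_apply]
    refine (hd.contDiffOn.inv fun x hx => hx).mul (ContDiff.contDiffOn ?_)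
    refine contDiff_matrix_det fun i j => ?_
    by_cases h : i = s.2
    · subst h
      simp only [Matrix.updateRow_self]
      exact contDiff_const
    · simp only [Matrix.updateRow_ne h]
      exact contDiff_apply_apply ℝ ℝ i j
  · exact congrArg Complex.ofReal (P.gPoint_inv x s.1 s.2)

theorem isSmooth_rep (i j : Fin n) : P.IsSmooth fun g => (P.rep g i j : ℂ) := by
  obtain ⟨p, q, h⟩ := P.rep_rational i j
  simp only [h, Complex.ofReal_mul]
  exact (IsSmooth.eval P.isSmooth_gPoint p).mul (IsSmooth.eval P.isSmooth_gPoint_inv q)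

theorem isSmooth_rep_inv (i j : Fin n) : P.IsSmooth fun g => (P.rep g⁻¹ i j : ℂ) := by
  obtain ⟨p, q, h⟩ := P.rep_rational i j
  simp only [h, Complex.ofReal_mul, inv_inv]
  exact (IsSmooth.eval P.isSmooth_gPoint_inv p).mul (IsSmooth.eval P.isSmooth_gPoint q)

/-- The matrix entries of the derivative `dρ(X)` of the representation. -/
noncomputable def drep (X : P.lieAlg) (i j : Fin n) : ℂ := -P.dL X (fun g => (P.rep g i j : ℂ)) 1

theorem hasDerivAt_rep_expG_neg (X : P.lieAlg) (i j : Fin n) :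
    HasDerivAt (fun h : ℝ => (P.rep (P.expG X (-h)) i j : ℂ)) (-P.drep X i j) 0 := by
  have h := (P.isSmooth_rep i j).hasDerivAt X 1
  simpa only [mul_one, drep, neg_neg] using h

theorem hasDerivAt_rep_expG (X : P.lieAlg) (i j : Fin n) :
    HasDerivAt (fun h : ℝ => (P.rep (P.expG X h) i j : ℂ)) (P.drep X i j) 0 := by
  have h := P.hasDerivAt_rep_expG_neg X i j
  have h' : HasDerivAt (fun h : ℝ => (P.rep (P.expG X (-h)) i j : ℂ)) (-P.drep X i j) (-(0 : ℝ)) := by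
    rwa [neg_zero]
  simpa [Function.comp_def] using h'.scomp (0 : ℝ) (hasDerivAt_neg (0 : ℝ))

theorem dL_rep (X : P.lieAlg) (i j : Fin n) (g : P.G) :
    P.dL X (fun g => (P.rep g i j : ℂ)) g = ∑ c, -P.drep X i c * P.rep g c j := by
  refine ((P.isSmooth_rep i j).hasDerivAt X g).unique ?_
  simp only [map_mul, Matrix.mul_apply, Complex.ofReal_sum, Complex.ofReal_mul]
  exact HasDerivAt.fun_sum fun c _ => (P.hasDerivAt_rep_expG_neg X i c).mul_const _

/-- From $\rho((e^{-hX}g)^{-1})=\rho(g^{-1})\rho(e^{hX})$: `dL` maps entries of $\rho(g^{-1})$ to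
constant linear combinations of such entries. -/
theorem dL_rep_inv (X : P.lieAlg) (i j : Fin n) (g : P.G) :
    P.dL X (fun g => (P.rep g⁻¹ i j : ℂ)) g = ∑ c, P.rep g⁻¹ i c * P.drep X c j := by
  refine ((P.isSmooth_rep_inv i j).hasDerivAt X g).unique ?_
  simp only [mul_inv_rev, expG_neg, inv_inv, map_mul, Matrix.mul_apply, Complex.ofReal_sum,
    Complex.ofReal_mul]
  exact HasDerivAt.fun_sum fun c _ => (P.hasDerivAt_rep_expG X c j).const_mul _

/-- Outside the singular set, every vector is of the form `dρ(X) m`. -/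
theorem exists_drep_mulVec_eq {m : Euc n} (hm : m ∉ P.singularR) (v : Euc n) :
    ∃ X : P.lieAlg, ∀ i, ∑ j, P.drep X i j * (m j : ℂ) = (v i : ℂ) := by
  obtain ⟨X, hX⟩ := P.exists_lieAlg_deriv_act hm v
  refine ⟨X, fun i => ?_⟩
  have h1 : HasDerivAt (fun h : ℝ => ∑ j, (P.rep (P.expG X h) i j : ℂ) * (m j : ℂ))
      (∑ j, P.drep X i j * (m j : ℂ)) 0 :=
    HasDerivAt.fun_sum fun c _ => (P.hasDerivAt_rep_expG X i c).mul_const _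
  refine h1.unique ?_
  refine (hX i).ofReal_comp.congr_of_eventuallyEq (Eventually.of_forall fun t => ?_)
  have h2 : P.act ⟨expGL (t • (X : Matrix (Fin k) (Fin k) ℝ)), P.G_le_GR (X.2 t)⟩ m i =
      ∑ j, P.rep (P.expG X t) i j * m j := by
    change ((P.rep (P.expG X t)).mulVec m) i = _
    simp [Matrix.mulVec, dotProduct]
  simp only [h2, Complex.ofReal_sum, Complex.ofReal_mul]

variable {P}

theorem dL_add {f f' : P.G → ℂ} (hf : P.IsSmooth f) (hf' : P.IsSmooth f') (X : P.lieAlg) :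
    P.dL X (fun g => f g + f' g) = fun g => P.dL X f g + P.dL X f' g :=
  funext fun g => ((hf.add hf').hasDerivAt X g).unique
    ((hf.hasDerivAt X g).fun_add (hf'.hasDerivAt X g))

theorem dL_mul {f f' : P.G → ℂ} (hf : P.IsSmooth f) (hf' : P.IsSmooth f') (X : P.lieAlg) :
    P.dL X (fun g => f g * f' g) = fun g => P.dL X f g * f' g + f g * P.dL X f' g :=
  funext fun g => by
    refine ((hf.mul hf').hasDerivAt X g).unique ?_
    have h := (hf.hasDerivAt X g).fun_mul (hf'.hasDerivAt X g)
    simpa only [neg_zero, expG_zero, one_mul] using h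

theorem dL_const_mul {f : P.G → ℂ} (hf : P.IsSmooth f) (c : ℂ) (X : P.lieAlg) :
    P.dL X (fun g => c * f g) = fun g => c * P.dL X f g :=
  funext fun g => (((IsSmooth.const c).mul hf).hasDerivAt X g).unique
    ((hf.hasDerivAt X g).const_mul c)

/-! ### Amplitudes -/

/-- The smallest space of functions on `G` that contains the functions `dL(w) f`, and that is stable
under multiplication by matrix entries of `ρ(g)` and `ρ(g⁻¹)`. -/
inductive Amplitude (f : P.G → ℂ) : (P.G → ℂ) → Prop
  | word (w : List P.lieAlg) : Amplitude f (P.dLWord w f)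
  | add {φ ψ : P.G → ℂ} : Amplitude f φ → Amplitude f ψ → Amplitude f fun g => φ g + ψ g
  | const_mul (c : ℂ) {φ : P.G → ℂ} : Amplitude f φ → Amplitude f fun g => c * φ g
  | mul_rep (i j : Fin n) {φ : P.G → ℂ} : Amplitude f φ → Amplitude f fun g => φ g * P.rep g i j
  | mul_rep_inv (i j : Fin n) {φ : P.G → ℂ} :
      Amplitude f φ → Amplitude f fun g => φ g * P.rep g⁻¹ i j

variable {f : P.G → ℂ}

theorem Amplitude.self : P.Amplitude f f := Amplitude.word []

theorem Amplitude.sum {ι : Type*} (s : Finset ι) {φ : ι → P.G → ℂ}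
    (h : ∀ i, P.Amplitude f (φ i)) : P.Amplitude f fun g => ∑ i ∈ s, φ i g := by
  classical
  induction s using Finset.induction_on with
  | empty => simpa using Amplitude.const_mul 0 (Amplitude.self (f := f))
  | insert a s ha ih => simpa only [Finset.sum_insert ha] using (h a).add ih

theorem isSmooth_dLWord (hf : P.IsSmooth f) (w : List P.lieAlg) : P.IsSmooth (P.dLWord w f) := by
  induction w with
  | nil => exact hf
  | cons X w ih => exact ih.dL X

theorem Amplitude.isSmooth (hf : P.IsSmooth f) {φ : P.G → ℂ} (h : P.Amplitude f φ) :
    P.IsSmooth φ := by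
  induction h with
  | word w => exact isSmooth_dLWord hf w
  | add _ _ h h' => exact h.add h'
  | const_mul c _ h => exact (IsSmooth.const c).mul h
  | mul_rep i j _ h => exact h.mul (P.isSmooth_rep i j)
  | mul_rep_inv i j _ h => exact h.mul (P.isSmooth_rep_inv i j)

/-- Leibniz rule, with the derivatives of the entries of $\rho(g)$ and $\rho(g^{-1})$ again
combinations of such entries. -/
theorem Amplitude.dL (hf : P.IsSmooth f) {φ : P.G → ℂ} (h : P.Amplitude f φ) (X : P.lieAlg) :
    P.Amplitude f (P.dL X φ) := by
  induction h with
  | word w => exact Amplitude.word (X :: w)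
  | add h h' ih ih' =>
    rw [dL_add (h.isSmooth hf) (h'.isSmooth hf)]
    exact ih.add ih'
  | const_mul c h ih =>
    rw [dL_const_mul (h.isSmooth hf)]
    exact ih.const_mul c
  | @mul_rep i j φ h ih =>
    rw [dL_mul (h.isSmooth hf) (P.isSmooth_rep i j)]
    refine (ih.mul_rep i j).add ?_
    have e : (fun g => φ g * P.dL X (fun g => (P.rep g i j : ℂ)) g) =
        fun g => ∑ c, -P.drep X i c * (φ g * P.rep g c j) := by
      ext1 g
      rw [P.dL_rep, Finset.mul_sum]
      exact Finset.sum_congr rfl fun c _ => by ring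
    rw [e]
    exact Amplitude.sum _ fun c => (h.mul_rep c j).const_mul _
  | @mul_rep_inv i j φ h ih =>
    rw [dL_mul (h.isSmooth hf) (P.isSmooth_rep_inv i j)]
    refine (ih.mul_rep_inv i j).add ?_
    have e : (fun g => φ g * P.dL X (fun g => (P.rep g⁻¹ i j : ℂ)) g) =
        fun g => ∑ c, P.drep X c j * (φ g * P.rep g⁻¹ i c) := by
      ext1 g
      rw [P.dL_rep_inv, Finset.mul_sum]
      exact Finset.sum_congr rfl fun c _ => by ring
    rw [e]
    exact Amplitude.sum _ fun c => (h.mul_rep_inv i c).const_mul _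

variable [MeasurableSpace P.G] [BorelSpace P.G] {μ : Measure P.G}

/-- The induction carries an arbitrary tempered weight `u`, into which the matrix entries are
absorbed until only a word `dLWord w f` is left; there the weighted $L^1$ condition applies. -/
theorem Amplitude.integrable_mul (hf : P.IsRapidlyDecreasing μ f) {φ : P.G → ℂ}
    (h : P.Amplitude f φ) : ∀ {u : P.G → ℝ}, Continuous u → P.Tempered u →
      Integrable (fun g => φ g * (u g : ℂ)) μ := by
  induction h with
  | word w =>
    rintro u hu ⟨C, κ, hκ, hC⟩
    refine ⟨((isSmooth_dLWord hf.smooth w).continuous.mul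
      (Complex.continuous_ofReal.comp hu)).aestronglyMeasurable, ?_⟩
    calc ∫⁻ g, ‖P.dLWord w f g * (u g : ℂ)‖ₑ ∂μ
        ≤ ∫⁻ g, C * (‖P.dLWord w f g‖ₑ * P.expDist κ g) ∂μ := lintegral_mono fun g => by
          have e : ‖(u g : ℂ)‖ₑ = ‖u g‖ₑ := by
            rw [enorm_eq_nnnorm, enorm_eq_nnnorm, Complex.nnnorm_real]
          rw [enorm_mul, e, mul_left_comm]
          exact mul_le_mul_right (hC g) _
      _ = C * ∫⁻ g, ‖P.dLWord w f g‖ₑ * P.expDist κ g ∂μ :=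
          lintegral_const_mul' _ _ ENNReal.coe_ne_top
      _ < ⊤ := ENNReal.mul_lt_top ENNReal.coe_lt_top (hf.integrable κ hκ w)
  | add h h' ih ih' =>
    intro u hu hu'
    simp only [add_mul]
    exact (ih hu hu').add (ih' hu hu')
  | const_mul c h ih =>
    intro u hu hu'
    simp only [mul_assoc]
    exact (ih hu hu').const_mul c
  | mul_rep i j h ih =>
    intro u hu hu'
    simp only [mul_assoc, ← Complex.ofReal_mul]
    exact ih ((P.continuous_rep_apply i j).mul hu) ((P.tempered_rep i j).mul hu')
  | mul_rep_inv i j h ih =>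
    intro u hu hu'
    simp only [mul_assoc, ← Complex.ofReal_mul]
    exact ih (((P.continuous_rep_apply i j).comp continuous_inv).mul hu)
      ((P.tempered_rep_inv i j).mul hu')

theorem Amplitude.integrable (hf : P.IsRapidlyDecreasing μ f) {φ : P.G → ℂ}
    (h : P.Amplitude f φ) : Integrable φ μ := by
  simpa using h.integrable_mul hf continuous_const (Tempered.const 1)

theorem Amplitude.continuous (hf : P.IsSmooth f) {φ : P.G → ℂ} (h : P.Amplitude f φ) :
    Continuous φ := (h.isSmooth hf).continuous

end PrehomogeneousSpace.RealPrehomogeneousSpace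

/-! ### Integration by parts on `G` and smoothness of the oscillating integrals. -/

namespace PrehomogeneousSpace.RealPrehomogeneousSpace

variable {k n : ℕ} {P : RealPrehomogeneousSpace k n} [MeasurableSpace P.G] [BorelSpace P.G]
  {μ : Measure P.G} {f : P.G → ℂ}

/-- Integration by parts on `G`: the integral of a derivative along a one parameter group of left
translations vanishes. -/
theorem integral_leftDeriv_eq_zero [μ.IsHaarMeasure] (X : P.lieAlg) {u v : P.G → ℂ}
    (hv : Continuous v)
    (hd : ∀ g, HasDerivAt (fun h : ℝ => u (P.expG X (-h) * g)) (v g) 0)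
    (hu : Integrable u μ) (hvi : Integrable v μ) : ∫ g, v g ∂μ = 0 := by
  have hd' (g : P.G) (t : ℝ) :
      HasDerivAt (fun h : ℝ => u (P.expG X (-h) * g)) (v (P.expG X (-t) * g)) t := by
    have h1 := hd (P.expG X (-t) * g)
    have h2 : HasDerivAt (fun h : ℝ => u (P.expG X (-h) * (P.expG X (-t) * g)))
        (v (P.expG X (-t) * g)) (t - t) := by rwa [sub_self]
    have h3 : HasDerivAt _ ((1 : ℝ) • v (P.expG X (-t) * g)) t :=
      HasDerivAt.scomp (h := fun s : ℝ => s - t) t h2 ((hasDerivAt_id t).sub_const t)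
    rw [one_smul] at h3
    refine h3.congr_of_eventuallyEq (Eventually.of_forall fun s => ?_)
    simp only [Function.comp_apply]
    rw [← mul_assoc, ← expG_add]
    congr 3
    ring
  have hcont : Continuous fun p : ℝ × P.G => v (P.expG X (-p.1) * p.2) :=
    hv.comp (((P.continuous_expG X).comp continuous_fst.neg).mul continuous_snd)
  have hftc (g : P.G) : ∫ s in (0 : ℝ)..1, v (P.expG X (-s) * g) = u (P.expG X (-1) * g) - u g := by
    have h := intervalIntegral.integral_eq_sub_of_hasDerivAt (a := 0) (b := 1)
      (fun t _ => hd' g t) ((hcont.comp (Continuous.prodMk_left g)).intervalIntegrable 0 1)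
    rw [h, neg_zero, expG_zero, one_mul]
  have hprod : Integrable (fun p : ℝ × P.G => v (P.expG X (-p.1) * p.2))
      ((volume.restrict (Set.uIoc (0 : ℝ) 1)).prod μ) := by
    rw [integrable_prod_iff hcont.aestronglyMeasurable]
    refine ⟨Eventually.of_forall fun s => hvi.comp_mul_left (P.expG X (-s)), ?_⟩
    simp only [integral_mul_left_eq_self (μ := μ) (fun g => ‖v g‖)]
    rw [Set.uIoc_of_le zero_le_one]
    exact integrableOn_const (by simp)
  -- Integrate $\int_0^1v(e^{-sX}g)\,ds=u(e^{-X}g)-u(g)$ over `G`: by left invariance the left side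
  -- gives $\int v$ and the right side $0$.
  have hswap := intervalIntegral_integral_swap (f := fun s g => v (P.expG X (-s) * g)) hprod
  simp only [integral_mul_left_eq_self (μ := μ) v, hftc] at hswap
  rw [integral_sub (hu.comp_mul_left (P.expG X (-1))) hu, integral_mul_left_eq_self (μ := μ) u, sub_self] at hswap
  simpa using hswap

/-! ### Integrals with oscillating factors -/

/-- The matrix entries of `ρ(g⁻¹) - 1`. -/
noncomputable def displacement (g : P.G) (s : Fin n × Fin n) : ℝ :=
  P.rep g⁻¹ s.1 s.2 - (1 : Matrix (Fin n) (Fin n) ℝ) s.1 s.2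

/-- The oscillating factor `exp(i ⟨ρ(g⁻¹) - 1, b⟩)`. -/
noncomputable def oscFactor (b : Fin n × Fin n → ℝ) (g : P.G) : ℂ :=
  Complex.exp (Complex.I * ((∑ s, b s * displacement g s : ℝ) : ℂ))

/-- The integral `∫ φ(g) exp(i ⟨ρ(g⁻¹) - 1, b⟩) dμ(g)`. -/
noncomputable def oscInt (μ : Measure P.G) (φ : P.G → ℂ) (b : Fin n × Fin n → ℝ) : ℂ :=
  ∫ g, φ g * oscFactor b g ∂μ

theorem norm_oscFactor (b : Fin n × Fin n → ℝ) (g : P.G) : ‖oscFactor b g‖ = 1 := by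
  rw [oscFactor, mul_comm, Complex.norm_exp_ofReal_mul_I]

theorem continuous_displacement (s : Fin n × Fin n) :
    Continuous fun g : P.G => displacement g s :=
  ((P.continuous_rep_apply s.1 s.2).comp continuous_inv).sub continuous_const

theorem continuous_oscFactor (b : Fin n × Fin n → ℝ) : Continuous fun g : P.G => oscFactor b g := by
  refine Complex.continuous_exp.comp (continuous_const.mul (Complex.continuous_ofReal.comp ?_))
  exact continuous_finsetSum _ fun s _ => continuous_const.mul (continuous_displacement s)

theorem integrable_mul_oscFactor {φ : P.G → ℂ} (hφ : Integrable φ μ) (b : Fin n × Fin n → ℝ) :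
    Integrable (fun g => φ g * oscFactor b g) μ :=
  hφ.mul_bdd (c := 1) (continuous_oscFactor b).aestronglyMeasurable
    (Eventually.of_forall fun g => (norm_oscFactor b g).le)

theorem norm_oscInt_le (φ : P.G → ℂ) (b : Fin n × Fin n → ℝ) :
    ‖oscInt μ φ b‖ ≤ ∫ g, ‖φ g‖ ∂μ := by
  refine (norm_integral_le_integral_norm _).trans (le_of_eq ?_)
  simp [norm_oscFactor]

/-- The amplitude that appears in the derivative of `oscInt`. -/
noncomputable def derivAmplitude (φ : P.G → ℂ) (s : Fin n × Fin n) (g : P.G) : ℂ :=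
  Complex.I * (φ g * P.rep g⁻¹ s.1 s.2) +
    -(Complex.I * (1 : Matrix (Fin n) (Fin n) ℂ) s.1 s.2) * φ g

theorem derivAmplitude_eq (φ : P.G → ℂ) (s : Fin n × Fin n) (g : P.G) :
    derivAmplitude φ s g = Complex.I * φ g * displacement g s := by
  have h : (((1 : Matrix (Fin n) (Fin n) ℝ) s.1 s.2 : ℝ) : ℂ) =
      (1 : Matrix (Fin n) (Fin n) ℂ) s.1 s.2 := by
    simp [Matrix.one_apply, apply_ite]
  rw [derivAmplitude, displacement, Complex.ofReal_sub, h]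
  ring

theorem Amplitude.derivAmplitude {φ : P.G → ℂ} (h : P.Amplitude f φ) (s : Fin n × Fin n) :
    P.Amplitude f (derivAmplitude φ s) :=
  ((h.mul_rep_inv s.1 s.2).const_mul _).add (h.const_mul _)

/-- The coordinate functions, with values in `ℂ`. -/
noncomputable def coordCLM (s : Fin n × Fin n) : (Fin n × Fin n → ℝ) →L[ℝ] ℂ :=
  Complex.ofRealCLM.comp (ContinuousLinearMap.proj s)

/-- The derivative of `b ↦ φ(g) exp(i ⟨ρ(g⁻¹) - 1, b⟩)`. -/
noncomputable def oscFDeriv (φ : P.G → ℂ) (b : Fin n × Fin n → ℝ) (g : P.G) :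
    (Fin n × Fin n → ℝ) →L[ℝ] ℂ :=
  ∑ s, (derivAmplitude φ s g * oscFactor b g) • coordCLM s

theorem hasFDerivAt_mul_oscFactor (φ : P.G → ℂ) (b : Fin n × Fin n → ℝ) (g : P.G) :
    HasFDerivAt (fun b => φ g * oscFactor b g) (oscFDeriv φ b g) b := by
  have h1 : HasFDerivAt (fun b : Fin n × Fin n → ℝ =>
      Complex.I * ((∑ s, b s * displacement g s : ℝ) : ℂ))
      (∑ s, (Complex.I * displacement g s) • coordCLM s) b := by
    have h2 : (fun b : Fin n × Fin n → ℝ =>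
        Complex.I * ((∑ s, b s * displacement g s : ℝ) : ℂ)) =
        ⇑(∑ s, (Complex.I * displacement g s) • coordCLM (n := n) s) := by
      ext1 b
      rw [sum_apply, Complex.ofReal_sum, Finset.mul_sum]
      refine Finset.sum_congr rfl fun s _ => ?_
      rw [smul_apply, smul_eq_mul, Complex.ofReal_mul]
      change _ = Complex.I * displacement g s * (b s : ℂ)
      ring
    rw [h2]
    exact ContinuousLinearMap.hasFDerivAt _
  have h3 := h1.cexp.const_mul (φ g)
  have h4 : oscFDeriv φ b g = φ g • Complex.exp (Complex.I *
      ((∑ s, b s * displacement g s : ℝ) : ℂ)) •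
      ∑ s, (Complex.I * displacement g s) • coordCLM (n := n) s := by
    simp only [oscFDeriv, Finset.smul_sum, smul_smul]
    refine Finset.sum_congr rfl fun s _ => ?_
    rw [derivAmplitude_eq, oscFactor]
    congr 1
    ring
  rw [h4]
  exact h3

theorem norm_oscFDeriv_le (φ : P.G → ℂ) (b : Fin n × Fin n → ℝ) (g : P.G) :
    ‖oscFDeriv φ b g‖ ≤ ∑ s, ‖derivAmplitude φ s g‖ * ‖coordCLM (n := n) s‖ :=
  (norm_sum_le _ _).trans (Finset.sum_le_sum fun s _ => by
    rw [norm_smul, norm_mul, norm_oscFactor, mul_one])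

theorem integrable_oscFDeriv {φ : P.G → ℂ} (hφ : ∀ s, Integrable (derivAmplitude φ s) μ)
    (b : Fin n × Fin n → ℝ) : Integrable (oscFDeriv φ b) μ := by
  have h (s : Fin n × Fin n) : Integrable
      (fun g => (derivAmplitude φ s g * oscFactor b g) • coordCLM (n := n) s) μ :=
    (integrable_mul_oscFactor (hφ s) b).smul_const (coordCLM s)
  exact (integrable_finsetSum Finset.univ fun s _ => (hφ s).norm.mul_const _).mono'
    (Finset.aestronglyMeasurable_fun_sum _ fun s _ => (h s).aestronglyMeasurable)
    (Eventually.of_forall (norm_oscFDeriv_le φ b))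

theorem integral_oscFDeriv {φ : P.G → ℂ} (hφ : ∀ s, Integrable (derivAmplitude φ s) μ)
    (b : Fin n × Fin n → ℝ) :
    ∫ g, oscFDeriv φ b g ∂μ = ∑ s, oscInt μ (derivAmplitude φ s) b • coordCLM s := by
  simp only [oscFDeriv]
  rw [integral_finsetSum _ fun s _ =>
    (integrable_mul_oscFactor (hφ s) b).smul_const (coordCLM s)]
  exact Finset.sum_congr rfl fun s _ => integral_smul_const _ _

theorem hasFDerivAt_oscInt (hf : P.IsRapidlyDecreasing μ f) {φ : P.G → ℂ} (h : P.Amplitude f φ)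
    (b : Fin n × Fin n → ℝ) :
    HasFDerivAt (oscInt μ φ) (∑ s, oscInt μ (derivAmplitude φ s) b • coordCLM s) b := by
  have hint (s : Fin n × Fin n) : Integrable (derivAmplitude φ s) μ :=
    (h.derivAmplitude s).integrable hf
  rw [← integral_oscFDeriv hint b]
  exact hasFDerivAt_integral_of_dominated_of_fderiv_le (𝕜 := ℝ) (μ := μ)
    (F := fun b g => φ g * oscFactor b g) (F' := oscFDeriv φ) (x₀ := b) (s := Set.univ)
    (bound := fun g => ∑ s, ‖derivAmplitude φ s g‖ * ‖coordCLM (n := n) s‖) Filter.univ_mem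
    (Eventually.of_forall fun b =>
      (integrable_mul_oscFactor (h.integrable hf) b).aestronglyMeasurable)
    (integrable_mul_oscFactor (h.integrable hf) b) (integrable_oscFDeriv hint b).aestronglyMeasurable
    (Eventually.of_forall fun g b _ => norm_oscFDeriv_le φ b g)
    (integrable_finsetSum _ fun s _ => (hint s).norm.mul_const _)
    (Eventually.of_forall fun g b _ => hasFDerivAt_mul_oscFactor φ b g)

/-- The partial derivatives are again `oscInt` of amplitudes, so the induction on the order runs
over all amplitudes at once. -/
theorem contDiff_oscInt (hf : P.IsRapidlyDecreasing μ f) {φ : P.G → ℂ} (h : P.Amplitude f φ) :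
    ContDiff ℝ ∞ (oscInt μ φ) := by
  rw [contDiff_infty]
  intro N
  induction N generalizing φ with
  | zero =>
    exact contDiff_zero.2 (continuous_iff_continuousAt.2 fun b =>
      (hasFDerivAt_oscInt hf h b).continuousAt)
  | succ N ih =>
    push_cast
    rw [contDiff_succ_iff_hasFDerivAt]
    exact ⟨_, ContDiff.sum fun s _ => (ih (h.derivAmplitude s)).smul contDiff_const,
      hasFDerivAt_oscInt hf h⟩

/-- The bilinear expression `(ξ_i m_j)_{ij}`. -/
def outer (m ξ : Euc n) (s : Fin n × Fin n) : ℝ := ξ s.1 * m s.2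

theorem contDiff_outer : ContDiff ℝ ∞ fun x : Euc n × Euc n => outer x.1 x.2 := by
  rw [contDiff_pi]
  intro s
  unfold outer
  fun_prop

theorem hasDerivAt_oscFactor_outer (X : P.lieAlg) (m ξ : Euc n) (g : P.G) :
    HasDerivAt (fun h : ℝ => oscFactor (outer m ξ) (P.expG X (-h) * g))
      (oscFactor (outer m ξ) g * (Complex.I * ∑ i, ∑ c, (ξ i : ℂ) * (P.rep g⁻¹ i c : ℂ) *
        ∑ j, P.drep X c j * m j)) 0 := by
  have h1 (s : Fin n × Fin n) := ((P.isSmooth_rep_inv s.1 s.2).hasDerivAt X g).sub_const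
    (((1 : Matrix (Fin n) (Fin n) ℝ) s.1 s.2 : ℝ) : ℂ)
  have h2 := ((HasDerivAt.fun_sum (u := Finset.univ) fun s _ =>
    (h1 s).const_mul ((outer m ξ s : ℝ) : ℂ)).const_mul Complex.I).cexp
  simp only [neg_zero, expG_zero, one_mul, P.dL_rep_inv] at h2
  have e (x : P.G) : oscFactor (outer m ξ) x = Complex.exp (Complex.I *
      ∑ s, ((outer m ξ s : ℝ) : ℂ) * ((P.rep x⁻¹ s.1 s.2 : ℂ) -
        (((1 : Matrix (Fin n) (Fin n) ℝ) s.1 s.2 : ℝ) : ℂ))) := by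
    simp [oscFactor, displacement]
  simp only [e]
  convert h2 using 3
  rw [Fintype.sum_prod_type]
  refine Finset.sum_congr rfl fun i _ => ?_
  simp only [outer, Finset.mul_sum]
  rw [Finset.sum_comm]
  refine Finset.sum_congr rfl fun j _ => Finset.sum_congr rfl fun c _ => ?_
  push_cast
  ring

/-- The derivative of `φ * oscFactor` along $e^{-hX}$ has integral zero. Its phase part contributes
the factor $i\,\xi\cdot\rho(g^{-1})d\rho(X)m$, from `hasDerivAt_oscFactor_outer`. -/
theorem oscInt_dL [μ.IsHaarMeasure] (hf : P.IsRapidlyDecreasing μ f) {φ : P.G → ℂ}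
    (h : P.Amplitude f φ) (X : P.lieAlg) (m ξ : Euc n) :
    ∑ i, ∑ c, ((ξ i : ℂ) * ∑ j, P.drep X c j * m j) *
      oscInt μ (fun g => φ g * P.rep g⁻¹ i c) (outer m ξ) =
    Complex.I * oscInt μ (P.dL X φ) (outer m ξ) := by
  let v (g : P.G) : ℂ := P.dL X φ g * oscFactor (outer m ξ) g + Complex.I * ∑ i, ∑ c,
    ((ξ i : ℂ) * ∑ j, P.drep X c j * m j) * (φ g * P.rep g⁻¹ i c * oscFactor (outer m ξ) g)
  have hA (i c : Fin n) : P.Amplitude f fun g => φ g * P.rep g⁻¹ i c := h.mul_rep_inv i c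
  have hdL := h.dL hf.smooth X
  have hI1 := integrable_mul_oscFactor (hdL.integrable hf) (outer m ξ)
  have hI2 (i c : Fin n) := (integrable_mul_oscFactor ((hA i c).integrable hf)
    (outer m ξ)).const_mul ((ξ i : ℂ) * ∑ j, P.drep X c j * m j)
  have hI3 : Integrable (fun g => ∑ i, ∑ c, ((ξ i : ℂ) * ∑ j, P.drep X c j * m j) *
      (φ g * P.rep g⁻¹ i c * oscFactor (outer m ξ) g)) μ :=
    integrable_finsetSum _ fun i _ => integrable_finsetSum _ fun c _ => hI2 i c
  have hvc : Continuous v := by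
    refine ((hdL.continuous hf.smooth).mul (continuous_oscFactor _)).add (continuous_const.mul ?_)
    exact continuous_finsetSum _ fun i _ => continuous_finsetSum _ fun c _ =>
      continuous_const.mul (((hA i c).continuous hf.smooth).mul (continuous_oscFactor _))
  have h0 := integral_leftDeriv_eq_zero (μ := μ) X (u := fun g => φ g * oscFactor (outer m ξ) g)
    hvc (fun g => by
      have h1 := ((h.isSmooth hf.smooth).hasDerivAt X g).fun_mul
        (hasDerivAt_oscFactor_outer X m ξ g)
      rw [neg_zero, expG_zero, one_mul] at h1
      refine h1.congr_deriv ?_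
      change _ = P.dL X φ g * oscFactor (outer m ξ) g + Complex.I * ∑ i, ∑ c,
        ((ξ i : ℂ) * ∑ j, P.drep X c j * m j) * (φ g * P.rep g⁻¹ i c * oscFactor (outer m ξ) g)
      simp only [Finset.mul_sum]
      congr 1
      refine Finset.sum_congr rfl fun i _ => Finset.sum_congr rfl fun c _ => ?_
      simp only [Finset.sum_mul, Finset.mul_sum]
      exact Finset.sum_congr rfl fun j _ => by ring)
    (integrable_mul_oscFactor (h.integrable hf) _) (hI1.add (hI3.const_mul _))
  simp only [v] at h0
  rw [integral_add hI1 (hI3.const_mul _), integral_const_mul, integral_finsetSum _ fun i _ =>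
    integrable_finsetSum _ fun c _ => hI2 i c] at h0
  simp only [integral_finsetSum _ fun c _ => hI2 _ c, integral_const_mul] at h0
  change oscInt μ (P.dL X φ) (outer m ξ) + Complex.I * ∑ i, ∑ c,
    ((ξ i : ℂ) * ∑ j, P.drep X c j * m j) *
      oscInt μ (fun g => φ g * P.rep g⁻¹ i c) (outer m ξ) = 0 at h0
  have h1 := congrArg (fun z => Complex.I * z) h0
  simp only [mul_add, ← mul_assoc, Complex.I_mul_I, mul_zero] at h1
  linear_combination -h1

end PrehomogeneousSpace.RealPrehomogeneousSpace

/-! ### Rapid decay of the symbol and its derivatives off the singular set. -/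

namespace PrehomogeneousSpace.RealPrehomogeneousSpace

variable {k n : ℕ} {P : RealPrehomogeneousSpace k n} [MeasurableSpace P.G]
  {μ : Measure P.G} {f : P.G → ℂ}

/-- Rapid decay in the second variable, uniformly for the first variable in `U`. -/
def RapidDecayOn (U : Set (Euc n)) (T : Euc n × Euc n → ℂ) : Prop :=
  ∀ N : ℕ, ∃ C : ℝ, ∀ m ∈ U, ∀ ξ, ‖ξ‖ ^ N * ‖T (m, ξ)‖ ≤ C

theorem RapidDecayOn.mono {U V : Set (Euc n)} {T : Euc n × Euc n → ℂ} (h : RapidDecayOn V T)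
    (hUV : U ⊆ V) : RapidDecayOn U T := fun N => by
  obtain ⟨C, hC⟩ := h N
  exact ⟨C, fun m hm => hC m (hUV hm)⟩

theorem RapidDecayOn.union {U V : Set (Euc n)} {T : Euc n × Euc n → ℂ} (h : RapidDecayOn U T)
    (h' : RapidDecayOn V T) : RapidDecayOn (U ∪ V) T := fun N => by
  obtain ⟨C, hC⟩ := h N
  obtain ⟨C', hC'⟩ := h' N
  exact ⟨max C C', fun m hm ξ => hm.elim (fun hm => (hC m hm ξ).trans (le_max_left _ _))
    fun hm => (hC' m hm ξ).trans (le_max_right _ _)⟩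

theorem RapidDecayOn.add {U : Set (Euc n)} {S T : Euc n × Euc n → ℂ} (h : RapidDecayOn U S)
    (h' : RapidDecayOn U T) : RapidDecayOn U fun x => S x + T x := fun N => by
  obtain ⟨C, hC⟩ := h N
  obtain ⟨C', hC'⟩ := h' N
  refine ⟨C + C', fun m hm ξ => ?_⟩
  calc ‖ξ‖ ^ N * ‖S (m, ξ) + T (m, ξ)‖ ≤ ‖ξ‖ ^ N * (‖S (m, ξ)‖ + ‖T (m, ξ)‖) := by
        gcongr; exact norm_add_le _ _
    _ ≤ C + C' := by rw [mul_add]; exact add_le_add (hC m hm ξ) (hC' m hm ξ)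

theorem RapidDecayOn.mul_of_bounded {U : Set (Euc n)} {S T : Euc n × Euc n → ℂ}
    (h : RapidDecayOn U T) {B : ℝ} (hS : ∀ m ∈ U, ∀ ξ, ‖S (m, ξ)‖ ≤ B) :
    RapidDecayOn U fun x => S x * T x := fun N => by
  obtain ⟨C, hC⟩ := h N
  refine ⟨B * C, fun m hm ξ => ?_⟩
  rw [norm_mul, mul_left_comm]
  exact mul_le_mul (hS m hm ξ) (hC m hm ξ) (by positivity) ((norm_nonneg _).trans (hS m hm ξ))

theorem RapidDecayOn.mul_snd {U : Set (Euc n)} {T : Euc n × Euc n → ℂ} (h : RapidDecayOn U T)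
    (i : Fin n) : RapidDecayOn U fun x => (x.2 i : ℂ) * T x := fun N => by
  obtain ⟨C, hC⟩ := h (N + 1)
  refine ⟨C, fun m hm ξ => (le_trans ?_ (hC m hm ξ))⟩
  rw [norm_mul, pow_succ, mul_assoc]
  gcongr
  rw [Complex.norm_real]
  exact PiLp.norm_apply_le ξ i

theorem RapidDecayOn.le_rpow {U : Set (Euc n)} {T : Euc n × Euc n → ℂ} (h : RapidDecayOn U T)
    (l : ℝ) : ∃ C : ℝ, ∀ m ∈ U, ∀ ξ, ‖T (m, ξ)‖ ≤ C * (1 + ‖ξ‖ ^ 2) ^ l := by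
  obtain ⟨N, hN⟩ := exists_nat_ge (-l)
  obtain ⟨C, hC⟩ := h 0
  obtain ⟨C', hC'⟩ := h (2 * N)
  -- From $(1+t)^N\le 2^{N-1}(1+t^N)$ with $t=|\xi|^2$; for $N=0$ the truncated exponent is $0$ and
  -- the bound still holds.
  refine ⟨2 ^ (N - 1) * (C + C'), fun m hm ξ => ?_⟩
  have h1 : 1 ≤ 1 + ‖ξ‖ ^ 2 := by nlinarith [sq_nonneg ‖ξ‖]
  have h2 : (1 + ‖ξ‖ ^ 2) ^ N * ‖T (m, ξ)‖ ≤ 2 ^ (N - 1) * (C + C') := by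
    calc (1 + ‖ξ‖ ^ 2) ^ N * ‖T (m, ξ)‖
        ≤ (2 ^ (N - 1) * (1 ^ N + (‖ξ‖ ^ 2) ^ N)) * ‖T (m, ξ)‖ := by
          gcongr
          exact add_pow_le zero_le_one (by positivity) N
      _ = 2 ^ (N - 1) * (‖ξ‖ ^ 0 * ‖T (m, ξ)‖ + ‖ξ‖ ^ (2 * N) * ‖T (m, ξ)‖) := by
          rw [one_pow, ← pow_mul, pow_zero]; ring
      _ ≤ _ := by gcongr; exacts [hC m hm ξ, hC' m hm ξ]
  have h3 : (1 + ‖ξ‖ ^ 2) ^ (-l) * ‖T (m, ξ)‖ ≤ 2 ^ (N - 1) * (C + C') := by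
    refine le_trans ?_ h2
    gcongr
    exact (Real.rpow_le_rpow_of_exponent_le h1 hN).trans_eq (Real.rpow_natCast _ _)
  rw [Real.rpow_neg (by positivity), inv_mul_le_iff₀ (by positivity)] at h3
  linarith

/-- The functions obtained from the integrals `oscInt` by differentiation. -/
inductive SymTerm (μ : Measure P.G) (f : P.G → ℂ) : (Euc n × Euc n → ℂ) → Prop
  | osc {φ : P.G → ℂ} (h : P.Amplitude f φ) : SymTerm μ f fun x => oscInt μ φ (outer x.1 x.2)
  | add {S T : Euc n × Euc n → ℂ} (hS : SymTerm μ f S) (hT : SymTerm μ f T) :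
      SymTerm μ f fun x => S x + T x
  | const_mul {T : Euc n × Euc n → ℂ} (c : ℂ) (hT : SymTerm μ f T) : SymTerm μ f fun x => c * T x
  | mul_fst {T : Euc n × Euc n → ℂ} (i : Fin n) (hT : SymTerm μ f T) :
      SymTerm μ f fun x => (x.1 i : ℂ) * T x
  | mul_snd {T : Euc n × Euc n → ℂ} (i : Fin n) (hT : SymTerm μ f T) :
      SymTerm μ f fun x => (x.2 i : ℂ) * T x

theorem SymTerm.sum {ι : Type*} (s : Finset ι) {T : ι → Euc n × Euc n → ℂ}
    (h : ∀ i, SymTerm μ f (T i)) : SymTerm μ f fun x => ∑ i ∈ s, T i x := by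
  classical
  induction s using Finset.induction_on with
  | empty =>
    simpa using (SymTerm.osc (μ := μ) (Amplitude.self (P := P) (f := f))).const_mul 0
  | insert i s hi ih =>
    simp only [Finset.sum_insert hi]
    exact (h i).add ih

/-- The coordinates `m_i`, as a linear form on pairs. -/
noncomputable def fstCoord (i : Fin n) : Euc n × Euc n →L[ℝ] ℝ :=
  (EuclideanSpace.proj i).comp (ContinuousLinearMap.fst ℝ _ _)

/-- The coordinates `ξ_i`, as a linear form on pairs. -/
noncomputable def sndCoord (i : Fin n) : Euc n × Euc n →L[ℝ] ℝ :=
  (EuclideanSpace.proj i).comp (ContinuousLinearMap.snd ℝ _ _)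

theorem hasFDerivAt_outer (x : Euc n × Euc n) :
    HasFDerivAt (fun x : Euc n × Euc n => outer x.1 x.2)
      (ContinuousLinearMap.pi fun s : Fin n × Fin n =>
        x.2 s.1 • fstCoord s.2 + x.1 s.2 • sndCoord s.1) x := by
  rw [hasFDerivAt_pi]
  exact fun s => (sndCoord (n := n) s.1).hasFDerivAt.mul (fstCoord (n := n) s.2).hasFDerivAt

/-- By the chain rule through the bilinear `outer`, a derivative of an `oscInt` term is a
combination of `oscInt` terms with one coordinate of $m$ or $\xi$ as factor. Such factors are
harmless for rapid decay on bounded sets of $m$. -/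
theorem SymTerm.hasFDerivAt [BorelSpace P.G] (hf : P.IsRapidlyDecreasing μ f) {T : Euc n × Euc n → ℂ}
    (h : SymTerm μ f T) : ∃ L : Euc n × Euc n → Euc n × Euc n →L[ℝ] ℂ,
      (∀ x, HasFDerivAt T (L x) x) ∧ ∀ d, SymTerm μ f fun x => L x d := by
  induction h with
  | @osc φ h =>
    refine ⟨_, fun x => HasFDerivAt.comp (g := oscInt μ φ) x
      (hasFDerivAt_oscInt hf h (outer x.1 x.2)) (hasFDerivAt_outer x),
      fun d => ?_⟩
    have h1 := SymTerm.sum (Finset.univ : Finset (Fin n × Fin n)) fun s =>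
      (((SymTerm.osc (μ := μ) (h.derivAmplitude s)).mul_snd s.1).const_mul (d.1 s.2 : ℂ)).add
      (((SymTerm.osc (μ := μ) (h.derivAmplitude s)).mul_fst s.2).const_mul (d.2 s.1 : ℂ))
    convert h1 using 2 with x
    rw [ContinuousLinearMap.comp_apply, sum_apply]
    refine Finset.sum_congr rfl fun s _ => ?_
    rw [smul_apply, smul_eq_mul]
    change _ * (((x.2 s.1 * d.1 s.2 + x.1 s.2 * d.2 s.1 : ℝ)) : ℂ) = _
    push_cast
    ring
  | add hS hT ihS ihT =>
    obtain ⟨L, hL, hL'⟩ := ihS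
    obtain ⟨M, hM, hM'⟩ := ihT
    exact ⟨fun x => L x + M x, fun x => (hL x).add (hM x), fun d => (hL' d).add (hM' d)⟩
  | const_mul c hT ih =>
    obtain ⟨L, hL, hL'⟩ := ih
    exact ⟨fun x => c • L x, fun x => (hL x).const_mul c, fun d => (hL' d).const_mul c⟩
  | @mul_fst T i hT ih =>
    obtain ⟨L, hL, hL'⟩ := ih
    refine ⟨_, fun x => (Complex.ofRealCLM.comp (fstCoord i)).hasFDerivAt.mul (hL x), fun d => ?_⟩
    convert ((hL' d).mul_fst i).add (hT.const_mul (d.1 i : ℂ)) using 2 with x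
    rw [add_apply, smul_apply,
      smul_apply, smul_eq_mul, smul_eq_mul, mul_comm (T x)]
    rfl
  | @mul_snd T i hT ih =>
    obtain ⟨L, hL, hL'⟩ := ih
    refine ⟨_, fun x => (Complex.ofRealCLM.comp (sndCoord i)).hasFDerivAt.mul (hL x), fun d => ?_⟩
    convert ((hL' d).mul_snd i).add (hT.const_mul (d.2 i : ℂ)) using 2 with x
    rw [add_apply, smul_apply,
      smul_apply, smul_eq_mul, smul_eq_mul, mul_comm (T x)]
    rfl

theorem SymTerm.contDiff [BorelSpace P.G] (hf : P.IsRapidlyDecreasing μ f)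
    {T : Euc n × Euc n → ℂ} (h : SymTerm μ f T) : ContDiff ℝ ∞ T := by
  induction h with
  | osc h => exact (contDiff_oscInt hf h).comp contDiff_outer
  | add hS hT ihS ihT => exact ihS.add ihT
  | const_mul c hT ih => exact contDiff_const.mul ih
  | mul_fst i hT ih => exact (Complex.ofRealCLM.comp (fstCoord i)).contDiff.mul ih
  | mul_snd i hT ih => exact (Complex.ofRealCLM.comp (sndCoord i)).contDiff.mul ih

theorem SymTerm.iterLineDeriv [BorelSpace P.G] (hf : P.IsRapidlyDecreasing μ f)
    {T : Euc n × Euc n → ℂ} (h : SymTerm μ f T) (vs : List (Euc n × Euc n)) :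
    SymTerm μ f (iterLineDeriv vs T) := by
  induction vs with
  | nil => exact h
  | cons v vs ih =>
    obtain ⟨L, hL, hL'⟩ := ih.hasFDerivAt hf
    convert hL' v using 2 with x
    exact ((hL x).hasLineDerivAt v).lineDeriv

theorem SymTerm.rapidDecayOn {U : Set (Euc n)} (hU : Bornology.IsBounded U)
    (hosc : ∀ φ, P.Amplitude f φ → RapidDecayOn U fun x => oscInt μ φ (outer x.1 x.2))
    {T : Euc n × Euc n → ℂ} (h : SymTerm μ f T) : RapidDecayOn U T := by
  induction h with
  | osc h => exact hosc _ h
  | add hS hT ihS ihT => exact ihS.add ihT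
  | const_mul c hT ih => exact ih.mul_of_bounded (S := fun _ => c) fun _ _ _ => le_rfl
  | mul_fst i hT ih =>
    obtain ⟨B, hB⟩ := hU.exists_norm_le
    refine ih.mul_of_bounded (S := fun x => (x.1 i : ℂ)) (B := B) fun m hm _ => ?_
    rw [Complex.norm_real]
    exact (PiLp.norm_apply_le m i).trans (hB m hm)
  | mul_snd i hT ih => exact ih.mul_snd i

/-- One power of $\xi$ is exchanged for one derivative of the amplitude. Combining `oscInt_dL` for
the `X p` through the right inverse `A` isolates the vector $\xi\cdot\rho(g^{-1})$. Inserting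
$\rho(g)_{cl}$ into the amplitude and summing over `c` cancels $\rho(g^{-1})$ and leaves $\xi_l$. -/
theorem mul_oscInt_eq [BorelSpace P.G] [μ.IsHaarMeasure] (hf : P.IsRapidlyDecreasing μ f)
    {X : Fin n → P.lieAlg} {m : Euc n} {A : Matrix (Fin n) (Fin n) ℂ}
    (hA : (Matrix.of fun c p => ∑ j, P.drep (X p) c j * (m j : ℂ)) * A = 1)
    {φ : P.G → ℂ} (h : P.Amplitude f φ) (ξ : Euc n) (l : Fin n) :
    (ξ l : ℂ) * oscInt μ φ (outer m ξ) = ∑ c, ∑ p, A p c *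
      (Complex.I * oscInt μ (P.dL (X p) fun g => φ g * P.rep g c l) (outer m ξ)) := by
  have h1 (c' : Fin n) {ψ : P.G → ℂ} (hψ : P.Amplitude f ψ) :
      ∑ p, A p c' * (Complex.I * oscInt μ (P.dL (X p) ψ) (outer m ξ)) =
        ∑ i, (ξ i : ℂ) * oscInt μ (fun g => ψ g * P.rep g⁻¹ i c') (outer m ξ) := by
    have h0 (p : Fin n) : A p c' * (Complex.I * oscInt μ (P.dL (X p) ψ) (outer m ξ)) =
        ∑ i, ∑ c, A p c' * (((ξ i : ℂ) * ∑ j, P.drep (X p) c j * (m j : ℂ)) *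
          oscInt μ (fun g => ψ g * P.rep g⁻¹ i c) (outer m ξ)) := by
      rw [← oscInt_dL hf hψ, Finset.mul_sum]
      exact Finset.sum_congr rfl fun i _ => Finset.mul_sum _ _ _
    rw [Finset.sum_congr rfl fun p _ => h0 p, Finset.sum_comm]
    refine Finset.sum_congr rfl fun i _ => ?_
    rw [Finset.sum_comm]
    have h2 (c : Fin n) : ∑ p, (∑ j, P.drep (X p) c j * (m j : ℂ)) * A p c' =
        (1 : Matrix (Fin n) (Fin n) ℂ) c c' := by
      rw [← hA, Matrix.mul_apply]
      rfl
    have h3 (c : Fin n) : ∑ p, A p c' * (((ξ i : ℂ) * ∑ j, P.drep (X p) c j * (m j : ℂ)) *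
        oscInt μ (fun g => ψ g * P.rep g⁻¹ i c) (outer m ξ)) =
        (1 : Matrix (Fin n) (Fin n) ℂ) c c' * ((ξ i : ℂ) *
          oscInt μ (fun g => ψ g * P.rep g⁻¹ i c) (outer m ξ)) := by
      rw [← h2, Finset.sum_mul]
      exact Finset.sum_congr rfl fun p _ => by ring
    simp only [h3, Matrix.one_apply, ite_mul, one_mul, zero_mul]
    simp
  simp only [fun c => h1 c (h.mul_rep c l)]
  rw [Finset.sum_comm]
  have h4 (i : Fin n) : ∑ c, (ξ i : ℂ) *
      oscInt μ (fun g => φ g * P.rep g c l * P.rep g⁻¹ i c) (outer m ξ) =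
      (ξ i : ℂ) * ((1 : Matrix (Fin n) (Fin n) ℂ) i l * oscInt μ φ (outer m ξ)) := by
    rw [← Finset.mul_sum]
    congr 1
    unfold oscInt
    rw [← integral_finsetSum _ fun c _ =>
      integrable_mul_oscFactor (((h.mul_rep c l).mul_rep_inv i c).integrable hf) _,
      ← integral_const_mul]
    refine integral_congr_ae (Eventually.of_forall fun g => ?_)
    have h5 : ((1 : Matrix (Fin n) (Fin n) ℂ) i l) = ∑ c, (P.rep g⁻¹ i c : ℂ) * P.rep g c l := by
      have h6 : (1 : Matrix (Fin n) (Fin n) ℝ) = P.rep g⁻¹ * P.rep g := by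
        rw [← map_mul, inv_mul_cancel, map_one]
      have h7 := congrArg (fun M : Matrix (Fin n) (Fin n) ℝ => ((M i l : ℝ) : ℂ)) h6
      simp only [Matrix.mul_apply, Complex.ofReal_sum, Complex.ofReal_mul] at h7
      rw [← h7, Matrix.one_apply, Matrix.one_apply]
      split_ifs <;> simp
    simp only [h5, Finset.sum_mul]
    exact Finset.sum_congr rfl fun c _ => by ring
  simp only [h4, Matrix.one_apply]
  simp

theorem exists_nhds_rapidDecayOn [BorelSpace P.G] [μ.IsHaarMeasure]
    (hf : P.IsRapidlyDecreasing μ f) {m₀ : Euc n} (hm₀ : m₀ ∉ P.singularR) :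
    ∃ U ∈ 𝓝 m₀, ∀ φ, P.Amplitude f φ → RapidDecayOn U fun x => oscInt μ φ (outer x.1 x.2) := by
  -- The `X p` satisfy $d\rho(X_p)m_0=e_p$, so the matrix `D m` with columns $d\rho(X_p)m$ is the
  -- identity at `m₀` and has a bounded inverse nearby.
  choose X hX using fun p : Fin n =>
    P.exists_drep_mulVec_eq hm₀ (EuclideanSpace.single p (1 : ℝ))
  let D (m : Euc n) : Matrix (Fin n) (Fin n) ℂ :=
    Matrix.of fun c p => ∑ j, P.drep (X p) c j * (m j : ℂ)
  have hD : Continuous D := continuous_matrix fun c p => by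
    change Continuous fun m : Euc n => ∑ j, P.drep (X p) c j * (m j : ℂ)
    fun_prop
  have hD₀ : D m₀ = 1 := by
    ext c p
    change ∑ j, P.drep (X p) c j * (m₀ j : ℂ) = _
    rw [hX, Matrix.one_apply]
    simp only [PiLp.single_apply]
    split_ifs <;> simp
  have hdet : ContinuousAt (fun m => (D m).det) m₀ := hD.matrix_det.continuousAt
  have hdet₀ : (D m₀).det ≠ 0 := by simp [hD₀]
  have hA (p c : Fin n) : ContinuousAt (fun m => ((D m).det)⁻¹ * (D m).adjugate p c) m₀ :=
    (hdet.inv₀ hdet₀).mul ((continuous_apply_apply p c).comp hD.matrix_adjugate).continuousAt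
  have hev : ∀ᶠ m in 𝓝 m₀, (D m).det ≠ 0 ∧ ∀ p c, ‖((D m).det)⁻¹ * (D m).adjugate p c‖ <
      ‖((D m₀).det)⁻¹ * (D m₀).adjugate p c‖ + 1 := by
    refine (hdet.eventually_ne hdet₀).and ?_
    rw [eventually_all]
    intro p
    rw [eventually_all]
    exact fun c => (hA p c).norm.eventually_lt continuousAt_const (lt_add_one _)
  -- The neighbourhood depends neither on `φ` nor on `N`; the induction on `N` may therefore replace
  -- `φ` by the differentiated amplitudes.
  refine ⟨_, hev, fun φ h N => ?_⟩
  induction N generalizing φ with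
  | zero => exact ⟨∫ g, ‖φ g‖ ∂μ, fun m _ ξ => by
      simpa using norm_oscInt_le (μ := μ) φ (outer m ξ)⟩
  | succ N ih =>
    choose C hC using fun p c l : Fin n => ih _ ((h.mul_rep c l).dL hf.smooth (X p))
    refine ⟨∑ l, ∑ c, ∑ p, (‖((D m₀).det)⁻¹ * (D m₀).adjugate p c‖ + 1) * C p c l,
      fun m hm ξ => ?_⟩
    have hinv : D m * (((D m).det)⁻¹ • (D m).adjugate) = 1 := by
      rw [Matrix.mul_smul, Matrix.mul_adjugate, smul_smul, inv_mul_cancel₀ hm.1, one_smul]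
    have h1 : ‖ξ‖ ≤ ∑ l, ‖(ξ l : ℂ)‖ := by
      calc ‖ξ‖ = ‖∑ l, EuclideanSpace.single l (ξ l)‖ := by
            congr 1
            ext i
            simp [Finset.sum_apply, Pi.single_apply]
        _ ≤ _ := (norm_sum_le _ _).trans (le_of_eq (by simp))
    calc ‖ξ‖ ^ (N + 1) * ‖oscInt μ φ (outer m ξ)‖
        ≤ ‖ξ‖ ^ N * (∑ l, ‖(ξ l : ℂ)‖) * ‖oscInt μ φ (outer m ξ)‖ := by
          rw [pow_succ]; gcongr
      _ = ∑ l, ‖ξ‖ ^ N * ‖(ξ l : ℂ) * oscInt μ φ (outer m ξ)‖ := by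
          simp only [Finset.mul_sum, Finset.sum_mul, norm_mul, mul_assoc]
      _ ≤ _ := by
          refine Finset.sum_le_sum fun l _ => ?_
          rw [mul_oscInt_eq hf hinv h ξ l]
          refine (mul_le_mul_of_nonneg_left (norm_sum_le _ _) (by positivity)).trans ?_
          rw [Finset.mul_sum]
          refine Finset.sum_le_sum fun c _ => ?_
          refine (mul_le_mul_of_nonneg_left (norm_sum_le _ _) (by positivity)).trans ?_
          rw [Finset.mul_sum]
          refine Finset.sum_le_sum fun p _ => ?_
          rw [norm_mul, norm_mul, Complex.norm_I, one_mul, mul_left_comm]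
          exact mul_le_mul (hm.2 p c).le (hC p c l m hm ξ) (by positivity) (by positivity)

theorem rapidDecayOn_of_isCompact [BorelSpace P.G] [μ.IsHaarMeasure]
    (hf : P.IsRapidlyDecreasing μ f) {K : Set (Euc n)} (hK : IsCompact K)
    (hKS : ∀ m ∈ K, m ∉ P.singularR) {T : Euc n × Euc n → ℂ} (hT : SymTerm μ f T) :
    RapidDecayOn K T := by
  refine hT.rapidDecayOn hK.isBounded ?_
  refine hK.induction_on (p := fun U => ∀ φ, P.Amplitude f φ →
    RapidDecayOn U fun x => oscInt μ φ (outer x.1 x.2)) ?_ ?_ ?_ ?_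
  · exact fun _ _ _ => ⟨0, fun m hm => hm.elim⟩
  · exact fun s t hst ht φ h => (ht φ h).mono hst
  · exact fun s t hs ht φ h => (hs φ h).union (ht φ h)
  · intro m hm
    obtain ⟨U, hU, h⟩ := exists_nhds_rapidDecayOn (μ := μ) hf (hKS m hm)
    exact ⟨U, mem_nhdsWithin_of_mem_nhds hU, h⟩

end PrehomogeneousSpace.RealPrehomogeneousSpace

/-! ### Membership in the symbol classes. -/

namespace PrehomogeneousSpace

variable {E : Type*} [NormedAddCommGroup E] [NormedSpace ℝ E]

/-- Mixed derivatives of a function that depends on its variables through an affine map are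
derivatives of the original function along the images of the directions under the linear part `A₀`.
-/
theorem iterLineDeriv_comp_affine {F F' : Type*} [NormedAddCommGroup F] [NormedSpace ℝ F]
    [NormedAddCommGroup F'] [NormedSpace ℝ F'] {A : F → F'} {A₀ : F → F'}
    (hA : ∀ x v (t : ℝ), A (x + t • v) = A x + t • A₀ v) (T : F' → ℂ) (vs : List F) :
    iterLineDeriv vs (fun x => T (A x)) = fun x => iterLineDeriv (vs.map A₀) T (A x) := by
  induction vs with
  | nil => rfl
  | cons v vs ih =>
    funext x
    change lineDeriv ℝ (iterLineDeriv vs fun x => T (A x)) x v =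
      lineDeriv ℝ (iterLineDeriv (vs.map A₀) T) (A x) (A₀ v)
    rw [ih]
    simp only [lineDeriv, hA]

theorem iterLineDeriv_const {F : Type*} [NormedAddCommGroup F] [NormedSpace ℝ F] (c : ℂ)
    {vs : List F} (hvs : vs ≠ []) : iterLineDeriv vs (fun _ => c) = fun _ => 0 := by
  induction vs with
  | nil => exact absurd rfl hvs
  | cons v vs ih =>
    funext x
    change lineDeriv ℝ (iterLineDeriv vs fun _ => c) x v = 0
    by_cases h : vs = []
    · subst h
      change lineDeriv ℝ (fun _ => c) x v = 0
      simp [lineDeriv]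
    · rw [ih h]
      simp [lineDeriv]

/-- A function independent of `(x, ξ)` is a symbol of order zero. -/
theorem const_mem_symbolClass {N : ℕ} (c : ℂ) (X : Set E) :
    (fun (_ : E) (_ : Euc N) => c) ∈ SymbolClass 0 X := by
  refine ⟨contDiffOn_const, fun α β K _ _ => ⟨‖c‖, fun x _ ξ => ?_⟩⟩
  change ‖iterLineDeriv _ (fun _ => c) (x, ξ)‖ ≤ _
  by_cases h : α.map (fun w => ((0, w) : E × Euc N)) ++ β.map (fun v => (v, 0)) = []
  · rw [h]
    have hα : α = [] := by simpa using (List.append_eq_nil_iff.1 h).1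
    simp [hα, iterLineDeriv]
  · rw [iterLineDeriv_const c h, norm_zero]
    positivity

namespace RealPrehomogeneousSpace

variable {k n : ℕ} {P : RealPrehomogeneousSpace k n} [MeasurableSpace P.G]
  {μ : Measure P.G} {f : P.G → ℂ}

theorem inner_act_inv (g : P.G) (m ξ : Euc n) :
    inner ℝ (P.act (P.incl g)⁻¹ m) ξ = ∑ i, ∑ j, ξ i * m j * P.rep g⁻¹ i j := by
  simp only [PiLp.inner_apply, act_inv_apply]
  refine Finset.sum_congr rfl fun i _ => ?_
  simp only [RCLike.inner_apply, conj_trivial, Finset.mul_sum]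
  exact Finset.sum_congr rfl fun j _ => by ring

theorem exp_inner_mul_exp_inner (g : P.G) (m ξ : Euc n) :
    Complex.exp (-Complex.I * (inner ℝ m ξ : ℝ)) *
      Complex.exp (Complex.I * (inner ℝ (P.act (P.incl g)⁻¹ m) ξ : ℝ)) =
    oscFactor (outer m ξ) g := by
  rw [oscFactor, ← Complex.exp_add, neg_mul, ← mul_neg, ← mul_add]
  congr 2
  rw [← Complex.ofReal_neg, ← Complex.ofReal_add, inner_act_inv]
  congr 1
  rw [Fintype.sum_prod_type]
  simp only [outer, displacement, mul_sub, Finset.sum_sub_distrib]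
  rw [neg_add_eq_sub]
  congr 1
  rw [PiLp.inner_apply]
  simp [Matrix.one_apply]

theorem symbol_eq_oscInt (m ξ : Euc n) : P.symbol μ f m ξ = oscInt μ f (outer m ξ) := by
  rw [symbol, fHat, oscInt, ← integral_const_mul]
  refine integral_congr_ae (Eventually.of_forall fun g => ?_)
  simp only
  rw [mul_left_comm, exp_inner_mul_exp_inner]

theorem symTerm_symbol : SymTerm μ f fun x => P.symbol μ f x.1 x.2 := by
  simp only [symbol_eq_oscInt]
  exact SymTerm.osc Amplitude.self

variable [BorelSpace P.G]

/-- The base map `p`, with linear part `p₀`, covers three uses at once: the identity, the projection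
$(m,m')\mapsto m$, and a constant map for fixed $m$. -/
theorem comp_symbol_mem_symbolClassNegInfty [μ.IsHaarMeasure] (hf : P.IsRapidlyDecreasing μ f)
    {E : Type*} [NormedAddCommGroup E] [NormedSpace ℝ E] {p p₀ : E → Euc n}
    (hp : ContDiff ℝ ∞ p) (hp₀ : ∀ x v (t : ℝ), p (x + t • v) = p x + t • p₀ v) {X : Set E}
    (hX : ∀ x ∈ X, p x ∉ P.singularR) :
    (fun x ξ => P.symbol μ f (p x) ξ) ∈ SymbolClassNegInfty X := by
  refine fun l => ⟨?_, fun α β K hK hKX => ?_⟩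
  · exact ((symTerm_symbol.contDiff hf).comp
      ((hp.comp contDiff_fst).prodMk contDiff_snd)).contDiffOn
  · have hA : ∀ (x v : E × Euc n) (t : ℝ), (p (x + t • v).1, (x + t • v).2) =
        ((p x.1, x.2) : Euc n × Euc n) + t • ((p₀ v.1, v.2) : Euc n × Euc n) :=
      fun x v t => Prod.ext (hp₀ x.1 v.1 t) rfl
    have h := iterLineDeriv_comp_affine (A := fun x : E × Euc n => (p x.1, x.2))
      (A₀ := fun v : E × Euc n => (p₀ v.1, v.2)) hA (fun x => P.symbol μ f x.1 x.2)
      (α.map (fun w => ((0, w) : E × Euc n)) ++ β.map (fun v => (v, 0)))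
    obtain ⟨C, hC⟩ := (rapidDecayOn_of_isCompact hf (hK.image hp.continuous)
      (by rintro _ ⟨x, hx, rfl⟩; exact hX x (hKX hx)) (symTerm_symbol.iterLineDeriv hf _)).le_rpow
      ((l - α.length) / 2)
    refine ⟨C, fun x hx ξ => ?_⟩
    have h' := congrFun h (x, ξ)
    change iterLineDeriv _ (Function.uncurry fun x ξ => P.symbol μ f (p x) ξ) (x, ξ) = _ at h'
    rw [h']
    exact hC (p x) ⟨x, hx, rfl⟩ ξ

/-- At a fixed point $g^{-1}m=m$, so the two exponentials cancel and the symbol no longer depends on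
$\xi$. -/
theorem symbol_of_mem_fixedR {m : Euc n} (hm : m ∈ P.fixedR) (ξ : Euc n) :
    P.symbol μ f m ξ = ∫ g, f g ∂μ := by
  rw [symbol, fHat, ← integral_const_mul]
  refine integral_congr_ae (Eventually.of_forall fun g => ?_)
  simp only
  rw [hm, mul_left_comm, ← Complex.exp_add]
  simp

end RealPrehomogeneousSpace

end PrehomogeneousSpace

/-! ### Fourier inversion and removal of the cutoff in oscillatory integrals. -/

namespace PrehomogeneousSpace

section Fourier

open scoped FourierTransform BoundedContinuousFunction

variable {n : ℕ} {X : Opens (Euc n)}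

/-- A test function, viewed as a Schwartz function. -/
noncomputable def testToSchwartz (φ : 𝓓(X, ℂ)) : SchwartzMap (Euc n) ℂ :=
  φ.hasCompactSupport.toSchwartzMap φ.contDiff

theorem fourierInt_eq (φ : 𝓓(X, ℂ)) (ξ : Euc n) :
    fourierInt φ ξ = 𝓕 (testToSchwartz φ) ((2 * Real.pi)⁻¹ • ξ) := by
  rw [SchwartzMap.fourier_coe, Real.fourier_eq', fourierInt]
  refine integral_congr_ae (Eventually.of_forall fun y => ?_)
  simp only [smul_eq_mul]
  change _ = _ * φ y
  congr 2
  rw [inner_smul_right]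
  have : (Real.pi : ℂ) ≠ 0 := by exact_mod_cast Real.pi_ne_zero
  push_cast
  field_simp

theorem integrable_test (φ : 𝓓(X, ℂ)) : Integrable φ (volume : Measure (Euc n)) :=
  φ.continuous.integrable_of_hasCompactSupport φ.hasCompactSupport

theorem integrable_fourierInt (φ : 𝓓(X, ℂ)) : Integrable (fourierInt φ) := by
  have h : fourierInt φ = fun ξ => 𝓕 (testToSchwartz φ) ((2 * Real.pi)⁻¹ • ξ) :=
    funext (fourierInt_eq φ)
  rw [h]
  exact (𝓕 (testToSchwartz φ)).integrable.comp_smul (by positivity)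

/-- Fourier inversion for test functions. -/
theorem fourier_inversion (φ : 𝓓(X, ℂ)) (x : Euc n) :
    ((2 * Real.pi : ℝ) : ℂ)⁻¹ ^ n *
      ∫ ξ : Euc n, Complex.exp (Complex.I * (inner ℝ x ξ : ℝ)) * fourierInt φ ξ = φ x := by
  have hc : Continuous (testToSchwartz φ : Euc n → ℂ) := (testToSchwartz φ).continuous
  have h1 := congrFun (hc.fourierInv_fourier_eq (testToSchwartz φ).integrable
    (by rw [← SchwartzMap.fourier_coe]; exact (𝓕 (testToSchwartz φ)).integrable)) x
  rw [Real.fourierInv_eq', ← SchwartzMap.fourier_coe] at h1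
  have h2 := Measure.integral_comp_smul (volume : Measure (Euc n)) (fun v =>
    Complex.exp ((2 * Real.pi * inner ℝ v x : ℝ) * Complex.I) • 𝓕 (testToSchwartz φ) v)
    (2 * Real.pi)⁻¹
  have h3 : (fun ξ : Euc n => Complex.exp (Complex.I * (inner ℝ x ξ : ℝ)) * fourierInt φ ξ) =
      fun ξ => Complex.exp ((2 * Real.pi * inner ℝ ((2 * Real.pi)⁻¹ • ξ) x : ℝ) * Complex.I) •
        𝓕 (testToSchwartz φ) ((2 * Real.pi)⁻¹ • ξ) := by
    funext ξ
    rw [fourierInt_eq, smul_eq_mul, inner_smul_left, real_inner_comm, mul_comm Complex.I]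
    congr 3
    simp only [conj_trivial]
    rw [mul_inv_cancel_left₀ (by positivity)]
  rw [h3, h2, h1, finrank_euclideanSpace_fin, abs_of_pos (by positivity), inv_pow, inv_pow,
    inv_inv, Complex.real_smul]
  change _ * (_ * φ x) = φ x
  have : (Real.pi : ℂ) ≠ 0 := by exact_mod_cast Real.pi_ne_zero
  push_cast
  field_simp

/-- If the inner integral over `x` is integrable in `ξ`, dominated convergence removes the cutoff.
The constant `c` stands for $\chi(\varepsilon\xi)$, which does not depend on `x`. -/
theorem hasOscillatoryIntegral_of_integrable {E : Type*} [NormedAddCommGroup E] [NormedSpace ℝ E]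
    [MeasureSpace E] {N : ℕ} {Φ : E → Euc N → ℝ} {a : E → Euc N → ℂ} {w : E → ℂ} {Q : Euc N → ℂ}
    (hQ : Integrable Q) (h : ∀ (ξ : Euc N) (c : ℂ),
      ∫ x : E, Complex.exp (Complex.I * (Φ x ξ : ℝ)) * c * a x ξ * w x = c * Q ξ) :
    HasOscillatoryIntegral Φ a w (((2 * Real.pi : ℝ) : ℂ)⁻¹ ^ N * ∫ ξ, Q ξ) := by
  intro χ hχ
  refine Tendsto.const_mul _ ?_
  simp only [h]
  obtain ⟨C, hC⟩ := χ.hasCompactSupport.exists_bound_of_continuous χ.continuous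
  refine tendsto_integral_filter_of_dominated_convergence (fun ξ => C * ‖Q ξ‖)
    (Eventually.of_forall fun ε => ?_) (Eventually.of_forall fun ε => ?_) (hQ.norm.const_mul C) ?_
  · exact (χ.continuous.comp (continuous_const_smul ε)).aestronglyMeasurable.mul
      hQ.aestronglyMeasurable
  · refine Eventually.of_forall fun ξ => ?_
    rw [norm_mul]
    exact mul_le_mul_of_nonneg_right (hC _) (norm_nonneg _)
  · refine Eventually.of_forall fun ξ => ?_
    have h1 : Tendsto (fun ε : ℝ => ε • ξ) (𝓝[>] 0) (𝓝 0) := by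
      have : Continuous fun ε : ℝ => ε • ξ := by fun_prop
      exact (this.tendsto' 0 0 (zero_smul ℝ ξ)).mono_left nhdsWithin_le_nhds
    refine tendsto_const_nhds.congr' ?_
    filter_upwards [h1.eventually hχ] with ε hε
    rw [hε, one_mul]

end Fourier

/-! ### Pointwise formulas for $\pi(f)$. -/

namespace RealPrehomogeneousSpace

open scoped BoundedContinuousFunction

variable {k n : ℕ} {P : RealPrehomogeneousSpace k n}

theorem continuous_act_inv {Y : Type*} [TopologicalSpace Y] {u : Y → P.G} {v : Y → Euc n}
    (hu : Continuous u) (hv : Continuous v) : Continuous fun y => P.act (P.incl (u y))⁻¹ (v y) := by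
  have h : Continuous fun y => fun i => P.act (P.incl (u y))⁻¹ (v y) i := by
    refine continuous_pi fun i => ?_
    simp only [act_inv_apply]
    exact continuous_finsetSum _ fun j _ => ((P.continuous_rep_apply i j).comp hu.inv).mul
        ((EuclideanSpace.proj j).continuous.comp hv)
  exact (PiLp.continuous_toLp 2 _).comp h

theorem act_incl_act_inv (g : P.G) (m : Euc n) : P.act (P.incl g) (P.act (P.incl g)⁻¹ m) = m := by
  rw [act_act, mul_inv_cancel, act_one]

/-- Uniformity in `m` gives norm continuity of $g\mapsto\pi(g)\phi$, hence measurability of the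
Bochner integrand defining `piOp`. Off the compact set $L=W\cdot\operatorname{supp}\phi$ both terms
vanish, and on `L` compactness suffices. -/
theorem eventually_forall_dist_act_inv_lt {φ : Euc n → ℂ} (hc : Continuous φ)
    (hφ : HasCompactSupport φ) (g₀ : P.G) {ε : ℝ} (hε : 0 < ε) :
    ∀ᶠ g in 𝓝 g₀, ∀ m, dist (φ (P.act (P.incl g)⁻¹ m)) (φ (P.act (P.incl g₀)⁻¹ m)) < ε := by
  obtain ⟨W, hW, hW₀⟩ := exists_compact_mem_nhds g₀
  obtain ⟨L, hLdef⟩ : ∃ L : Set (Euc n), L =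
    (fun p : P.G × Euc n => P.act (P.incl p.1)⁻¹ p.2) '' (W⁻¹ ×ˢ tsupport φ) := ⟨_, rfl⟩
  have hL : IsCompact L := by
    rw [hLdef]
    exact (hW.inv.prod hφ.isCompact).image (continuous_act_inv continuous_fst continuous_snd)
  have hoff {g : P.G} (hg : g ∈ W) {m : Euc n} (hm : m ∉ L) : φ (P.act (P.incl g)⁻¹ m) = 0 := by
    refine image_eq_zero_of_notMem_tsupport fun h => hm ?_
    rw [hLdef]
    refine ⟨(g⁻¹, P.act (P.incl g)⁻¹ m), ⟨Set.inv_mem_inv.2 hg, h⟩, ?_⟩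
    simp only [map_inv, inv_inv]
    exact act_incl_act_inv g m
  have hcont : Continuous fun p : P.G × Euc n =>
      dist (φ (P.act (P.incl p.1)⁻¹ p.2)) (φ (P.act (P.incl g₀)⁻¹ p.2)) :=
    (hc.comp (continuous_act_inv continuous_fst continuous_snd)).dist
      (hc.comp (continuous_act_inv continuous_const continuous_snd))
  have hev : ∀ᶠ g in 𝓝 g₀, ∀ m ∈ L,
      dist (φ (P.act (P.incl g)⁻¹ m)) (φ (P.act (P.incl g₀)⁻¹ m)) < ε :=
    hL.eventually_forall_of_forall_eventually fun m _ =>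
      hcont.continuousAt.eventually_lt continuousAt_const (by simpa using hε)
  filter_upwards [hev, hW₀] with g hg hgW m
  by_cases hm : m ∈ L
  · exact hg m hm
  · rwa [hoff hgW hm, hoff (mem_of_mem_nhds hW₀) hm, dist_self]

theorem continuous_leftRegular {φ : C₀(Euc n, ℂ)} (hφ : HasCompactSupport φ) :
    Continuous fun g : P.G => P.leftRegular (P.incl g) φ := by
  refine continuous_iff_continuousAt.2 fun g₀ => ?_
  rw [Metric.continuousAt_iff']
  intro ε hε
  filter_upwards [eventually_forall_dist_act_inv_lt φ.continuous hφ g₀ (half_pos hε)] with g hg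
  refine lt_of_le_of_lt ?_ (half_lt_self hε)
  rw [← ZeroAtInftyContinuousMap.dist_toBCF_eq_dist, BoundedContinuousFunction.dist_le
    (half_pos hε).le]
  exact fun m => (hg m).le

/-- Evaluation at a point, on `C₀`. -/
noncomputable def evalC0 (m : Euc n) : C₀(Euc n, ℂ) →L[ℂ] ℂ :=
  LinearMap.mkContinuous
    { toFun := fun φ => φ m
      map_add' := fun _ _ => rfl
      map_smul' := fun _ _ => rfl } 1 fun φ => by
    rw [one_mul, ← ZeroAtInftyContinuousMap.norm_toBCF_eq_norm]
    exact φ.toBCF.norm_coe_le_norm m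

theorem norm_leftRegular_le (g : P.GR) (φ : C₀(Euc n, ℂ)) : ‖P.leftRegular g φ‖ ≤ ‖φ‖ := by
  rw [← ZeroAtInftyContinuousMap.norm_toBCF_eq_norm, BoundedContinuousFunction.norm_le
    (norm_nonneg _)]
  intro m
  rw [← ZeroAtInftyContinuousMap.norm_toBCF_eq_norm (f := φ)]
  exact φ.toBCF.norm_coe_le_norm _

variable [MeasurableSpace P.G] {μ : Measure P.G} {f : P.G → ℂ}

/-- The function `m ↦ ∫ f(g) b(g⁻¹ m) d_G(g)`, for a bounded function `b`. -/
noncomputable def averaged (μ : Measure P.G) (f : P.G → ℂ) (b : Euc n → ℂ) (m : Euc n) : ℂ :=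
  ∫ g, f g * b (P.act (P.incl g)⁻¹ m) ∂μ

variable [BorelSpace P.G]

theorem integrable_mul_act_inv (hf : Integrable f μ) (b : Euc n →ᵇ ℂ) (m : Euc n) :
    Integrable (fun g => f g * b (P.act (P.incl g)⁻¹ m)) μ :=
  hf.mul_bdd (c := ‖b‖) (b.continuous.comp
    (continuous_act_inv continuous_id continuous_const)).aestronglyMeasurable
    (Eventually.of_forall fun _ => b.norm_coe_le_norm _)

/-- Evaluation at `m` is a continuous linear form on $C_0$, so it commutes with the Bochner
integral. -/
theorem piOp_apply (hf : Integrable f μ) {φ : C₀(Euc n, ℂ)} (hφ : HasCompactSupport φ) (m : Euc n) :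
    P.piOp μ f φ m = averaged μ f φ m := by
  have hint : Integrable (fun g => f g • P.leftRegular (P.incl g) φ) μ :=
    hf.smul_bdd ‖φ‖ (continuous_leftRegular hφ).aestronglyMeasurable
      (Eventually.of_forall fun g => norm_leftRegular_le _ _)
  exact ((evalC0 m).integral_comp_comm hint).symm

theorem norm_averaged_le (hf : Integrable f μ) (b : Euc n →ᵇ ℂ) (m : Euc n) :
    ‖averaged μ f b m‖ ≤ (∫ g, ‖f g‖ ∂μ) * ‖b‖ := by
  rw [← integral_mul_const]
  refine norm_integral_le_of_norm_le (hf.norm.mul_const _) (Eventually.of_forall fun g => ?_)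
  rw [norm_mul]
  exact mul_le_mul_of_nonneg_left (b.norm_coe_le_norm _) (norm_nonneg _)

theorem continuous_averaged (hf : Integrable f μ) :
    Continuous fun p : (Euc n →ᵇ ℂ) × Euc n => averaged μ f p.1 p.2 := by
  refine continuous_iff_continuousAt.2 fun p₀ => ?_
  refine continuousAt_of_dominated (bound := fun g => ‖f g‖ * (‖p₀.1‖ + 1))
    (Eventually.of_forall fun p => (integrable_mul_act_inv hf p.1 p.2).aestronglyMeasurable)
    ?_ (hf.norm.mul_const _) (Eventually.of_forall fun g => ?_)
  · have h : ∀ᶠ p : (Euc n →ᵇ ℂ) × Euc n in 𝓝 p₀, ‖p.1‖ < ‖p₀.1‖ + 1 :=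
      continuous_fst.norm.continuousAt.eventually_lt continuousAt_const (lt_add_one _)
    filter_upwards [h] with p hp
    refine Eventually.of_forall fun g => ?_
    rw [norm_mul]
    exact mul_le_mul_of_nonneg_left ((p.1.norm_coe_le_norm _).trans hp.le) (norm_nonneg _)
  · refine (continuous_const.mul ?_).continuousAt
    exact continuous_fst.eval (continuous_act_inv continuous_const continuous_snd)

theorem norm_fHat_le (m ξ : Euc n) : ‖P.fHat μ f m ξ‖ ≤ ∫ g, ‖f g‖ ∂μ := by
  refine (norm_integral_le_integral_norm _).trans (le_of_eq ?_)
  congr 1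
  funext g
  rw [norm_mul, mul_comm Complex.I, Complex.norm_exp_ofReal_mul_I, mul_one]

theorem continuous_exp_act_inv {Y : Type*} [TopologicalSpace Y] {u : Y → P.G} {v w : Y → Euc n}
    (hu : Continuous u) (hv : Continuous v) (hw : Continuous w) : Continuous fun y =>
      Complex.exp (Complex.I * (inner ℝ (P.act (P.incl (u y))⁻¹ (v y)) (w y) : ℝ)) := by
  have h := (continuous_act_inv hu hv).inner (𝕜 := ℝ) hw
  fun_prop

theorem continuous_fHat (hf : Integrable f μ) {Y : Type*} [TopologicalSpace Y]
    [FirstCountableTopology Y] {v w : Y → Euc n} (hv : Continuous v) (hw : Continuous w) :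
    Continuous fun y => P.fHat μ f (v y) (w y) := by
  refine continuous_of_dominated (bound := fun g => ‖f g‖) (fun p => ?_) (fun p => ?_) hf.norm ?_
  · exact hf.aestronglyMeasurable.mul
      (continuous_exp_act_inv continuous_id continuous_const continuous_const).aestronglyMeasurable
  · refine Eventually.of_forall fun g => ?_
    rw [norm_mul, mul_comm Complex.I, Complex.norm_exp_ofReal_mul_I, mul_one]
  · exact Eventually.of_forall fun g => continuous_const.mul
      (continuous_exp_act_inv continuous_const hv hw)

theorem integrable_fHat_mul_fourierInt (hf : Integrable f μ) {X : Opens (Euc n)} (φ : 𝓓(X, ℂ))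
    (m : Euc n) : Integrable fun ξ => P.fHat μ f m ξ * fourierInt φ ξ :=
  (integrable_fourierInt φ).bdd_mul (c := ∫ g, ‖f g‖ ∂μ)
    (continuous_fHat hf continuous_const continuous_id).aestronglyMeasurable
    (Eventually.of_forall fun ξ => norm_fHat_le m ξ)

/-- Fubini, followed for each `g` by Fourier inversion of `φ` at the point $g^{-1}m$. -/
theorem integral_fHat_mul_fourierInt [SFinite μ] (hf : Integrable f μ) {X : Opens (Euc n)}
    (φ : 𝓓(X, ℂ)) (m : Euc n) :
    ((2 * Real.pi : ℝ) : ℂ)⁻¹ ^ n * ∫ ξ, P.fHat μ f m ξ * fourierInt φ ξ =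
      averaged μ f φ m := by
  have hprod : Integrable (fun p : Euc n × P.G => f p.2 *
      Complex.exp (Complex.I * (inner ℝ (P.act (P.incl p.2)⁻¹ m) p.1 : ℝ)) * fourierInt φ p.1)
      (volume.prod μ) := by
    have h1 := (integrable_fourierInt φ).mul_prod hf
    have h2 := h1.mul_bdd (c := 1) (g := fun p : Euc n × P.G =>
      Complex.exp (Complex.I * (inner ℝ (P.act (P.incl p.2)⁻¹ m) p.1 : ℝ)))
      (continuous_exp_act_inv continuous_snd continuous_const continuous_fst).aestronglyMeasurable
      (Eventually.of_forall fun p => by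
        rw [mul_comm Complex.I, Complex.norm_exp_ofReal_mul_I])
    refine h2.congr (Eventually.of_forall fun p => ?_)
    simp only
    ring
  have h3 : ∫ ξ, P.fHat μ f m ξ * fourierInt φ ξ = ∫ ξ, ∫ g, f g *
      Complex.exp (Complex.I * (inner ℝ (P.act (P.incl g)⁻¹ m) ξ : ℝ)) * fourierInt φ ξ ∂μ := by
    simp only [integral_mul_const, fHat]
  rw [h3, integral_integral_swap hprod, ← integral_const_mul]
  refine integral_congr_ae (Eventually.of_forall fun g => ?_)
  simp only
  rw [← fourier_inversion φ (P.act (P.incl g)⁻¹ m), mul_left_comm, ← integral_const_mul (f g)]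
  simp only [mul_assoc]

end RealPrehomogeneousSpace

end PrehomogeneousSpace

/-! ### The phase function, the Fourier integral operator and the Schwartz kernel. -/

namespace PrehomogeneousSpace

theorem isPhaseFunction_inner_sub {n : ℕ} (X : Set (Euc n × Euc n)) :
    IsPhaseFunction X fun p (ξ : Euc n) => (inner ℝ (p.1 - p.2) ξ : ℝ) := by
  have hsmooth : ContDiff ℝ ∞ (Function.uncurry fun (p : Euc n × Euc n) (ξ : Euc n) =>
      (inner ℝ (p.1 - p.2) ξ : ℝ)) := by
    change ContDiff ℝ ∞ fun q : (Euc n × Euc n) × Euc n => (inner ℝ (q.1.1 - q.1.2) q.2 : ℝ)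
    exact (contDiff_fst.fst.sub contDiff_fst.snd).inner ℝ contDiff_snd
  refine ⟨hsmooth.contDiffOn, fun x _ ξ t _ => inner_smul_right _ _ _, fun x _ ξ hξ h => hξ ?_⟩
  -- In the direction that moves $m$ along $\xi$ the phase has derivative $|\xi|^2$, which excludes
  -- critical points.
  have h1 := (((hsmooth.differentiable (by simp)) (x, ξ)).hasFDerivAt.hasLineDerivAt
    ((ξ, 0), 0)).lineDeriv
  rw [h] at h1
  have h2 : HasDerivAt (fun t : ℝ => (inner ℝ (x.1 - x.2) ξ : ℝ) + t * (inner ℝ ξ ξ : ℝ))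
      (inner ℝ ξ ξ : ℝ) 0 := by
    simpa using ((hasDerivAt_id (0 : ℝ)).mul_const (inner ℝ ξ ξ : ℝ)).const_add
      (inner ℝ (x.1 - x.2) ξ : ℝ)
  have h3 : (fun t : ℝ => Function.uncurry (fun (p : Euc n × Euc n) (ξ : Euc n) =>
      (inner ℝ (p.1 - p.2) ξ : ℝ)) ((x, ξ) + t • ((ξ, 0), 0))) =
      fun t : ℝ => (inner ℝ (x.1 - x.2) ξ : ℝ) + t * (inner ℝ ξ ξ : ℝ) := by
    funext t
    simp only [Function.uncurry, Prod.fst_add, Prod.snd_add, Prod.smul_fst, Prod.smul_snd,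
      smul_zero, add_zero]
    rw [add_sub_right_comm, inner_add_left, inner_smul_left]
    rfl
  rw [lineDeriv, h3, h2.deriv] at h1
  exact inner_self_eq_zero.1 h1

/-- The value of `distOf` at a test function, for continuous functions. -/
theorem distOf_apply {E : Type*} [NormedAddCommGroup E] [NormedSpace ℝ E] [MeasurableSpace E]
    [BorelSpace E] {μ : Measure E} [IsLocallyFiniteMeasure μ] {X : Opens E} {h : E → ℂ}
    (hh : Continuous h) (v : 𝓓(X, ℂ)) : distOf μ X h v = ∫ x, v x * h x ∂μ :=
  TestFunction.integralAgainstBilinCLM_eq_integral (B := ContinuousLinearMap.mul ℂ ℂ)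
    (hh.locallyIntegrable.locallyIntegrableOn _)

namespace RealPrehomogeneousSpace

open scoped BoundedContinuousFunction

variable {k n : ℕ} {P : RealPrehomogeneousSpace k n} [MeasurableSpace P.G] [BorelSpace P.G]
  {μ : Measure P.G} {f : P.G → ℂ}

theorem exp_mul_symbol (m ξ : Euc n) :
    Complex.exp (Complex.I * (inner ℝ m ξ : ℝ)) * P.symbol μ f m ξ = P.fHat μ f m ξ := by
  rw [symbol, ← mul_assoc, ← Complex.exp_add, neg_mul, add_neg_cancel, Complex.exp_zero, one_mul]

theorem exp_inner_sub (m m' ξ : Euc n) :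
    Complex.exp (Complex.I * (inner ℝ (m - m') ξ : ℝ)) =
      Complex.exp (Complex.I * (inner ℝ m ξ : ℝ)) *
        Complex.exp (-Complex.I * (inner ℝ m' ξ : ℝ)) := by
  rw [← Complex.exp_add, inner_sub_left]
  congr 1
  push_cast
  ring

theorem hasOscillatoryIntegral_averaged [SFinite μ] (hf : Integrable f μ)
    (φ : 𝓓((⊤ : Opens (Euc n)), ℂ)) (m : Euc n) :
    HasOscillatoryIntegral (fun m' ξ => inner ℝ (m - m') ξ)
      (fun _ ξ => P.symbol μ f m ξ) φ (averaged μ f φ m) := by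
  rw [← integral_fHat_mul_fourierInt hf φ m]
  refine hasOscillatoryIntegral_of_integrable (integrable_fHat_mul_fourierInt hf φ m) fun ξ c => ?_
  rw [fourierInt, ← mul_assoc, ← integral_const_mul]
  refine integral_congr_ae (Eventually.of_forall fun y => ?_)
  simp only
  rw [exp_inner_sub, ← exp_mul_symbol]
  ring

theorem integrable_prod_fHat (hf : Integrable f μ) {X Y : Opens (Euc n)} (v : 𝓓(X, ℂ))
    (u : 𝓓(Y, ℂ)) : Integrable (fun p : Euc n × Euc n =>
      P.fHat μ f p.2 p.1 * (fourierInt u p.1 * v p.2)) (volume.prod volume) :=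
  ((integrable_fourierInt u).mul_prod (integrable_test v)).bdd_mul (c := ∫ g, ‖f g‖ ∂μ)
    (continuous_fHat hf continuous_snd continuous_fst).aestronglyMeasurable
    (Eventually.of_forall fun p => norm_fHat_le p.2 p.1)

theorem hasOscillatoryIntegral_fourierIntegral [SFinite μ] (hf : Integrable f μ)
    {X Y : Opens (Euc n)} (v : 𝓓(X, ℂ)) (u : 𝓓(Y, ℂ)) :
    HasOscillatoryIntegral (fun (p : Euc n × Euc n) ξ => inner ℝ (p.1 - p.2) ξ)
      (fun p ξ => P.symbol μ f p.1 ξ) (fun p => v p.1 * u p.2)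
      (∫ x, v x * averaged μ f u x) := by
  have hprod := integrable_prod_fHat hf v u
  -- Integrating out $m'$ produces the Fourier transform of `u`, integrable in `ξ`; as $\hat f$ is
  -- bounded, the pairing with `v` stays integrable.
  have hQ : Integrable fun ξ => (∫ x, P.fHat μ f x ξ * v x) * fourierInt u ξ := by
    refine hprod.integral_prod_left.congr (Eventually.of_forall fun ξ => ?_)
    simp only
    rw [← integral_mul_const]
    refine integral_congr_ae (Eventually.of_forall fun x => ?_)
    simp only
    ring
  have e : ∫ x, v x * averaged μ f u x = ((2 * Real.pi : ℝ) : ℂ)⁻¹ ^ n *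
      ∫ ξ, (∫ x, P.fHat μ f x ξ * v x) * fourierInt u ξ := by
    have h1 : ∫ ξ, (∫ x, P.fHat μ f x ξ * v x) * fourierInt u ξ =
        ∫ ξ, ∫ x, P.fHat μ f x ξ * (fourierInt u ξ * v x) := by
      refine integral_congr_ae (Eventually.of_forall fun ξ => ?_)
      simp only
      rw [← integral_mul_const]
      refine integral_congr_ae (Eventually.of_forall fun x => ?_)
      simp only
      ring
    rw [h1, integral_integral_swap hprod, ← integral_const_mul]
    refine integral_congr_ae (Eventually.of_forall fun x => ?_)
    simp only
    rw [← integral_fHat_mul_fourierInt hf u x, mul_left_comm, ← integral_const_mul (v x)]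
    congr 1
    refine integral_congr_ae (Eventually.of_forall fun ξ => ?_)
    simp only
    ring
  rw [e]
  refine hasOscillatoryIntegral_of_integrable hQ fun ξ c => ?_
  have h2 := integral_prod_mul (μ := (volume : Measure (Euc n))) (ν := (volume : Measure (Euc n)))
    (fun x => P.fHat μ f x ξ * v x) fun y => Complex.exp (-Complex.I * (inner ℝ y ξ : ℝ)) * u y
  rw [fourierInt, ← h2, ← integral_const_mul]
  refine integral_congr_ae (Eventually.of_forall fun p => ?_)
  simp only
  rw [exp_inner_sub, ← exp_mul_symbol]
  ring

/-- The distribution `φ ↦ ∫ f(g) φ(g⁻¹ m) d_G(g)`. -/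
noncomputable def averagedCLM (hf : Integrable f μ) (m : Euc n) : (Euc n →ᵇ ℂ) →L[ℂ] ℂ :=
  LinearMap.mkContinuous
    { toFun := fun b => averaged μ f b m
      map_add' := fun b c => by
        rw [averaged, averaged, averaged, ← integral_add (integrable_mul_act_inv hf b m)
          (integrable_mul_act_inv hf c m)]
        refine integral_congr_ae (Eventually.of_forall fun g => ?_)
        exact mul_add _ _ _
      map_smul' := fun a b => by
        rw [averaged, averaged, RingHom.id_apply, smul_eq_mul, ← integral_const_mul]
        refine integral_congr_ae (Eventually.of_forall fun g => ?_)
        exact mul_left_comm _ _ _ } (∫ g, ‖f g‖ ∂μ) fun b => norm_averaged_le hf b m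

/-- The kernel `𝒦_{f,m}`. -/
noncomputable def kernelAt (hf : Integrable f μ) (m : Euc n) : CDist (⊤ : Opens (Euc n)) :=
  ContinuousLinearMap.toUniformConvergenceCLM _ _ _
    ((averagedCLM hf m).comp (TestFunction.toBoundedContinuousFunctionCLM ℂ))

theorem kernelAt_apply (hf : Integrable f μ) (m : Euc n) (φ : 𝓓((⊤ : Opens (Euc n)), ℂ)) :
    kernelAt hf m φ = averaged μ f φ m := rfl

/-- Convergence in `CDist` is uniform convergence on compact sets of test functions, and
$(m,\phi)\mapsto\mathcal K_{f,m}(\phi)$ is jointly continuous. -/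
theorem continuous_kernelAt (hf : Integrable f μ) : Continuous (kernelAt (P := P) (μ := μ) hf) := by
  refine continuous_iff_continuousAt.2 fun m₀ => ?_
  refine (UniformConvergenceCLM.tendsto_iff_tendstoUniformlyOn _ _ _).2 fun S hS => ?_
  rw [Metric.tendstoUniformlyOn_iff]
  intro ε hε
  have hS' : IsCompact S := hS
  have hc : Continuous fun p : Euc n × 𝓓((⊤ : Opens (Euc n)), ℂ) =>
      dist (kernelAt (P := P) (μ := μ) hf m₀ p.2) (kernelAt hf p.1 p.2) := by
    have h (v : Euc n × 𝓓((⊤ : Opens (Euc n)), ℂ) → Euc n) (hv : Continuous v) :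
        Continuous fun p : Euc n × 𝓓((⊤ : Opens (Euc n)), ℂ) =>
          kernelAt (P := P) (μ := μ) hf (v p) p.2 :=
      (continuous_averaged hf).comp
        (((TestFunction.toBoundedContinuousFunctionCLM ℂ).continuous.comp continuous_snd).prodMk hv)
    exact (h _ continuous_const).dist (h _ continuous_fst)
  exact hS'.eventually_forall_of_forall_eventually fun φ _ =>
    hc.continuousAt.eventually_lt continuousAt_const (by simpa using hε)

/-- Restriction of a bounded function on the product to `{m} × V`. -/
noncomputable def sliceBCF (b : (Euc n × Euc n) →ᵇ ℂ) (m : Euc n) : Euc n →ᵇ ℂ :=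
  b.compContinuous ⟨fun y => (m, y), Continuous.prodMk_right m⟩

theorem norm_sliceBCF_le (b : (Euc n × Euc n) →ᵇ ℂ) (m : Euc n) : ‖sliceBCF b m‖ ≤ ‖b‖ :=
  (BoundedContinuousFunction.norm_le (norm_nonneg _)).2 fun _ => b.norm_coe_le_norm _

theorem continuous_averaged_sliceBCF (hf : Integrable f μ) (b : (Euc n × Euc n) →ᵇ ℂ) :
    Continuous fun m => averaged μ f (sliceBCF b m) m := by
  refine continuous_of_dominated (bound := fun g => ‖f g‖ * ‖b‖)
    (fun m => (integrable_mul_act_inv hf (sliceBCF b m) m).aestronglyMeasurable)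
    (fun m => Eventually.of_forall fun g => ?_) (hf.norm.mul_const _)
    (Eventually.of_forall fun g => ?_)
  · rw [norm_mul]
    exact mul_le_mul_of_nonneg_left (b.norm_coe_le_norm _) (norm_nonneg _)
  · exact continuous_const.mul (b.continuous.comp
      (continuous_id.prodMk (continuous_act_inv continuous_const continuous_id)))

/-- The form `b ↦ ∫_L ∫ f(g) b(m, g⁻¹ m) d_G(g) dm`, for a compact set `L`. -/
noncomputable def kernelCLM (hf : Integrable f μ) {L : Set (Euc n)} (hL : IsCompact L) :
    ((Euc n × Euc n) →ᵇ ℂ) →L[ℂ] ℂ :=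
  have hint (b : (Euc n × Euc n) →ᵇ ℂ) :
      IntegrableOn (fun m => averaged μ f (sliceBCF b m) m) L :=
    (continuous_averaged_sliceBCF hf b).continuousOn.integrableOn_compact hL
  LinearMap.mkContinuous
    { toFun := fun b => ∫ m in L, averaged μ f (sliceBCF b m) m
      map_add' := fun b c => by
        rw [← integral_add (hint b) (hint c)]
        refine integral_congr_ae (Eventually.of_forall fun m => ?_)
        exact (averagedCLM hf m).map_add (sliceBCF b m) (sliceBCF c m)
      map_smul' := fun a b => by
        rw [RingHom.id_apply, smul_eq_mul, ← integral_const_mul]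
        refine integral_congr_ae (Eventually.of_forall fun m => ?_)
        exact (averagedCLM hf m).map_smul a (sliceBCF b m) }
    ((∫ g, ‖f g‖ ∂μ) * volume.real L) fun b => by
      have h := norm_setIntegral_le_of_norm_le_const (μ := volume) (s := L)
        (f := fun m => averaged μ f (sliceBCF b m) m) (C := (∫ g, ‖f g‖ ∂μ) * ‖b‖)
        hL.measure_lt_top fun m _ => (norm_averaged_le hf _ m).trans
          (mul_le_mul_of_nonneg_left (norm_sliceBCF_le b m)
            (integral_nonneg fun g => norm_nonneg _))
      exact h.trans_eq (mul_right_comm _ _ _)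

/-- The Schwartz kernel `Ψ ↦ ∫ 𝒦_{f,m}(Ψ(m, ·)) dm`. -/
noncomputable def schwartzKernel (hf : Integrable f μ) : CDist (⊤ : Opens (Euc n × Euc n)) :=
  ContinuousLinearMap.toUniformConvergenceCLM _ _ _
    -- Continuity is checked on test functions supported in a fixed compact `K`. There the integral
    -- over `m` may be restricted to the projection of `K`, which gives a form bounded in the sup
    -- norm.
    (TestFunction.limitCLM ℂ (fun Ψ => ∫ m, kernelAt (P := P) (μ := μ) hf m (slice Ψ m))
      (fun K _ => (kernelCLM hf (K.isCompact.image continuous_fst)).comp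
        (ContDiffMapSupportedIn.toBoundedContinuousFunctionCLM ℂ))
      fun K hK Ψ => by
        symm
        refine setIntegral_eq_integral_of_forall_compl_eq_zero fun m hm => ?_
        refine integral_eq_zero_of_ae (Eventually.of_forall fun g => ?_)
        refine mul_eq_zero_of_right _ (Ψ.zero_on_compl fun h => hm ⟨_, h, rfl⟩))

theorem schwartzKernel_apply (hf : Integrable f μ) (Ψ : 𝓓((⊤ : Opens (Euc n × Euc n)), ℂ)) :
    schwartzKernel (P := P) (μ := μ) hf Ψ = ∫ m, kernelAt hf m (slice Ψ m) := rfl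

theorem piDist_apply (hf : Integrable f μ) {X Y : Opens (Euc n)} (u : 𝓓(Y, ℂ)) (v : 𝓓(X, ℂ)) :
    P.piDist μ f X Y u v = ∫ x, v x * averaged μ f u x := by
  rw [piDist, distOf_apply (h := P.piOp μ f (testToC0 u))
    (map_continuous (P.piOp μ f (testToC0 u)))]
  simp only [piOp_apply hf (φ := testToC0 u) u.hasCompactSupport]
  rfl

theorem isSchwartzKernel_schwartzKernel (hf : Integrable f μ) :
    IsSchwartzKernel (P.piDist μ f ⊤ ⊤) (schwartzKernel hf) := by
  intro u v
  rw [piDist_apply hf, schwartzKernel_apply]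
  refine integral_congr_ae (Eventually.of_forall fun m => ?_)
  simp only [kernelAt_apply, averaged]
  rw [← integral_const_mul]
  refine integral_congr_ae (Eventually.of_forall fun g => ?_)
  exact mul_left_comm _ _ _

end RealPrehomogeneousSpace

end PrehomogeneousSpace

/-! ### Assembly of the theorem. -/

open RealPrehomogeneousSpace

/-- Here `k` is the size of the matrices in `G_ℂ`, and `n` the dimension of `V_ℂ`. -/
theorem theorem5p1 {k n : ℕ} (P : RealPrehomogeneousSpace k n)
    [MeasurableSpace P.G] [BorelSpace P.G] (μ : Measure P.G) [μ.IsHaarMeasure]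
    (hfixed : P.singularR = P.fixedR) (f : P.G → ℂ) (hf : P.IsRapidlyDecreasing μ f) :
    -- `π(f)φ(m) = ∫∫ e^{i(m - m')·ξ} a_f(m, ξ) φ(m') dm' đξ`
    (∀ (φ : 𝓓((⊤ : Opens (Euc n)), ℂ)) (m : Euc n),
      HasOscillatoryIntegral (fun m' ξ => inner ℝ (m - m') ξ)
        (fun _ ξ => P.symbol μ f m ξ) φ (P.piOp μ f (testToC0 φ) m)) ∧
    -- `a_f(m, ξ) ∈ S^0_{1,0}(V_{m'} × V^*)` for each `m`
    (∀ m : Euc n,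
      (fun (_ : Euc n) (ξ : Euc n) => P.symbol μ f m ξ) ∈ SymbolClass 0 Set.univ) ∧
    -- `a_f(m, ξ) ∈ S^{-∞}(V_{m'} × V^*)` for each `m ∉ F_ℝ`
    (∀ m : Euc n, m ∉ P.fixedR →
      (fun (_ : Euc n) (ξ : Euc n) => P.symbol μ f m ξ) ∈ SymbolClassNegInfty Set.univ) ∧
    -- the Schwartz kernel is given by a continuous family `m ↦ 𝒦 m` of oscillatory integrals
    (∃ 𝒦 : Euc n → CDist (⊤ : Opens (Euc n)),
      Continuous 𝒦 ∧
      (∀ (m : Euc n) (φ : 𝓓((⊤ : Opens (Euc n)), ℂ)),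
        HasOscillatoryIntegral (fun m' ξ => inner ℝ (m - m') ξ)
          (fun _ ξ => P.symbol μ f m ξ) φ (𝒦 m φ)) ∧
      ∃ K : CDist (⊤ : Opens (Euc n × Euc n)),
        IsSchwartzKernel (P.piDist μ f ⊤ ⊤) K ∧
        ∀ Ψ : 𝓓((⊤ : Opens (Euc n × Euc n)), ℂ),
          K Ψ = ∫ m, 𝒦 m (slice Ψ m)) ∧
    -- `a_f(m, ξ) ∈ S^{-∞}((V_ℝ - F_ℝ)_m × V_{m'} × V^*)`
    ((fun (p : Euc n × Euc n) (ξ : Euc n) => P.symbol μ f p.1 ξ) ∈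
      SymbolClassNegInfty ((P.complFixed : Set (Euc n)) ×ˢ Set.univ)) ∧
    -- `π(f) : C_c^∞(V_ℝ) → 𝒟'(V_ℝ - F_ℝ)` is a Fourier integral operator
    IsFourierIntegralOperator (X := P.complFixed) (Y := ⊤)
      (fun p (ξ : Euc n) => inner ℝ (p.1 - p.2) ξ)
      (fun p ξ => P.symbol μ f p.1 ξ) (P.piDist μ f P.complFixed ⊤) ∧
    -- `π(f) ∈ L^{-∞}(V_ℝ - F_ℝ)`
    IsSmoothingOperator P.complFixed
      (fun φ m => P.piOp μ f (testToC0 φ) m) := by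
  have hfi : Integrable f μ := Amplitude.self.integrable hf
  -- The assumption $S_{\mathbb R}=F_{\mathbb R}$ enters here: off the fixed points the orbit maps
  -- are submersive and the symbol decays rapidly.
  have hX : ∀ x ∈ (P.complFixed : Set (Euc n)), x ∉ P.singularR := fun x hx h => hx (hfixed ▸ h)
  have hjoint : (fun (p : Euc n × Euc n) (ξ : Euc n) => P.symbol μ f p.1 ξ) ∈
      SymbolClassNegInfty ((P.complFixed : Set (Euc n)) ×ˢ Set.univ) :=
    comp_symbol_mem_symbolClassNegInfty hf (p := Prod.fst) (p₀ := Prod.fst) contDiff_fst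
      (fun _ _ _ => rfl) fun x hx => hX x.1 hx.1
  have hout (m : Euc n) (hm : m ∉ P.fixedR) :
      (fun (_ : Euc n) (ξ : Euc n) => P.symbol μ f m ξ) ∈ SymbolClassNegInfty Set.univ :=
    comp_symbol_mem_symbolClassNegInfty hf (p := fun _ => m) (p₀ := fun _ => 0) contDiff_const
      (fun _ _ _ => by simp) fun _ _ => hX m hm
  have hosc (φ : 𝓓((⊤ : Opens (Euc n)), ℂ)) (m : Euc n) :=
    hasOscillatoryIntegral_averaged (P := P) hfi φ m
  refine ⟨fun φ m => ?_, fun m => ?_, hout, ⟨kernelAt hfi, continuous_kernelAt hfi,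
    fun m φ => hosc φ m, schwartzKernel hfi, isSchwartzKernel_schwartzKernel hfi,
    fun Ψ => schwartzKernel_apply hfi Ψ⟩, hjoint,
    ⟨isPhaseFunction_inner_sub _, ⟨0, by simpa using hjoint 0⟩, fun u v => ?_⟩, fun l =>
    ⟨P.symbol μ f, ?_, fun u x _ => ?_⟩⟩
  · rw [piOp_apply hfi (φ := testToC0 φ) φ.hasCompactSupport]
    exact hosc φ m
  -- Order $0$ arises from the constants at fixed points; elsewhere $S^{-\infty}\subset S^0$.
  · by_cases hm : m ∈ P.fixedR
    · simp only [symbol_of_mem_fixedR hm]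
      exact const_mem_symbolClass _ _
    · exact hout m hm 0
  · rw [piDist_apply hfi]
    exact hasOscillatoryIntegral_fourierIntegral hfi v u
  · exact comp_symbol_mem_symbolClassNegInfty hf (p := id) (p₀ := id) contDiff_id
      (fun _ _ _ => rfl) hX l
  · refine (piOp_apply hfi (φ := testToC0 u) u.hasCompactSupport x).trans ?_
    simp only [exp_mul_symbol]
    exact (integral_fHat_mul_fourierInt hfi u x).symm
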